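/- Graphs are finite, undirected and connected, have at least two vertices, and may have loops and parallel edges. A graph $G=(V,E)$ is the \emph{homomorphic image} of a graph $H=(W,F)$ by an onto map $\phi:W\to V$ if for all $u,v\in V$ (possibly $u=v$) the number of edges of $G$ between $u$ and $v$ equals the number of edges of $H$ whose endpoints are mapped by $\phi$ to $\{u,v\}$. A vector $\mu\in\mathbb{Z}_{\ge 0}^V$ is a \emph{feasible split vector} of $G$ if there are a connected graph $H=(W,F)$ and an onto map $\phi:W\to V$ such that $G$ is the homomorphic image of $H$ by $\phi$ and $|\phi^{-1}(v)|=\mu(v)+1$ for all $v\in V$. A \emph{polymatroid} over a finite set $N$ is a polytope of the form $\{x\in\mathbb{R}^N_{\ge 0} \mid x(S)\le f(S)\ \forall S\subseteq N\}$, where $f:2^N\to\mathbb{Z}_{\ge 0}$ is submodular. \textbf{Theorem.} For every graph $G=(V,E)$, the polytope $$P_G:=\operatorname{conv}\{\mu\in\mathbb{Z}_{\ge 0}^V \mid \mu \text{ is a feasible split vector of } G\}$$ is a polymatroid, and its integral points are exactly the feasible split vectors of $G$. Furthermore, there is a polynomial-time algorithm that, given $G$ and weights $w\in\mathbb{Z}^V$,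 returns an integral point of $P_G$ that maximizes $w^\top x$ over $x\in P_G$; and there is a polynomial-time algorithm that, given $G$ and a feasible split vector $\mu$ of $G$, returns a connected graph $H=(W,F)$ and an onto map $\phi:W\to V$ such that $G$ is the homomorphic image of $H$ by $\phi$ and $|\phi^{-1}(v)|=\mu(v)+1$ for all $v\in V$. -/

import Mathlib

open scoped Graph

/-! ## Homomorphic images and split vectors

Graphs are Mathlib's multigraphs `Graph α β`: loops and parallel edges are allowed. -/

namespace KTrail

/-- A graph is connected if its underlying simple graph (loops and multiplicities of edges
forgotten) is connected. -/
def Connected {α β : Type*} (G : Graph α β) : Prop :=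
  G.toSimpleGraph.Connected

/-- The graphs under consideration: finite, connected, with at least two vertices. -/
structure IsAdmissible {α β : Type*} (G : Graph α β) : Prop where
  finite_vertexSet : V(G).Finite
  finite_edgeSet : E(G).Finite
  connected : Connected G
  two_le : 2 ≤ V(G).ncard

/-- `G` is the homomorphic image of `H` by `φ`: the map `φ` is onto, and for all vertices `u`, `v`
of `G` (possibly equal), the number of edges of `G` between `u` and `v` equals the number of edges
of `H` whose endpoints get mapped to `{u, v}`. -/
def IsHomImage {α β α' β' : Type*} (G : Graph α β) (H : Graph α' β') (φ : V(H) → V(G)) : Prop :=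
  Function.Surjective φ ∧
    ∀ u v : V(G), {e : β | G.IsLink e u v}.encard =
      {f : β' | ∃ x y : V(H), H.IsLink f x y ∧ φ x = u ∧ φ y = v}.encard

/-- `H` and `φ` certify the multiplicity vector `mult`: the graph `H` is connected, `G` is the
homomorphic image of `H` by `φ`, and every vertex `v` of `G` has exactly `mult v` preimages. -/
def Certifies {α β α' β' : Type*} (G : Graph α β) (mult : V(G) → ℕ) (H : Graph α' β')
    (φ : V(H) → V(G)) : Prop :=
  Connected H ∧ IsHomImage G H φ ∧ ∀ v : V(G), (φ ⁻¹' {v}).encard = mult v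

/-- Feasible multiplicity vectors. If `G` is finite, every certifying `H` is finite, so it is
enough to let `H` range over graphs whose vertices and edges are taken from types in `Type`. -/
def IsFeasibleMultiplicity {α β : Type*} (G : Graph α β) (mult : V(G) → ℕ) : Prop :=
  ∃ (α' β' : Type) (H : Graph α' β') (φ : V(H) → V(G)), Certifies G mult H φ

/-- Feasible split vectors: adding one to every entry gives a feasible multiplicity vector. -/
def IsFeasibleSplit {α β : Type*} (G : Graph α β) (μ : V(G) → ℕ) : Prop :=
  IsFeasibleMultiplicity G (fun v => μ v + 1)

/-- The feasible split vectors as points of `ℝ^V(G)`. -/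
def splitPoints {α β : Type*} (G : Graph α β) : Set (V(G) → ℝ) :=
  {x | ∃ μ : V(G) → ℕ, IsFeasibleSplit G μ ∧ ∀ v, x v = (μ v : ℝ)}

/-- The polytope `P_G`: the convex hull of the feasible split vectors. -/
def splitPolytope {α β : Type*} (G : Graph α β) : Set (V(G) → ℝ) :=
  convexHull ℝ (splitPoints G)

/-- The integral points of a set of real vectors. -/
def integralPoints {N : Type*} (P : Set (N → ℝ)) : Set (N → ℝ) :=
  {x ∈ P | ∀ i, ∃ k : ℤ, x i = (k : ℝ)}

/-- `P` is a polymatroid: `P = {x ≥ 0 | x(S) ≤ f(S) for all S}` for some submodular set function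
`f` with values in the nonnegative integers. -/
def IsPolymatroid {N : Type*} (P : Set (N → ℝ)) : Prop :=
  open scoped Classical in
  ∃ f : Finset N → ℕ, (∀ S T : Finset N, f (S ∪ T) + f (S ∩ T) ≤ f S + f T) ∧
    P = {x : N → ℝ | (∀ i, 0 ≤ x i) ∧ ∀ S : Finset N, ∑ i ∈ S, x i ≤ (f S : ℝ)}

/-! ## Random access machines and polynomial time

The machine model is a structured random access machine. Its memory consists of arrays numbered
by `ℕ` (a fixed program uses only finitely many of them), whose cells are addressed by integers
and hold integers. Arithmetic is addition and subtraction; there is no multiplication, so that in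
`t` steps the bit lengths of numbers grow by `O(t)` only, and polynomial running time with unit
costs is the same as polynomial running time on a Turing machine. -/

/-- Memory contents: `s a k` is the content of cell `k` of array `a`. -/
abbrev Store := ℕ → ℤ → ℤ

/-- Integer expressions of the programming language. -/
inductive Expr : Type
  | const (k : ℤ)
  | read (a : ℕ) (i : Expr)
  | add (e₁ e₂ : Expr)
  | sub (e₁ e₂ : Expr)

/-- The value of an expression. -/
def Expr.eval (s : Store) : Expr → ℤ
  | .const k => k
  | .read a i => s a (i.eval s)
  | .add e₁ e₂ => e₁.eval s + e₂.eval s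
  | .sub e₁ e₂ => e₁.eval s - e₂.eval s

/-- Programs. Tests have the form `0 < e`. -/
inductive Program : Type
  | skip
  | write (a : ℕ) (i e : Expr)
  | seq (c₁ c₂ : Program)
  | ite (e : Expr) (c₁ c₂ : Program)
  | loop (e : Expr) (c : Program)

/-- The store with cell `k` of array `a` overwritten by `x`. -/
def Store.set (s : Store) (a : ℕ) (k x : ℤ) : Store :=
  fun b j => if b = a ∧ j = k then x else s b j

/-- `Exec c s s' t`: started in `s`, the program `c` halts in `s'` after `t` steps. A step is the
execution of `skip`, an assignment, or the evaluation of a test; the expressions in a fixed program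
have bounded size. -/
inductive Exec : Program → Store → Store → ℕ → Prop
  | skip (s : Store) : Exec .skip s s 1
  | write (a : ℕ) (i e : Expr) (s : Store) :
      Exec (.write a i e) s (s.set a (i.eval s) (e.eval s)) 1
  | seq {c₁ c₂ : Program} {s₁ s₂ s₃ : Store} {t₁ t₂ : ℕ} :
      Exec c₁ s₁ s₂ t₁ → Exec c₂ s₂ s₃ t₂ → Exec (.seq c₁ c₂) s₁ s₃ (t₁ + t₂)
  | ite_pos {e : Expr} {c₁ c₂ : Program} {s s' : Store} {t : ℕ} :
      0 < e.eval s → Exec c₁ s s' t → Exec (.ite e c₁ c₂) s s' (t + 1)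
  | ite_neg {e : Expr} {c₁ c₂ : Program} {s s' : Store} {t : ℕ} :
      ¬ 0 < e.eval s → Exec c₂ s s' t → Exec (.ite e c₁ c₂) s s' (t + 1)
  | loop_done {e : Expr} {c : Program} {s : Store} :
      ¬ 0 < e.eval s → Exec (.loop e c) s s 1
  | loop_step {e : Expr} {c : Program} {s₁ s₂ s₃ : Store} {t₁ t₂ : ℕ} :
      0 < e.eval s₁ → Exec c s₁ s₂ t₁ → Exec (.loop e c) s₂ s₃ t₂ →
      Exec (.loop e c) s₁ s₃ (t₁ + t₂ + 1)

/-- The initial store: the input is written to array `0`, all other cells are `0`. -/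
def inputStore (l : List ℤ) : Store :=
  fun a k => if a = 0 ∧ 0 ≤ k then l.getD k.toNat 0 else 0

/-- The output `l` is found in the first cells of array `1`. -/
def HasOutput (s : Store) (l : List ℤ) : Prop :=
  ∀ k : Fin l.length, s 1 ((k : ℕ) : ℤ) = l.get k

/-- Number of bits needed to write down a list of integers: binary digits, and for each entry
a sign and a separator. -/
def bitLength (l : List ℤ) : ℕ :=
  (l.map fun x => x.natAbs.size + 2).sum

/-- A search problem with instances in `ι` is solvable in polynomial time: a single program
halts on each (valid) instance within a number of steps that is bounded by a fixed polynomial in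
the bit length of the encoded instance, and outputs a solution of that instance. -/
def SolvableInPolyTime {ι : Type*} (encode : ι → List ℤ) (valid : ι → Prop)
    (IsSolution : ι → List ℤ → Prop) : Prop :=
  ∃ (c : Program) (p : Polynomial ℕ), ∀ i : ι, valid i →
    ∃ (s : Store) (t : ℕ) (out : List ℤ),
      Exec c (inputStore (encode i)) s t ∧ t ≤ p.eval (bitLength (encode i)) ∧
      HasOutput s out ∧ IsSolution i out

/-! ## Graphs as inputs and outputs of programs -/

/-- A graph given by the list of its edges: the vertices are `0, …, n - 1`, the edges are
`0, …, m - 1`, and `ends j` are the endpoints of edge `j`. -/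
structure EdgeList : Type where
  n : ℕ
  m : ℕ
  ends : Fin m → Fin n × Fin n

/-- The graph given by an edge list. -/
def EdgeList.toGraph (I : EdgeList) : Graph (Fin I.n) (Fin I.m) where
  vertexSet := Set.univ
  edgeSet := Set.univ
  IsLink e x y := I.ends e = (x, y) ∨ I.ends e = (y, x)
  isLink_symm := fun _ _ => ⟨fun _ _ h => h.symm⟩
  eq_or_eq_of_isLink_of_isLink := by
    intro e x y v w h h'
    rcases h with h | h <;> rcases h' with h' | h' <;> rw [h] at h' <;>
      simp only [Prod.mk.injEq] at h' <;> tauto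
  edge_mem_iff_exists_isLink := fun e =>
    ⟨fun _ => ⟨(I.ends e).1, (I.ends e).2, Or.inl rfl⟩, fun _ => Set.mem_univ _⟩
  left_mem_of_isLink := fun _ _ _ _ => Set.mem_univ _

/-- A number below `n`, as a vertex of the graph. -/
def EdgeList.vert (I : EdgeList) (v : Fin I.n) : V(I.toGraph) :=
  ⟨v, Set.mem_univ v⟩

/-- A vector given by the list of its entries, as a vector indexed by the vertices of the graph. -/
def EdgeList.vec (I : EdgeList) {R : Type*} (x : Fin I.n → R) : V(I.toGraph) → R :=
  fun v => x v.1

/-- The encoding `n, m, a₀, b₀, …, aₘ₋₁, bₘ₋₁` of an edge list. -/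
def EdgeList.encode (I : EdgeList) : List ℤ :=
  [(I.n : ℤ), (I.m : ℤ)] ++
    (List.ofFn I.ends).flatMap fun e => [((e.1 : ℕ) : ℤ), ((e.2 : ℕ) : ℤ)]

/-- Instances of the optimization problem: a graph and an integral weight for each vertex. -/
structure OptInstance : Type where
  graph : EdgeList
  weight : Fin graph.n → ℤ

def OptInstance.encode (i : OptInstance) : List ℤ :=
  i.graph.encode ++ List.ofFn i.weight

/-- The output lists the entries of a vector `x` in `P_G` (indeed an integral one) that maximizes
the weight over `P_G`. -/
def OptInstance.IsSolution (i : OptInstance) (out : List ℤ) : Prop :=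
  ∃ x : Fin i.graph.n → ℤ, out = List.ofFn x ∧
    i.graph.vec (fun v => (x v : ℝ)) ∈ splitPolytope i.graph.toGraph ∧
    ∀ y ∈ splitPolytope i.graph.toGraph,
      ∑ v, (i.weight v : ℝ) * y (i.graph.vert v) ≤ ∑ v, (i.weight v : ℝ) * (x v : ℝ)

/-- Instances of the construction problem: a graph and a nonnegative integral vector. -/
structure SplitInstance : Type where
  graph : EdgeList
  split : Fin graph.n → ℕ

def SplitInstance.encode (i : SplitInstance) : List ℤ :=
  i.graph.encode ++ List.ofFn fun v => (i.split v : ℤ)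

/-- The output describes a connected graph `H` (as an edge list) and the list of values of a map
`φ` on the vertices of `H`, which certify that the given vector is a feasible split vector. -/
def SplitInstance.IsSolution (i : SplitInstance) (out : List ℤ) : Prop :=
  ∃ (H : EdgeList) (φ : Fin H.n → Fin i.graph.n),
    out = H.encode ++ List.ofFn (fun w => ((φ w : ℕ) : ℤ)) ∧
    Certifies i.graph.toGraph (i.graph.vec fun v => i.split v + 1) H.toGraph
      (H.vec fun w => i.graph.vert (φ w))

end KTrail

/-!
A vector `μ` is a feasible split vector if and only if `G` has an orientation in which every vertex
can be reached from a fixed root `r` and every vertex `v` is entered by at least `μ v` arcs in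
addition to the one that is needed to reach it if `v ≠ r`. Given a connected `H`, orient a spanning
tree of `H` away from a preimage of `r`, every other edge arbitrarily, and map this orientation to
`G`. Conversely, fix an arborescence in the orientation of `G`; detaching the head of an arc outside
the arborescence to a new copy of this head preserves connectedness.

Call a set of vertices tight if it is entered by as few arcs as root-connectedness permits. By
submodularity, the union and the intersection of intersecting tight sets are tight. Reversing a
path from `v` to `u` moves an entering arc from `u` to `v`; if there is no such path or if this
destroys root-connectedness, then a tight set contains `u` but not `v`. Hence, if no entry of `μ` on
`U` can be increased, the vertices that can spare an entering arc are covered by disjoint tight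
sets that avoid `U`, and `μ` has maximal total value on the complement of their union. This makes
the feasible split vectors the integral points of a polymatroid. The greedy algorithm optimizes
over it, with path reversals as its only subroutine.
-/

namespace KTrail

/-! ## Orientations with prescribed lower bounds on the in-degrees -/

section Orientation

open Finset

variable {V E : Type*}

/-- The map `D` assigns to each edge a tail and a head; the endpoints are those given by `ends`. -/
def IsOrientation (ends D : E → V × V) : Prop :=
  ∀ e, D e = ends e ∨ D e = (ends e).swap

/-- There is a directed path from `u` to `v`. -/
def Reaches (D : E → V × V) : V → V → Prop :=
  Relation.ReflTransGen fun x y => ∃ e, D e = (x, y)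

/-- All vertices can be reached from `r`. -/
def RootConnected (D : E → V × V) (r : V) : Prop :=
  ∀ v, Reaches D r v

theorem IsOrientation.update_swap [DecidableEq E] {ends D : E → V × V} (h : IsOrientation ends D)
    (e : E) : IsOrientation ends (Function.update D e (D e).swap) := by
  intro i
  by_cases hi : i = e
  · subst hi
    rcases h i with h | h <;> simp [h]
  · rw [Function.update_of_ne hi]
    exact h i

theorem exists_arc_leaving {D : E → V × V} {P : V → Prop} {a b : V} (h : Reaches D a b)
    (ha : P a) (hb : ¬ P b) : ∃ e, P (D e).1 ∧ ¬ P (D e).2 := by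
  induction h with
  | refl => exact absurd ha hb
  | @tail c d _ hcd ih =>
    by_cases hc : P c
    · obtain ⟨e, he⟩ := hcd
      exact ⟨e, by simpa [he] using hc, by simpa [he] using hb⟩
    · exact ih hc

theorem reflTransGen_avoiding {r : V → V → Prop} (v : V) {a u : V}
    (h : Relation.ReflTransGen r a u) :
    Relation.ReflTransGen (fun x y => x ≠ v ∧ r x y) a u ∨
      ∃ w, r v w ∧ Relation.ReflTransGen (fun x y => x ≠ v ∧ r x y) w u := by
  induction h using Relation.ReflTransGen.head_induction_on with
  | refl => exact Or.inl .refl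
  | @head a b hab _ ih =>
    rcases ih with ih | ih
    · by_cases ha : a = v
      · exact Or.inr ⟨b, ha ▸ hab, ih⟩
      · exact Or.inl (ih.head ⟨ha, hab⟩)
    · exact Or.inr ih

theorem exists_first_arc [DecidableEq E] {D : E → V × V} {F : Finset E} {v u : V} (hvu : v ≠ u)
    (h : Relation.ReflTransGen (fun x y => ∃ e ∈ F, D e = (x, y)) v u) :
    ∃ e ∈ F, (D e).1 = v ∧
      Relation.ReflTransGen (fun x y => ∃ i ∈ F.erase e, D i = (x, y)) (D e).2 u := by
  obtain ⟨w, ⟨e, heF, he⟩, hw⟩ : ∃ w, (∃ e ∈ F, D e = (v, w)) ∧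
      Relation.ReflTransGen (fun x y => x ≠ v ∧ ∃ e ∈ F, D e = (x, y)) w u := by
    rcases reflTransGen_avoiding v h with h | h
    · obtain h | ⟨c, hc, -⟩ := h.cases_head
      · exact absurd h hvu
      · exact absurd rfl hc.1
    · exact h
  refine ⟨e, heF, by rw [he], ?_⟩
  rw [he]
  refine hw.lift id ?_
  rintro x y ⟨hx, i, hi, hxy⟩
  refine ⟨i, mem_erase.2 ⟨?_, hi⟩, hxy⟩
  rintro rfl
  exact hx (congrArg Prod.fst (hxy.symm.trans he))

/-- The number of arcs that have to enter a nonempty set in a root-connected orientation. -/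
def demand [DecidableEq V] (r : V) (X : Finset V) : ℕ := if r ∈ X then 0 else 1

theorem demand_modular [DecidableEq V] (r : V) (X Y : Finset V) :
    demand r (X ∩ Y) + demand r (X ∪ Y) = demand r X + demand r Y := by
  by_cases h1 : r ∈ X <;> by_cases h2 : r ∈ Y <;> simp [demand, h1, h2]

theorem exists_pairwiseDisjoint_cover [Finite V] [DecidableEq V] {P : Finset V → Prop}
    (hP : ∀ X Y, P X → P Y → (X ∩ Y).Nonempty → P (X ∪ Y)) :
    ∃ 𝓜 : Finset (Finset V), (𝓜 : Set (Finset V)).PairwiseDisjoint id ∧ (∀ M ∈ 𝓜, P M) ∧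
      ∀ X, P X → ∃ M ∈ 𝓜, X ⊆ M := by
  cases nonempty_fintype V
  classical
  refine ⟨univ.filter fun M => Maximal P M, fun X hX Y hY hXY => ?_,
    fun M hM => (mem_filter.1 hM).2.prop, fun X hX => ?_⟩
  · by_contra hne
    have hX := (mem_filter.1 (mem_coe.1 hX)).2
    have hY := (mem_filter.1 (mem_coe.1 hY)).2
    have hmem := hP X Y hX.prop hY.prop (not_disjoint_iff_nonempty_inter.1 hne)
    exact hXY ((hX.eq_of_ge hmem subset_union_left).symm.trans
      (hY.eq_of_ge hmem subset_union_right))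
  · obtain ⟨M, hXM, hM⟩ := (Set.toFinite {X | P X}).exists_le_maximal hX
    exact ⟨M, mem_filter.2 ⟨mem_univ M, hM⟩, hXM⟩

section Degrees

variable [Fintype E] [DecidableEq V]

/-- The number of arcs with head `v`. -/
def indeg (D : E → V × V) (v : V) : ℕ :=
  card {e | (D e).2 = v}

theorem RootConnected.indeg_pos {D : E → V × V} {r v : V} (h : RootConnected D r) (hv : v ≠ r) :
    0 < indeg D v := by
  obtain rfl | ⟨u, -, e, he⟩ := (h v).cases_tail
  · exact absurd rfl hv
  · exact card_pos.2 ⟨e, by simp [he]⟩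

/-- The number of arcs entering `X`. -/
def entering (D : E → V × V) (X : Finset V) : ℕ :=
  card {e | (D e).1 ∉ X ∧ (D e).2 ∈ X}

/-- The number of edges with both endpoints in `X`. -/
def inside (D : E → V × V) (X : Finset V) : ℕ :=
  card {e | (D e).1 ∈ X ∧ (D e).2 ∈ X}

/-- There is a root-connected orientation in which every vertex `v` has at least `μ v` entering
arcs in addition to the one that reaches it from the root. -/
def Orientable (ends : E → V × V) (r : V) (μ : V → ℕ) : Prop :=
  ∃ D, IsOrientation ends D ∧ RootConnected D r ∧
    ∀ v, μ v + (if v = r then 0 else 1) ≤ indeg D v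

/-- A nonempty set that is entered by as few arcs as possible. -/
def Tight (D : E → V × V) (r : V) (X : Finset V) : Prop :=
  X.Nonempty ∧ entering D X = demand r X

theorem sum_indeg (D : E → V × V) (X : Finset V) :
    ∑ v ∈ X, indeg D v = entering D X + inside D X := by
  simp only [indeg, entering, inside, card_filter]
  rw [sum_comm, ← sum_add_distrib]
  refine sum_congr rfl fun e _ => ?_
  rw [sum_ite_eq]
  by_cases h1 : (D e).1 ∈ X <;> by_cases h2 : (D e).2 ∈ X <;> simp [h1, h2]

theorem inside_eq {ends D : E → V × V} (h : IsOrientation ends D) (X : Finset V) :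
    inside D X = inside ends X := by
  unfold inside
  congr 1
  ext e
  simp only [mem_filter, mem_univ, true_and]
  rcases h e with h | h <;> rw [h]
  simp [and_comm]

theorem demand_le_entering {D : E → V × V} {r : V} (h : RootConnected D r) {X : Finset V}
    (hX : X.Nonempty) : demand r X ≤ entering D X := by
  unfold demand
  split_ifs with hr
  · exact Nat.zero_le _
  · obtain ⟨x, hx⟩ := hX
    obtain ⟨e, h1, h2⟩ := exists_arc_leaving (P := fun v => v ∉ X) (h x) hr (by simpa using hx)
    exact card_pos.2 ⟨e, by simpa using ⟨h1, not_not.1 h2⟩⟩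

theorem entering_submodular (D : E → V × V) (X Y : Finset V) :
    entering D (X ∩ Y) + entering D (X ∪ Y) ≤ entering D X + entering D Y := by
  simp only [entering, card_filter, ← sum_add_distrib]
  refine sum_le_sum fun e _ => ?_
  by_cases h1 : (D e).1 ∈ X <;> by_cases h2 : (D e).2 ∈ X <;> by_cases h3 : (D e).1 ∈ Y <;>
    by_cases h4 : (D e).2 ∈ Y <;> simp [h1, h2, h3, h4]

theorem Tight.inter_union {D : E → V × V} {r : V} (h : RootConnected D r) {X Y : Finset V}
    (hX : Tight D r X) (hY : Tight D r Y) (hXY : (X ∩ Y).Nonempty) :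
    Tight D r (X ∩ Y) ∧ Tight D r (X ∪ Y) := by
  have hU : (X ∪ Y).Nonempty := hX.1.mono subset_union_left
  have := demand_le_entering h hXY
  have := demand_le_entering h hU
  have := entering_submodular D X Y
  have := demand_modular r X Y
  have := hX.2
  have := hY.2
  exact ⟨⟨hXY, by omega⟩, ⟨hU, by omega⟩⟩

theorem Tight.sum_indeg_le {ends D D' : E → V × V} {r : V} {X : Finset V} (hX : Tight D r X)
    (hD : IsOrientation ends D) (hD' : IsOrientation ends D') (h' : RootConnected D' r) :
    ∑ v ∈ X, indeg D v ≤ ∑ v ∈ X, indeg D' v := by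
  rw [sum_indeg, sum_indeg, inside_eq hD, inside_eq hD', hX.2]
  exact Nat.add_le_add_right (demand_le_entering h' hX.1) _

theorem entering_eq_zero_of_forall_reaches {D : E → V × V} {a : V} {X : Finset V}
    (hX : ∀ x, x ∈ X ↔ ¬ Reaches D a x) : entering D X = 0 := by
  rw [entering, card_eq_zero, filter_eq_empty_iff]
  intro e _ he
  rw [hX, hX, not_not] at he
  exact he.2 (he.1.tail ⟨e, rfl⟩)

theorem indeg_update_swap [DecidableEq E] (D : E → V × V) (e : E) (x : V) :
    indeg (Function.update D e (D e).swap) x + (if x = (D e).2 then 1 else 0) =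
      indeg D x + (if x = (D e).1 then 1 else 0) := by
  have hrest : ∑ i ∈ univ.erase e, (if (Function.update D e (D e).swap i).2 = x then 1 else 0) =
      ∑ i ∈ univ.erase e, (if (D i).2 = x then 1 else 0) :=
    sum_congr rfl fun i hi => by rw [Function.update_of_ne (ne_of_mem_erase hi)]
  simp only [indeg, card_filter]
  rw [← add_sum_erase _ _ (mem_univ e),
    ← add_sum_erase (a := e) _ (fun i => if (D i).2 = x then 1 else 0) (mem_univ e), hrest]
  simp only [Function.update_self, Prod.snd_swap, eq_comm (a := x)]
  omega

theorem exists_reversal_of_subset {ends D : E → V × V} (hD : IsOrientation ends D)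
    {u v : V} (F : Finset E)
    (h : Relation.ReflTransGen (fun x y => ∃ e ∈ F, D e = (x, y)) v u) :
    ∃ D', IsOrientation ends D' ∧ (∀ e ∉ F, D' e = D e) ∧
      ∀ x, indeg D' x + (if x = u then 1 else 0) = indeg D x + (if x = v then 1 else 0) := by
  classical
  induction F using Finset.strongInduction generalizing v with
  | _ F ih =>
    by_cases hvu : v = u
    · exact ⟨D, hD, fun _ _ => rfl, fun x => by rw [hvu]⟩
    obtain ⟨e, heF, rfl, hw⟩ := exists_first_arc hvu h
    obtain ⟨D', hD', hF', hdeg⟩ := ih _ (erase_ssubset heF) hw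
    have hD'e : D' e = D e := hF' e (notMem_erase e F)
    refine ⟨Function.update D' e (D' e).swap, hD'.update_swap e, fun i hi => ?_, fun x => ?_⟩
    · rw [Function.update_of_ne (ne_of_mem_of_not_mem heF hi).symm]
      exact hF' i fun hi' => hi (mem_of_mem_erase hi')
    · have h1 := indeg_update_swap D' e x
      have h2 := hdeg x
      rw [hD'e] at h1 ⊢
      omega

theorem exists_reversal {ends D : E → V × V} (hD : IsOrientation ends D) {u v : V}
    (h : Reaches D v u) : ∃ D', IsOrientation ends D' ∧
      ∀ x, indeg D' x + (if x = u then 1 else 0) = indeg D x + (if x = v then 1 else 0) := by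
  obtain ⟨D', h1, -, h2⟩ := exists_reversal_of_subset hD (univ : Finset E)
    (by simpa [Reaches] using h)
  exact ⟨D', h1, h2⟩

theorem Orientable.mono {ends : E → V × V} {r : V} {μ ν : V → ℕ} (h : Orientable ends r μ)
    (hle : ν ≤ μ) : Orientable ends r ν := by
  obtain ⟨D, h1, h2, h3⟩ := h
  exact ⟨D, h1, h2, fun v => (Nat.add_le_add_right (hle v) _).trans (h3 v)⟩

theorem Orientable.le_card {ends : E → V × V} {r : V} {μ : V → ℕ} (h : Orientable ends r μ)
    (v : V) : μ v ≤ Fintype.card E := by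
  obtain ⟨D, -, -, h3⟩ := h
  exact (Nat.le_add_right _ _).trans ((h3 v).trans (card_le_univ _))

theorem tight_univ [Fintype V] [Nonempty V] (D : E → V × V) (r : V) : Tight D r univ :=
  ⟨univ_nonempty, by simp [entering, demand]⟩

theorem sum_indeg_univ_eq [Fintype V] {ends D D' : E → V × V} (hD : IsOrientation ends D)
    (hD' : IsOrientation ends D') : ∑ v, indeg D v = ∑ v, indeg D' v := by
  rw [sum_indeg, sum_indeg, inside_eq hD, inside_eq hD']
  simp [entering]

section Saturation

variable [Finite V]

theorem exists_tight_disjoint {D : E → V × V} {r : V} (h : RootConnected D r) {u : V}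
    {U : Finset V} (hU : ∀ v ∈ U, ∃ Y, Tight D r Y ∧ u ∈ Y ∧ v ∉ Y) :
    ∃ Y, Tight D r Y ∧ u ∈ Y ∧ Disjoint U Y := by
  cases nonempty_fintype V
  have : Nonempty V := ⟨u⟩
  obtain ⟨T, hT⟩ := Set.Finite.exists_minimal (Set.toFinite {T : Finset V | Tight D r T ∧ u ∈ T})
    ⟨univ, tight_univ D r, mem_univ u⟩
  refine ⟨T, hT.prop.1, hT.prop.2, disjoint_left.2 fun v hv hvT => ?_⟩
  obtain ⟨Y, hY, huY, hvY⟩ := hU v hv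
  have huTY : u ∈ T ∩ Y := mem_inter.2 ⟨hT.prop.2, huY⟩
  have := hT.le_of_le ⟨(hT.prop.1.inter_union h hY ⟨u, huTY⟩).1, huTY⟩ inter_subset_left
  exact hvY (mem_inter.1 (this hvT)).2

theorem exists_saturated_superset {ends D : E → V × V} {r : V} {μ : V → ℕ}
    (hD : IsOrientation ends D) (h : RootConnected D r) (U : Finset V)
    (hU : ∀ v ∈ U, ∀ u, μ u + (if u = r then 0 else 1) < indeg D u →
      ∃ Y, Tight D r Y ∧ u ∈ Y ∧ v ∉ Y) :
    ∃ Z, U ⊆ Z ∧ ∀ μ', Orientable ends r μ' → ∑ v ∈ Z, μ' v ≤ ∑ v ∈ Z, μ v := by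
  obtain ⟨𝓜, hdisj, h𝓜, hcover⟩ :=
    exists_pairwiseDisjoint_cover (P := fun Y => Tight D r Y ∧ Disjoint U Y)
      fun X Y hX hY hXY => ⟨(hX.1.inter_union h hY.1 hXY).2, disjoint_union_right.2 ⟨hX.2, hY.2⟩⟩
  cases nonempty_fintype V
  set C : Finset V := 𝓜.biUnion id with hC
  have hexact : ∀ u ∉ C, indeg D u ≤ μ u + (if u = r then 0 else 1) := by
    intro u hu
    by_contra! hlt
    obtain ⟨Y, hY, huY, hYU⟩ := exists_tight_disjoint h (fun v hv => hU v hv u hlt)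
    obtain ⟨M, hM, hYM⟩ := hcover Y ⟨hY, hYU⟩
    exact hu (mem_biUnion.2 ⟨M, hM, hYM huY⟩)
  refine ⟨Cᶜ, fun v hv => ?_, ?_⟩
  · simp only [hC, mem_compl, mem_biUnion, not_exists, not_and, id]
    exact fun Y hY hvY => disjoint_left.1 (h𝓜 Y hY).2 hv hvY
  · rintro μ' ⟨D', hD', h', hμ'⟩
    have hin : ∑ v ∈ C, indeg D v ≤ ∑ v ∈ C, indeg D' v := by
      rw [hC, sum_biUnion hdisj, sum_biUnion hdisj]
      exact sum_le_sum fun Y hY => (h𝓜 Y hY).1.sum_indeg_le hD hD' h'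
    have htot := sum_indeg_univ_eq hD hD'
    rw [← sum_add_sum_compl C, ← sum_add_sum_compl C (indeg D')] at htot
    have hle : ∑ v ∈ Cᶜ, (μ' v + (if v = r then 0 else 1)) ≤ ∑ v ∈ Cᶜ, indeg D' v :=
      sum_le_sum fun v _ => hμ' v
    have hge : ∑ v ∈ Cᶜ, indeg D v ≤ ∑ v ∈ Cᶜ, (μ v + (if v = r then 0 else 1)) :=
      sum_le_sum fun v hv => hexact v (mem_compl.1 hv)
    rw [sum_add_distrib] at hle hge
    omega

theorem exists_tight_of_not_reaches {D : E → V × V} {r u v : V} (h : RootConnected D r)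
    (huv : ¬ Reaches D v u) : ∃ Y, Tight D r Y ∧ u ∈ Y ∧ v ∉ Y := by
  classical
  obtain ⟨Y, hY⟩ : ∃ Y : Finset V, ∀ x, x ∈ Y ↔ ¬ Reaches D v x :=
    ⟨(Set.toFinite {x | ¬ Reaches D v x}).toFinset, by simp⟩
  have huY : u ∈ Y := (hY u).2 huv
  have h0 := entering_eq_zero_of_forall_reaches hY
  have h1 := demand_le_entering h ⟨u, huY⟩
  exact ⟨Y, ⟨⟨u, huY⟩, by omega⟩, huY, fun hv => (hY v).1 hv .refl⟩

theorem exists_tight_of_not_rootConnected {ends D D' : E → V × V} {r u v : V}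
    (hD : IsOrientation ends D) (h : RootConnected D r) (hD' : IsOrientation ends D')
    (hdeg : ∀ x, indeg D' x + (if x = u then 1 else 0) = indeg D x + (if x = v then 1 else 0))
    (h' : ¬ RootConnected D' r) : ∃ Y, Tight D r Y ∧ u ∈ Y ∧ v ∉ Y := by
  classical
  obtain ⟨Y, hY⟩ : ∃ Y : Finset V, ∀ x, x ∈ Y ↔ ¬ Reaches D' r x :=
    ⟨(Set.toFinite {x | ¬ Reaches D' r x}).toFinset, by simp⟩
  obtain ⟨y, hy⟩ := not_forall.1 h'
  have hne : Y.Nonempty := ⟨y, (hY y).2 hy⟩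
  have hr : r ∉ Y := fun hr => (hY r).1 hr .refl
  have hd : demand r Y = 1 := by simp [demand, hr]
  have h0 := entering_eq_zero_of_forall_reaches hY
  have h1 := demand_le_entering h hne
  have hs : ∑ x ∈ Y, (indeg D' x + (if x = u then 1 else 0)) =
      ∑ x ∈ Y, (indeg D x + (if x = v then 1 else 0)) := sum_congr rfl fun x _ => hdeg x
  rw [sum_add_distrib, sum_add_distrib, sum_indeg, sum_indeg, inside_eq hD,
    inside_eq hD', sum_ite_eq', sum_ite_eq'] at hs
  by_cases hu : u ∈ Y <;> by_cases hv : v ∈ Y <;> simp only [hu, hv, if_true, if_false] at hs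
  · omega
  · exact ⟨Y, ⟨hne, by omega⟩, hu, hv⟩
  · omega
  · omega

theorem Orientable.exists_saturated {ends : E → V × V} {r : V} {μ : V → ℕ}
    (h : Orientable ends r μ) (U : Finset V)
    (hU : ∀ v ∈ U, ¬ Orientable ends r (μ + Pi.single v 1)) :
    ∃ Z, U ⊆ Z ∧ ∀ μ', Orientable ends r μ' → ∑ v ∈ Z, μ' v ≤ ∑ v ∈ Z, μ v := by
  obtain ⟨D, hD, hr, hdeg⟩ := h
  refine exists_saturated_superset hD hr U fun v hv u hu => ?_
  by_cases huv : Reaches D v u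
  · obtain ⟨D', hD', hdeg'⟩ := exists_reversal hD huv
    refine exists_tight_of_not_rootConnected hD hr hD' hdeg' fun hr' => ?_
    refine hU v hv ⟨D', hD', hr', fun x => ?_⟩
    have h1 := hdeg x
    have h2 := hdeg' x
    simp only [Pi.add_apply, Pi.single_apply]
    by_cases hxu : x = u
    · subst hxu
      split_ifs at * <;> omega
    · simp only [hxu, if_false] at h2
      split_ifs at * <;> omega
  · exact exists_tight_of_not_reaches hr huv

end Saturation

end Degrees

end Orientation

/-! ## Saturable families and polymatroids -/

section Saturable

open Finset

variable {N : Type*} [DecidableEq N]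

/-- A bounded down-closed set of nonnegative integral vectors such that a vector whose entries
cannot be increased individually on `U` is maximal on some superset of `U`. These are the sets of
integral points of polymatroids. -/
structure IsSaturable (F : Set (N → ℕ)) : Prop where
  zero_mem : 0 ∈ F
  lower : ∀ ⦃μ⦄, μ ∈ F → ∀ ⦃ν⦄, ν ≤ μ → ν ∈ F
  bounded : ∃ B, ∀ μ ∈ F, ∀ v, μ v ≤ B
  saturated : ∀ μ ∈ F, ∀ U : Finset N, (∀ v ∈ U, μ + Pi.single v 1 ∉ F) →
    ∃ Z, U ⊆ Z ∧ ∀ μ' ∈ F, ∑ v ∈ Z, μ' v ≤ ∑ v ∈ Z, μ v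

/-- The largest total value on `S` of a vector in `F`: the submodular function that defines the
polymatroid of a saturable set. -/
noncomputable def rank {N : Type*} (F : Set (N → ℕ)) (S : Finset N) : ℕ :=
  sSup ((fun μ => ∑ v ∈ S, μ v) '' F)

/-- The points of `ℝ^N` with the entries of a vector in `F`. -/
def realPoints {N : Type*} (F : Set (N → ℕ)) : Set (N → ℝ) :=
  {x | ∃ μ ∈ F, ∀ v, x v = (μ v : ℝ)}

/-- The outcome of the greedy algorithm for the weights `w`: the entries with nonpositive weight
vanish, and no entry with positive weight can be increased, even if the entries of smaller weight
are erased. -/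
structure IsGreedy {R : Type*} [LE R] [LT R] [Zero R] (F : Set (N → ℕ)) (w : N → R)
    (ν : N → ℕ) : Prop where
  mem : ν ∈ F
  eq_zero : ∀ v, w v ≤ 0 → ν v = 0
  saturated : ∀ v, 0 < w v → {u | w v ≤ w u}.indicator ν + Pi.single v 1 ∉ F

theorem IsGreedy.intCast {F : Set (N → ℕ)} {w : N → ℤ} {ν : N → ℕ} (h : IsGreedy F w ν) :
    IsGreedy F (fun v => (w v : ℝ)) ν where
  mem := h.mem
  eq_zero := fun v hv => h.eq_zero v (by exact_mod_cast hv)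
  saturated := fun v hv => by simpa using h.saturated v (by exact_mod_cast hv)

variable {F : Set (N → ℕ)}

theorem IsSaturable.comp_equiv {M : Type*} [DecidableEq M] (hF : IsSaturable F) (e : N ≃ M) :
    IsSaturable {μ : M → ℕ | μ ∘ e ∈ F} where
  zero_mem := hF.zero_mem
  lower := fun _ hμ _ hle => hF.lower hμ fun v => hle (e v)
  bounded := by
    obtain ⟨B, hB⟩ := hF.bounded
    exact ⟨B, fun μ hμ v => by simpa using hB _ hμ (e.symm v)⟩
  saturated := by
    intro μ hμ U hU
    obtain ⟨Z, hZ, hmax⟩ := hF.saturated _ hμ (U.map e.symm.toEmbedding) (by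
      intro v hv hmem
      refine hU (e v) (by simpa using hv) ?_
      have : (μ + Pi.single (e v) 1) ∘ e = μ ∘ e + Pi.single v 1 := by
        ext u
        simp [Pi.single_apply]
      rw [Set.mem_ofPred_eq, this]
      exact hmem)
    refine ⟨Z.map e.toEmbedding, fun v hv => ?_, fun μ' hμ' => ?_⟩
    · have := hZ (mem_map_of_mem e.symm.toEmbedding hv)
      simpa [mem_map_equiv] using this
    · simpa using hmax _ hμ'

section Rank

variable [Finite N]

theorem IsSaturable.finite (hF : IsSaturable F) : F.Finite := by
  obtain ⟨B, hB⟩ := hF.bounded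
  cases nonempty_fintype N
  exact (Set.finite_Iic (fun _ : N => B)).subset fun μ hμ v => hB μ hμ v

theorem IsSaturable.sum_le_rank (hF : IsSaturable F) {μ : N → ℕ} (hμ : μ ∈ F) (S : Finset N) :
    ∑ v ∈ S, μ v ≤ rank F S :=
  le_csSup (hF.finite.image _).bddAbove ⟨μ, hμ, rfl⟩

theorem IsSaturable.exists_sum_eq_rank (hF : IsSaturable F) (S : Finset N) :
    ∃ μ ∈ F, ∑ v ∈ S, μ v = rank F S :=
  Set.Nonempty.csSup_mem (Set.Nonempty.image _ ⟨0, hF.zero_mem⟩) (hF.finite.image _)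

theorem IsSaturable.exists_extension (hF : IsSaturable F) {ν : N → ℕ} (hν : ν ∈ F)
    (U : Finset N) : ∃ ν' ∈ F, ν ≤ ν' ∧ (∀ v ∉ U, ν' v = ν v) ∧
      ∀ v ∈ U, ν' + Pi.single v 1 ∉ F := by
  obtain ⟨ν', h⟩ := Set.Finite.exists_maximal
    (hF.finite.subset (Set.sep_subset F fun ν' => ν ≤ ν' ∧ ∀ v ∉ U, ν' v = ν v))
    ⟨ν, hν, le_rfl, fun _ _ => rfl⟩
  refine ⟨ν', h.prop.1, h.prop.2.1, h.prop.2.2, fun v hv hmem => ?_⟩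
  have hle : ν' ≤ ν' + Pi.single v 1 := le_self_add
  have := h.le_of_ge ⟨hmem, h.prop.2.1.trans hle, fun u hu => ?_⟩ hle v
  · simp at this
  · have : u ≠ v := fun h => hu (h ▸ hv)
    simpa [this] using h.prop.2.2 u hu

theorem IsSaturable.rank_eq (hF : IsSaturable F) {ν : N → ℕ} (hν : ν ∈ F) {U : Finset N}
    (h0 : ∀ v ∉ U, ν v = 0) (hU : ∀ v ∈ U, ν + Pi.single v 1 ∉ F) :
    rank F U = ∑ v ∈ U, ν v := by
  obtain ⟨Z, hZ, hmax⟩ := hF.saturated ν hν U hU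
  obtain ⟨μ, hμ, h⟩ := hF.exists_sum_eq_rank U
  refine le_antisymm ?_ (hF.sum_le_rank hν U)
  calc rank F U = ∑ v ∈ U, μ v := h.symm
    _ ≤ ∑ v ∈ Z, μ v := sum_le_sum_of_subset hZ
    _ ≤ ∑ v ∈ Z, ν v := hmax μ hμ
    _ = ∑ v ∈ U, ν v := (sum_subset hZ fun v _ hv => h0 v hv).symm

theorem IsSaturable.rank_submodular (hF : IsSaturable F) (S T : Finset N) :
    rank F (S ∪ T) + rank F (S ∩ T) ≤ rank F S + rank F T := by
  obtain ⟨ν, hν, -, h0, hI⟩ := hF.exists_extension hF.zero_mem (S ∩ T)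
  obtain ⟨ν', hν', hle, h0', hU⟩ := hF.exists_extension hν (S ∪ T)
  have hinter : rank F (S ∩ T) = ∑ v ∈ S ∩ T, ν v := hF.rank_eq hν h0 hI
  have hunion : rank F (S ∪ T) = ∑ v ∈ S ∪ T, ν' v := hF.rank_eq hν' (fun v hv => by
    rw [h0' v hv]
    exact h0 v fun h => hv (mem_union_left _ (mem_inter.1 h).1)) hU
  calc rank F (S ∪ T) + rank F (S ∩ T)
      ≤ ∑ v ∈ S ∪ T, ν' v + ∑ v ∈ S ∩ T, ν' v := by
        rw [hunion, hinter]
        exact Nat.add_le_add_left (sum_le_sum fun v _ => hle v) _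
    _ = ∑ v ∈ S, ν' v + ∑ v ∈ T, ν' v := sum_union_inter
    _ ≤ rank F S + rank F T := add_le_add (hF.sum_le_rank hν' S) (hF.sum_le_rank hν' T)

theorem IsSaturable.mem_of_sum_le (hF : IsSaturable F) {μ : N → ℕ}
    (h : ∀ S, ∑ v ∈ S, μ v ≤ rank F S) : μ ∈ F := by
  obtain ⟨ν, hν⟩ := Set.Finite.exists_maximal
    (hF.finite.subset (Set.sep_subset F fun ν => ν ≤ μ)) ⟨0, hF.zero_mem, fun _ => Nat.zero_le _⟩
  by_contra hμ
  obtain ⟨v, hv⟩ : ∃ v, ν v < μ v := by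
    by_contra! hle
    exact hμ (hF.lower hν.prop.1 hle)
  have hnot : ν + Pi.single v 1 ∉ F := fun hmem => by
    have := hν.le_of_ge ⟨hmem, fun u => ?_⟩ le_self_add v
    · simp at this
    · by_cases huv : u = v
      · subst huv
        simpa using hv
      · simpa [huv] using hν.prop.2 u
  obtain ⟨Z, hZ, hmax⟩ := hF.saturated ν hν.prop.1 {v} (by simpa using hnot)
  obtain ⟨μ', hμ', hrank⟩ := hF.exists_sum_eq_rank Z
  have hlt : ∑ v ∈ Z, ν v < ∑ v ∈ Z, μ v :=
    sum_lt_sum (fun u _ => hν.prop.2 u) ⟨v, hZ (mem_singleton_self v), hv⟩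
  exact absurd ((h Z).trans (hrank ▸ hmax μ' hμ')) hlt.not_ge

theorem IsSaturable.exists_greedy {R : Type*} [LinearOrder R] [Zero R] (hF : IsSaturable F)
    (w : N → R) : ∃ ν, IsGreedy F w ν := by
  have key : ∀ A : Finset N, ∃ ν ∈ F, (∀ v ∉ A, ν v = 0) ∧
      ∀ v ∈ A, {u | w v ≤ w u}.indicator ν + Pi.single v 1 ∉ F := by
    intro A
    induction A using Finset.induction_on_min_value w with
    | empty => exact ⟨0, hF.zero_mem, by simp, by simp⟩
    | insert a A haA hmin ih =>
      obtain ⟨ν, hν, h0, hsat⟩ := ih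
      obtain ⟨ν', hν', hle, h0', hsat'⟩ := hF.exists_extension hν {a}
      have hsupp : ∀ v ∉ insert a A, ν' v = 0 := fun v hv => by
        rw [mem_insert, not_or] at hv
        rw [h0' v (by simpa using hv.1), h0 v hv.2]
      refine ⟨ν', hν', hsupp, fun v hv hmem => ?_⟩
      rcases mem_insert.1 hv with rfl | hvA
      · have : {u | w v ≤ w u}.indicator ν' = ν' := by
          rw [Set.indicator_eq_self]
          intro u hu
          rcases mem_insert.1 (by_contra fun h => hu (hsupp u h)) with rfl | huA
          exacts [le_rfl, hmin u huA]
        exact hsat' v (mem_singleton_self v) (this ▸ hmem)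
      · refine hsat v hvA (hF.lower hmem (add_le_add_left (fun u => ?_) _))
        exact Set.indicator_le_indicator (hle u)
  cases nonempty_fintype N
  obtain ⟨ν, hν, h0, hsat⟩ := key {v | 0 < w v}
  exact ⟨ν, hν, fun v hv => h0 v (by simpa using hv), fun v hv => hsat v (by simpa using hv)⟩

end Rank

section Optimality

variable [Fintype N]

-- Write `(w v)⁺` as the integral of the indicator function of `{t | 0 < t ≤ w v}`.
open MeasureTheory in
theorem sum_posPart_mul_nonpos {N : Type*} [Fintype N] {w z : N → ℝ}
    (h : ∀ t, 0 < t → ∑ v with t ≤ w v, z v ≤ 0) : ∑ v, (w v)⁺ * z v ≤ 0 := by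
  have hlayer : ∀ v, ∫ t in Set.Ioi 0, (Set.Iic (w v)).indicator (fun _ => z v) t =
      (w v)⁺ * z v := fun v => by
    rw [integral_indicator_const _ measurableSet_Iic, measureReal_restrict_apply measurableSet_Iic,
      Set.inter_comm, Set.Ioi_inter_Iic, Real.volume_real_Ioc, sub_zero, smul_eq_mul, posPart_def]
  have hinteg : ∀ v, IntegrableOn ((Set.Iic (w v)).indicator fun _ => z v) (Set.Ioi 0) :=
      fun v => by
    rw [integrableOn_indicator_iff measurableSet_Iic, Set.inter_comm, Set.Ioi_inter_Iic]
    exact integrableOn_const (by simp)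
  simp only [← hlayer]
  rw [← integral_finsetSum _ fun v _ => hinteg v]
  refine setIntegral_nonpos measurableSet_Ioi fun t ht => ?_
  simpa [Set.indicator_apply, sum_filter] using h t ht

theorem IsGreedy.sum_level_le {w : N → ℝ} {ν : N → ℕ} (h : IsGreedy F w ν) (hF : IsSaturable F)
    {x : N → ℝ} (hx : ∀ S, ∑ v ∈ S, x v ≤ rank F S) {t : ℝ} (ht : 0 < t) :
    ∑ v with t ≤ w v, x v ≤ ∑ v with t ≤ w v, (ν v : ℝ) := by
  have hrank : rank F {v | t ≤ w v} = ∑ v with t ≤ w v, {u | t ≤ w u}.indicator ν v := by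
    refine hF.rank_eq (hF.lower h.mem (Set.indicator_le_self _ _)) (fun v hv => ?_)
      fun v hv hmem => ?_
    · exact Set.indicator_of_notMem (by simpa using hv) _
    · have hv : t ≤ w v := by simpa using hv
      refine h.saturated v (ht.trans_le hv) (hF.lower hmem (add_le_add_left ?_ _))
      exact Set.indicator_le_indicator_of_subset (fun u hu => hv.trans hu) fun _ => Nat.zero_le _
  calc ∑ v with t ≤ w v, x v ≤ rank F {v | t ≤ w v} := hx _
    _ = ∑ v with t ≤ w v, (ν v : ℝ) := by
      rw [hrank]
      push_cast
      exact sum_congr rfl fun v hv => by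
        rw [Set.indicator_of_mem (show v ∈ {u | t ≤ w u} by simpa using hv)]

theorem IsGreedy.optimal {w : N → ℝ} {ν : N → ℕ} (h : IsGreedy F w ν) (hF : IsSaturable F)
    {x : N → ℝ} (hx0 : ∀ v, 0 ≤ x v) (hx : ∀ S, ∑ v ∈ S, x v ≤ rank F S) :
    ∑ v, w v * x v ≤ ∑ v, w v * ν v := by
  have hpos : ∑ v, (w v)⁺ * (x v - ν v) ≤ 0 := sum_posPart_mul_nonpos fun t ht => by
    rw [sum_sub_distrib]
    exact sub_nonpos.2 (h.sum_level_le hF hx ht)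
  have hle : ∑ v, w v * (x v - ν v) ≤ ∑ v, (w v)⁺ * (x v - ν v) := by
    refine sum_le_sum fun v _ => ?_
    rcases le_total (w v) 0 with hv | hv
    · rw [h.eq_zero v hv, posPart_eq_zero.2 hv, zero_mul]
      exact mul_nonpos_of_nonpos_of_nonneg hv (by simpa using hx0 v)
    · rw [posPart_eq_self.2 hv]
  simp only [mul_sub, sum_sub_distrib] at hle hpos ⊢
  linarith

end Optimality

section Polytope

theorem convex_setOf_sum_le {N : Type*} (f : Finset N → ℝ) :
    Convex ℝ {x : N → ℝ | (∀ i, 0 ≤ x i) ∧ ∀ S : Finset N, ∑ i ∈ S, x i ≤ f S} := by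
  rintro x ⟨hx0, hx⟩ y ⟨hy0, hy⟩ a b ha hb hab
  refine ⟨fun i => add_nonneg (mul_nonneg ha (hx0 i)) (mul_nonneg hb (hy0 i)), fun S => ?_⟩
  calc ∑ i ∈ S, (a • x + b • y) i = a * ∑ i ∈ S, x i + b * ∑ i ∈ S, y i := by
        simp [sum_add_distrib, mul_sum]
    _ ≤ a * f S + b * f S := by gcongr; exacts [hx S, hy S]
    _ = f S := by rw [← add_mul, hab, one_mul]

theorem finite_realPoints {N : Type*} {F : Set (N → ℕ)} (h : F.Finite) : (realPoints F).Finite :=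
  (h.image fun μ v => (μ v : ℝ)).subset fun _ ⟨μ, hμ, hx⟩ => ⟨μ, hμ, (funext hx).symm⟩

variable [Finite N]

theorem IsSaturable.convexHull_eq (hF : IsSaturable F) :
    convexHull ℝ (realPoints F) =
      {x : N → ℝ | (∀ i, 0 ≤ x i) ∧ ∀ S : Finset N, ∑ i ∈ S, x i ≤ (rank F S : ℝ)} := by
  refine (convexHull_min ?_ (convex_setOf_sum_le _)).antisymm ?_
  · rintro x ⟨μ, hμ, hx⟩
    refine ⟨fun i => by rw [hx]; positivity, fun S => ?_⟩
    simp only [hx]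
    exact_mod_cast hF.sum_le_rank hμ S
  · rintro x ⟨hx0, hx⟩
    cases nonempty_fintype N
    by_contra hnot
    obtain ⟨f, c, hfc, hc⟩ := geometric_hahn_banach_closed_point (convex_convexHull ℝ _)
      ((finite_realPoints hF.finite).isCompact_convexHull ℝ).isClosed hnot
    let w : N → ℝ := fun v => f fun j => if v = j then 1 else 0
    have hf : ∀ y, f y = ∑ v, w v * y v := fun y => by
      simpa [mul_comm] using f.toLinearMap.pi_apply_eq_sum_univ y
    obtain ⟨ν, hν⟩ := hF.exists_greedy w
    have hopt := hν.optimal hF hx0 hx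
    have hνc := hfc (fun v => (ν v : ℝ)) (subset_convexHull ℝ _ ⟨ν, hν.mem, fun _ => rfl⟩)
    rw [hf] at hc hνc
    linarith

theorem IsSaturable.integralPoints_eq (hF : IsSaturable F) :
    integralPoints (convexHull ℝ (realPoints F)) = realPoints F := by
  apply Set.Subset.antisymm
  · rintro x ⟨hx, hinteger⟩
    rw [hF.convexHull_eq] at hx
    choose k hk using hinteger
    have hk0 : ∀ v, 0 ≤ k v := fun v => by
      have := hx.1 v
      rw [hk] at this
      exact_mod_cast this
    have hxk : ∀ v, x v = ((k v).toNat : ℝ) := fun v => by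
      rw [hk]
      exact_mod_cast (Int.toNat_of_nonneg (hk0 v)).symm
    refine ⟨fun v => (k v).toNat, hF.mem_of_sum_le fun S => ?_, hxk⟩
    have := hx.2 S
    simp only [hxk] at this
    exact_mod_cast this
  · rintro x ⟨μ, hμ, hx⟩
    exact ⟨subset_convexHull ℝ _ ⟨μ, hμ, hx⟩, fun v => ⟨μ v, by simpa using hx v⟩⟩

theorem IsSaturable.isPolymatroid (hF : IsSaturable F) :
    IsPolymatroid (convexHull ℝ (realPoints F)) := by
  refine ⟨rank F, fun S T => ?_, hF.convexHull_eq⟩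
  convert hF.rank_submodular S T

end Polytope

end Saturable

theorem Orientable.isSaturable {V E : Type*} [Finite V] [Fintype E] [DecidableEq V]
    {ends : E → V × V} {r : V} (h : Orientable ends r 0) :
    IsSaturable {μ | Orientable ends r μ} where
  zero_mem := h
  lower := fun _ hμ _ hle => hμ.mono hle
  bounded := ⟨Fintype.card E, fun _ hμ v => hμ.le_card v⟩
  saturated := fun _ hμ U hU => hμ.exists_saturated U hU

/-! ## Feasible split vectors and orientations -/

theorem exists_injective_comp_eq {A B κ : Type*} [Finite B] (c : A → κ) (d : B → κ)
    (h : ∀ k, (c ⁻¹' {k}).encard ≤ (d ⁻¹' {k}).encard) :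
    ∃ g : A → B, Function.Injective g ∧ ∀ a, d (g a) = c a := by
  rcases isEmpty_or_nonempty A with hA | ⟨⟨a₀⟩⟩
  · exact ⟨isEmptyElim, fun a => isEmptyElim a, isEmptyElim⟩
  have : Nonempty B := by
    have ha₀ : (c ⁻¹' {c a₀}).Nonempty := ⟨a₀, rfl⟩
    obtain ⟨b, -⟩ := Set.encard_pos.1 ((Set.encard_pos.2 ha₀).trans_le (h (c a₀)))
    exact ⟨b⟩
  have hfin : ∀ k, (c ⁻¹' {k}).Finite := fun k =>
    Set.encard_lt_top_iff.1 ((h k).trans_lt (Set.toFinite _).encard_lt_top)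
  choose g hg hinj using fun k => (hfin k).exists_injOn_of_encard_le (h k)
  have hdg : ∀ a, d (g (c a) a) = c a := fun a => hg (c a) rfl
  refine ⟨fun a => g (c a) a, fun a b hab => ?_, hdg⟩
  have hc : c a = c b := by
    rw [← hdg a, ← hdg b]
    exact congrArg d hab
  exact hinj (c b) hc rfl (by simpa only [hc] using hab)

theorem exists_sym2_eq_iff_isLink {α β : Type*} (G : Graph α β) :
    ∃ c : E(G) → Sym2 V(G), ∀ (e : E(G)) (x y : V(G)), G.IsLink e x y ↔ c e = s(x, y) := by
  choose x y h using fun e : E(G) => Graph.exists_isLink_of_mem_edgeSet e.2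
  refine ⟨fun e => s(⟨x e, (h e).left_mem⟩, ⟨y e, (h e).right_mem⟩), fun e u v => ?_⟩
  rw [Sym2.eq_iff]
  constructor
  · intro he
    rcases (h e).eq_and_eq_or_eq_and_eq he with ⟨h1, h2⟩ | ⟨h1, h2⟩
    exacts [Or.inl ⟨Subtype.ext h1, Subtype.ext h2⟩, Or.inr ⟨Subtype.ext h1, Subtype.ext h2⟩]
  · rintro (⟨rfl, rfl⟩ | ⟨rfl, rfl⟩)
    exacts [h e, (h e).symm]

theorem IsHomImage.exists_edge_map {α β α' β' : Type*} {G : Graph α β} {H : Graph α' β'}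
    {φ : V(H) → V(G)} (h : IsHomImage G H φ) (hE : E(G).Finite) :
    ∃ g : E(H) → E(G), Function.Injective g ∧
      ∀ (f : E(H)) (x y : V(H)), H.IsLink f x y → G.IsLink (g f) (φ x) (φ y) := by
  obtain ⟨c, hc⟩ := exists_sym2_eq_iff_isLink G
  obtain ⟨d, hd⟩ := exists_sym2_eq_iff_isLink H
  have hfiber : ∀ k, ((Sym2.map φ ∘ d) ⁻¹' {k}).encard = (c ⁻¹' {k}).encard := by
    intro k
    induction k using Sym2.ind with
    | _ u v =>
      have hH : Subtype.val '' ((Sym2.map φ ∘ d) ⁻¹' {s(u, v)}) =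
          {f | ∃ x y : V(H), H.IsLink f x y ∧ φ x = u ∧ φ y = v} := by
        ext f
        constructor
        · rintro ⟨f, hf, rfl⟩
          obtain ⟨⟨x, y⟩, hxy⟩ := Sym2.mk_surjective (d f)
          have hf : s(φ x, φ y) = s(u, v) := by simpa [← hxy] using hf
          have hlink := (hd f x y).2 hxy.symm
          rcases Sym2.eq_iff.1 hf with ⟨h1, h2⟩ | ⟨h1, h2⟩
          exacts [⟨x, y, hlink, h1, h2⟩, ⟨y, x, hlink.symm, h2, h1⟩]
        · rintro ⟨x, y, hxy, rfl, rfl⟩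
          exact ⟨⟨f, hxy.edge_mem⟩, by simp [(hd ⟨f, hxy.edge_mem⟩ x y).1 hxy], rfl⟩
      have hG : Subtype.val '' (c ⁻¹' {s(u, v)}) = {e | G.IsLink e u v} := by
        ext e
        constructor
        · rintro ⟨e, he, rfl⟩
          exact (hc e u v).2 he
        · exact fun he => ⟨⟨e, he.edge_mem⟩, (hc ⟨e, he.edge_mem⟩ u v).1 he, rfl⟩
      rw [← Subtype.val_injective.encard_image, hH, ← h.2,
        ← Subtype.val_injective.encard_image (c ⁻¹' _), hG]
  have := hE.to_subtype
  obtain ⟨g, hg, hgc⟩ := exists_injective_comp_eq _ c fun k => (hfiber k).le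
  refine ⟨g, hg, fun f x y hxy => (hc _ _ _).2 ?_⟩
  rw [hgc, Function.comp_apply, (hd f x y).1 hxy, Sym2.map_mk]

section Parents

theorem exists_adj_dist_lt {W : Type*} {S : SimpleGraph W} (hS : S.Connected) {r w : W}
    (h : w ≠ r) : ∃ p, S.Adj p w ∧ S.dist r p < S.dist r w := by
  obtain ⟨q, hq⟩ := hS.exists_walk_length_eq_dist w r
  cases q with
  | nil => exact absurd rfl h
  | @cons _ p _ hp q =>
    refine ⟨p, hp.symm, ?_⟩
    rw [S.dist_comm, S.dist_comm (u := r), ← hq, SimpleGraph.Walk.length_cons]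
    exact Nat.lt_succ_of_le (SimpleGraph.dist_le q)

theorem Connected.exists_parents {α β : Type*} {H : Graph α β} (hH : Connected H) (r : V(H)) :
    ∃ (p : {w // w ≠ r} → V(H)) (f : {w // w ≠ r} → E(H)) (d : V(H) → ℕ),
      Function.Injective f ∧ ∀ w, H.IsLink (f w) (p w) w.1 ∧ d (p w) < d w := by
  have hpar : ∀ w : {w // w ≠ r}, ∃ (p : V(H)) (f : E(H)), H.IsLink f p w.1 ∧
      H.toSimpleGraph.dist r p < H.toSimpleGraph.dist r w.1 := by
    rintro ⟨w, hw⟩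
    obtain ⟨p, ⟨-, f, hf⟩, hlt⟩ := exists_adj_dist_lt hH hw
    exact ⟨p, ⟨f, hf.edge_mem⟩, hf, hlt⟩
  choose p f hf hlt using hpar
  refine ⟨p, f, H.toSimpleGraph.dist r, fun w w' hff => ?_, fun w => ⟨hf w, hlt w⟩⟩
  rcases (hff ▸ hf w).eq_and_eq_or_eq_and_eq (hf w') with ⟨-, h⟩ | ⟨h1, h2⟩
  · exact Subtype.ext (Subtype.ext h)
  · have hw := hlt w
    have hw' := hlt w'
    rw [Subtype.ext h1] at hw
    rw [← Subtype.ext h2] at hw'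
    omega

variable {W V E : Type*} {r : W} {p : {w // w ≠ r} → W} {ψ : W → V}

theorem reaches_of_parents {D : E → V × V} {d : W → ℕ} (hd : ∀ w, d (p w) < d w)
    (hD : ∀ w, ∃ e, D e = (ψ (p w), ψ w)) (w : W) : Reaches D (ψ r) (ψ w) := by
  induction hk : d w using Nat.strong_induction_on generalizing w with
  | _ k ih =>
    by_cases hw : w = r
    · rw [hw]
      exact .refl
    · exact (ih _ (hk ▸ hd ⟨w, hw⟩) _ rfl).tail (hD ⟨w, hw⟩)

theorem encard_fiber_ne [DecidableEq V] {v : V} {k : ℕ} (h : (ψ ⁻¹' {v}).encard = k + 1) :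
    {w : {w // w ≠ r} | ψ w = v}.encard = (k + if v = ψ r then 0 else 1 : ℕ) := by
  have himage : Subtype.val '' {w : {w // w ≠ r} | ψ w = v} = ψ ⁻¹' {v} \ {r} := by
    ext w
    simp [and_comm]
  rw [← Subtype.val_injective.encard_image, himage]
  split_ifs with hv
  · have hr : r ∈ ψ ⁻¹' {v} := hv.symm
    rw [Set.encard_sdiff_singleton_of_mem hr, h]
    norm_cast
  · rw [Set.sdiff_singleton_eq_self (fun hr => hv hr.symm), h]
    simp

theorem orientable_of_parents [Fintype E] [DecidableEq V] {ends : E → V × V}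
    {f : {w // w ≠ r} → E} {d : W → ℕ} {μ : V → ℕ} (hf : Function.Injective f)
    (hd : ∀ w, d (p w) < d w)
    (hends : ∀ w, ends (f w) = (ψ (p w), ψ w) ∨ ends (f w) = (ψ w, ψ (p w)))
    (hμ : ∀ v, (ψ ⁻¹' {v}).encard = μ v + 1) : Orientable ends (ψ r) μ := by
  classical
  let D := Function.extend f (fun w => (ψ (p w), ψ w.1)) ends
  have hD : ∀ w, D (f w) = (ψ (p w), ψ w.1) := fun w => hf.extend_apply _ _ w
  refine ⟨D, fun e => ?_, fun v => ?_, fun v => ?_⟩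
  · by_cases he : ∃ w, f w = e
    · obtain ⟨w, rfl⟩ := he
      rw [hD]
      rcases hends w with h | h <;> simp [h]
    · exact Or.inl (Function.extend_apply' _ _ _ he)
  · obtain ⟨w, rfl⟩ : (ψ ⁻¹' {v}).Nonempty := Set.encard_pos.1 (by simp [hμ v])
    exact reaches_of_parents hd (fun w => ⟨_, hD w⟩) w
  · have hle : {w : {w // w ≠ r} | ψ w = v}.encard ≤ {e | (D e).2 = v}.encard := by
      refine Set.encard_le_encard_of_injOn (f := f) (fun w hw => ?_) hf.injOn
      rw [Set.mem_ofPred_eq, hD]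
      exact hw
    have hcard : {e | (D e).2 = v}.encard = indeg D v := by
      rw [indeg, ← Set.encard_coe_eq_coe_finsetCard]
      simp
    rw [encard_fiber_ne (hμ v), hcard] at hle
    exact_mod_cast hle

end Parents

section Coding

variable {α β : Type*}

/-- Numberings of the vertices and edges of `G` that identify it with the edge list `I`. -/
structure Coding (G : Graph α β) (I : EdgeList) where
  vert : Fin I.n ≃ V(G)
  edge : Fin I.m ≃ E(G)
  isLink_iff : ∀ e u v,
    G.IsLink (edge e) (vert u) (vert v) ↔ I.ends e = (u, v) ∨ I.ends e = (v, u)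

/-- The graph of an edge list is coded by that edge list. -/
def EdgeList.coding (I : EdgeList) : Coding I.toGraph I where
  vert := (Equiv.Set.univ _).symm
  edge := (Equiv.Set.univ _).symm
  isLink_iff := fun _ _ _ => Iff.rfl

theorem exists_coding {G : Graph α β} (hV : V(G).Finite) (hE : E(G).Finite) :
    ∃ I, Nonempty (Coding G I) := by
  have := hV.fintype
  have := hE.fintype
  obtain ⟨c, hc⟩ := exists_sym2_eq_iff_isLink G
  let v := (Fintype.equivFin V(G)).symm
  let e := (Fintype.equivFin E(G)).symm
  choose ends hends using fun j => Sym2.mk_surjective (Sym2.map v.symm (c (e j)))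
  refine ⟨⟨_, _, ends⟩, ⟨⟨v, e, fun j x y => ?_⟩⟩⟩
  rw [hc, ← (Sym2.map.injective v.symm.injective).eq_iff, ← hends, Sym2.map_mk,
    Equiv.symm_apply_apply, Equiv.symm_apply_apply]
  exact Sym2.mk_eq_mk_iff (q := (x, y))

variable {G : Graph α β} {I : EdgeList}

theorem Coding.orientable (C : Coding G I) {μ : V(G) → ℕ} (h : IsFeasibleSplit G μ)
    (r : Fin I.n) : Orientable I.ends r (μ ∘ C.vert) := by
  obtain ⟨α', β', H, φ, hconn, hhom, hmult⟩ := h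
  obtain ⟨g, hg, hlink⟩ := hhom.exists_edge_map (Set.finite_coe_iff.1 (Finite.of_equiv _ C.edge))
  obtain ⟨r₀, hr₀⟩ := hhom.1 (C.vert r)
  obtain ⟨p, f, d, hf, hpar⟩ := hconn.exists_parents r₀
  let ψ : V(H) → Fin I.n := fun x => C.vert.symm (φ x)
  have hψ : r = ψ r₀ := by simp [ψ, hr₀]
  rw [hψ]
  refine orientable_of_parents (ψ := ψ) (f := fun w => C.edge.symm (g (f w)))
    (C.edge.symm.injective.comp (hg.comp hf)) (fun w => (hpar w).2) (fun w => ?_) fun v => ?_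
  · rw [← C.isLink_iff]
    simpa [ψ] using hlink _ _ _ (hpar w).1
  · rw [Function.comp_apply, ← Nat.cast_succ, ← hmult]
    congr 1
    ext w
    simp [ψ, Equiv.symm_apply_eq]

theorem Coding.setOf_isLink (C : Coding G I) (u v : V(G)) :
    {e | G.IsLink e u v} = (fun j => (C.edge j : β)) ''
      {j | I.toGraph.IsLink j (C.vert.symm u) (C.vert.symm v)} := by
  ext e
  constructor
  · intro he
    refine ⟨C.edge.symm ⟨e, he.edge_mem⟩, ?_, by simp⟩
    exact (C.isLink_iff _ _ _).1 (by simpa using he)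
  · rintro ⟨j, hj, rfl⟩
    simpa using (C.isLink_iff j _ _).2 hj

theorem Coding.isFeasibleSplit (C : Coding G I) {μ : V(G) → ℕ}
    (h : IsFeasibleSplit I.toGraph (I.vec (μ ∘ C.vert))) : IsFeasibleSplit G μ := by
  obtain ⟨α', β', H, φ, hconn, ⟨hsurj, hlink⟩, hmult⟩ := h
  have hφ : ∀ w v, C.vert (φ w).1 = v ↔ φ w = I.vert (C.vert.symm v) := fun w v => by
    rw [← Equiv.eq_symm_apply, Subtype.ext_iff, EdgeList.vert]
  refine ⟨α', β', H, fun w => C.vert (φ w).1, hconn, ⟨fun v => ?_, fun u v => ?_⟩, fun v => ?_⟩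
  · obtain ⟨w, hw⟩ := hsurj (I.vert (C.vert.symm v))
    exact ⟨w, (hφ w v).2 hw⟩
  · rw [C.setOf_isLink, Function.Injective.encard_image]
    · simp only [hφ]
      exact hlink (I.vert (C.vert.symm u)) (I.vert (C.vert.symm v))
    · exact fun i j hij => C.edge.injective (Subtype.ext hij)
  · have := hmult (I.vert (C.vert.symm v))
    simp only [EdgeList.vec, EdgeList.vert, Function.comp_apply, Equiv.apply_symm_apply] at this
    rw [← this]
    congr 1
    ext w
    exact hφ w v

end Coding

/-! ## Program logic -/

/-- A bound on the number of steps of a program all of whose loops are iterated at most `X`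
times. -/
noncomputable def Program.cost : Program → Polynomial ℕ
  | .skip => 1
  | .write _ _ _ => 1
  | .seq c₁ c₂ => c₁.cost + c₂.cost
  | .ite _ c₁ c₂ => c₁.cost + c₂.cost + 1
  | .loop _ c => Polynomial.X * (c.cost + 1) + 1

/-- Started in `s`, the program `c` halts in a store that satisfies `Q`, and it takes no more steps
than if all loops were iterated `N` times. -/
def Runs (N : ℕ) (c : Program) (s : Store) (Q : Store → Prop) : Prop :=
  ∃ s' t, Exec c s s' t ∧ t ≤ c.cost.eval N ∧ Q s'

local notation:60 c₁:61 " ;; " c₂:60 => Program.seq c₁ c₂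

/-- Run `c` with cell `0` of array `i` counting from `0` to `e - 1`. -/
def Program.for (i : ℕ) (e : Expr) (c : Program) : Program :=
  .write i (.const 0) (.const 0) ;;
    .loop (.sub e (.read i (.const 0)))
      (c ;; .write i (.const 0) (.add (.read i (.const 0)) (.const 1)))

section Runs

variable {N : ℕ} {s : Store} {Q Q' : Store → Prop}

theorem Runs.mono {c : Program} (h : Runs N c s Q) (hQ : ∀ s', Q s' → Q' s') : Runs N c s Q' := by
  obtain ⟨s', t, h1, h2, h3⟩ := h
  exact ⟨s', t, h1, h2, hQ s' h3⟩

theorem Runs.skip (h : Q s) : Runs N .skip s Q :=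
  ⟨s, 1, .skip s, by simp [Program.cost], h⟩

theorem Runs.write {a : ℕ} {i e : Expr} (h : Q (s.set a (i.eval s) (e.eval s))) :
    Runs N (.write a i e) s Q :=
  ⟨_, 1, .write a i e s, by simp [Program.cost], h⟩

theorem Runs.seq {c₁ c₂ : Program} (h : Runs N c₁ s fun s' => Runs N c₂ s' Q) :
    Runs N (c₁ ;; c₂) s Q := by
  obtain ⟨s', t, h1, h2, s'', t', h1', h2', h3⟩ := h
  refine ⟨s'', t + t', .seq h1 h1', ?_, h3⟩
  rw [Program.cost, Polynomial.eval_add]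
  omega

theorem Runs.ite {e : Expr} {c₁ c₂ : Program} (h₁ : 0 < e.eval s → Runs N c₁ s Q)
    (h₂ : ¬ 0 < e.eval s → Runs N c₂ s Q) : Runs N (.ite e c₁ c₂) s Q := by
  by_cases he : 0 < e.eval s
  · obtain ⟨s', t, h1, h2, h3⟩ := h₁ he
    refine ⟨s', t + 1, .ite_pos he h1, ?_, h3⟩
    simp only [Program.cost, Polynomial.eval_add, Polynomial.eval_one]
    omega
  · obtain ⟨s', t, h1, h2, h3⟩ := h₂ he
    refine ⟨s', t + 1, .ite_neg he h1, ?_, h3⟩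
    simp only [Program.cost, Polynomial.eval_add, Polynomial.eval_one]
    omega

/-- The invariant `J k` promises at most `k` further iterations. -/
theorem Runs.loop {e : Expr} {c : Program} (J : ℕ → Store → Prop) {k : ℕ} (hk : k ≤ N)
    (h0 : J k s)
    (hstep : ∀ k s, J k s → 0 < e.eval s → Runs N c s fun s' => ∃ k' < k, J k' s')
    (hQ : ∀ k s, J k s → ¬ 0 < e.eval s → Q s) : Runs N (.loop e c) s Q := by
  have key : ∀ k s, J k s →
      ∃ s' t, Exec (.loop e c) s s' t ∧ t ≤ k * (c.cost.eval N + 1) + 1 ∧ Q s' := by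
    intro k
    induction k using Nat.strong_induction_on with
    | _ k ih =>
      intro s hs
      by_cases he : 0 < e.eval s
      · obtain ⟨s', t, h1, h2, k', hk', hs'⟩ := hstep k s hs he
        obtain ⟨s'', t', h1', h2', h3⟩ := ih k' hk' s' hs'
        refine ⟨s'', t + t' + 1, .loop_step he h1 h1', ?_, h3⟩
        have := Nat.mul_le_mul_right (c.cost.eval N + 1) hk'
        rw [Nat.succ_mul] at this
        omega
      · exact ⟨s, 1, .loop_done he, by omega, hQ k s hs he⟩
  obtain ⟨s', t, h1, h2, h3⟩ := key k s h0
  refine ⟨s', t, h1, h2.trans ?_, h3⟩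
  simp only [Program.cost, Polynomial.eval_add, Polynomial.eval_mul, Polynomial.eval_X,
    Polynomial.eval_one]
  exact Nat.add_le_add_right (Nat.mul_le_mul_right _ hk) _

@[simp] theorem Store.set_apply (s : Store) (a : ℕ) (k x : ℤ) (b : ℕ) :
    s.set a k x b = if b = a then Function.update (s a) k x else s b := by
  funext j
  by_cases hb : b = a
  · subst hb
    by_cases hj : j = k <;> simp [Store.set, hj]
  · simp [Store.set, hb]

theorem Store.set_ne (s : Store) {a b : ℕ} (k x : ℤ) (h : b ≠ a) : s.set a k x b = s b := by
  simp [h]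

theorem Runs.for {i : ℕ} {e : Expr} {c : Program} (J : ℕ → Store → Prop) {K : ℕ} (hK : K ≤ N)
    (he : ∀ k s, J k s → e.eval s = K) (h0 : J 0 (s.set i 0 0))
    (hstep : ∀ k < K, ∀ s, J k s → s i 0 = k →
      Runs N c s fun s' => s' i 0 = k ∧ J (k + 1) (s'.set i 0 (k + 1)))
    (hQ : ∀ s, J K s → Q s) : Runs N (.for i e c) s Q := by
  refine .seq (.write ?_)
  refine .loop (fun k s => ∃ l, l + k = K ∧ J l s ∧ s i 0 = l) hK
    ⟨0, by simp, h0, by simp [Expr.eval]⟩ ?_ ?_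
  · rintro k s ⟨l, hl, hJ, hs⟩ hpos
    have hlK : l < K := by
      rw [Expr.eval, he l s hJ] at hpos
      simp only [Expr.eval, hs] at hpos
      omega
    refine .seq ((hstep l hlK s hJ hs).mono ?_)
    rintro s' ⟨hs', hJ'⟩
    refine .write ⟨k - 1, by omega, l + 1, by omega, ?_, ?_⟩
    · simpa [Expr.eval, hs'] using hJ'
    · simp [Expr.eval, hs']
  · rintro k s ⟨l, hl, hJ, hs⟩ hpos
    rw [Expr.eval, he l s hJ] at hpos
    simp only [Expr.eval, hs] at hpos
    obtain rfl : l = K := by omega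
    exact hQ s hJ

theorem solvableInPolyTime_of_runs {ι : Type*} {encode : ι → List ℤ} {valid : ι → Prop}
    {IsSolution : ι → List ℤ → Prop} (c : Program)
    (h : ∀ i, valid i → Runs (bitLength (encode i)) c (inputStore (encode i)) fun s =>
      ∃ out, HasOutput s out ∧ IsSolution i out) :
    SolvableInPolyTime encode valid IsSolution := by
  refine ⟨c, c.cost, fun i hi => ?_⟩
  obtain ⟨s, t, h1, h2, out, h3, h4⟩ := h i hi
  exact ⟨s, t, out, h1, h2, h3, h4⟩

end Runs

/-! ## The arrays of the programs -/

-- A name ending in `Reg` stands for an array of which only cell `0` is used.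
local notation "inputArr" => 0
local notation "outputArr" => 1
local notation "vertexCountReg" => 2
local notation "edgeCountReg" => 3
local notation "tailArr" => 4
local notation "headArr" => 5
local notation "markArr" => 6
local notation "parentArr" => 7
local notation "startReg" => 8
local notation "reorientReg" => 9
local notation "roundReg" => 10
local notation "arcReg" => 11
local notation "rootedTailArr" => 12
local notation "rootedHeadArr" => 13
local notation "slackArr" => 14
local notation "wantReg" => 15
local notation "loserReg" => 16
local notation "foundReg" => 17
local notation "allMarkedReg" => 18
local notation "pathVertexReg" => 19
local notation "tempReg" => 20
local notation "pathArcReg" => 21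
local notation "vectorArr" => 22
local notation "selectedReg" => 23
local notation "selectedWeightReg" => 24
local notation "stepReg" => 25
local notation "copiesReg" => 26
local notation "labelArr" => 27
local notation "vertexReg" => 28

/-! ## Stores that hold vectors and orientations -/

/-- The frame condition of a program: the stores agree outside the listed arrays. -/
def Agree (L : List ℕ) (s s' : Store) : Prop :=
  ∀ a, a ∉ L → s' a = s a

theorem Agree.refl (L : List ℕ) (s : Store) : Agree L s s := fun _ _ => rfl

theorem Agree.trans {L : List ℕ} {s s' s'' : Store} (h : Agree L s s') (h' : Agree L s' s'') :
    Agree L s s'' := fun a ha => (h' a ha).trans (h a ha)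

theorem Agree.mono {L L' : List ℕ} {s s' : Store} (h : Agree L s s') (hL : ∀ a ∈ L, a ∈ L') :
    Agree L' s s' := fun a ha => h a fun h' => ha (hL a h')

theorem Agree.set {L : List ℕ} {s s' : Store} (h : Agree L s s') {a : ℕ} (ha : a ∈ L) (k x : ℤ) :
    Agree L s (s'.set a k x) := fun b hb => by
  rw [Store.set_ne _ _ _ (by rintro rfl; exact hb ha), h b hb]

/-- The array `a` holds the vector `f`. -/
def Holds {k : ℕ} (a : ℤ → ℤ) (f : Fin k → ℤ) : Prop :=
  ∀ i : Fin k, a ((i : ℕ) : ℤ) = f i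

theorem Holds.update {k : ℕ} {a : ℤ → ℤ} {f : Fin k → ℤ} (h : Holds a f) (i : Fin k) (x : ℤ) :
    Holds (Function.update a ((i : ℕ) : ℤ) x) (Function.update f i x) := by
  intro j
  by_cases hj : j = i
  · simp [hj]
  · have : ((j : ℕ) : ℤ) ≠ ((i : ℕ) : ℤ) := by
      exact_mod_cast fun h => hj (Fin.ext h)
    rw [Function.update_of_ne hj, Function.update_of_ne this, h j]

theorem Holds.natCast_update {k : ℕ} {a : ℤ → ℤ} {f : Fin k → ℕ} (h : Holds a fun i => (f i : ℤ))
    (i : Fin k) (x : ℕ) :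
    Holds (Function.update a ((i : ℕ) : ℤ) x) fun j => (Function.update f i x j : ℤ) := by
  have := h.update i x
  rwa [show (fun i => (f i : ℤ)) = Nat.cast ∘ f from rfl, ← Function.comp_update] at this

/-- The arrays `a` and `b` hold the tails and the heads of the arcs of `D`. -/
def HoldsArcs {n m : ℕ} (a b : ℤ → ℤ) (D : Fin m → Fin n × Fin n) : Prop :=
  Holds a (fun e => (((D e).1 : ℕ) : ℤ)) ∧ Holds b (fun e => (((D e).2 : ℕ) : ℤ))

theorem HoldsArcs.swap {n m : ℕ} {a b : ℤ → ℤ} {D : Fin m → Fin n × Fin n} (h : HoldsArcs a b D)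
    (e : Fin m) : HoldsArcs (Function.update a ((e : ℕ) : ℤ) (((D e).2 : ℕ) : ℤ))
      (Function.update b ((e : ℕ) : ℤ) (((D e).1 : ℕ) : ℤ))
      (Function.update D e (D e).swap) := by
  constructor
  · convert h.1.update e _ using 1
    funext i
    by_cases hi : i = e
    · subst hi
      simp
    · simp [hi]
  · convert h.2.update e _ using 1
    funext i
    by_cases hi : i = e
    · subst hi
      simp
    · simp [hi]

/-! ## Search -/

/-- The variable kept in cell `0` of array `a`. -/
abbrev Expr.cell (a : ℕ) : Expr := .read a (.const 0)

/-- Write `e` to cell `i` of array `b`, with `arcReg` running from `0` to `K - 1`. -/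
def fillArray (b : ℕ) (K i e : Expr) : Program :=
  .for arcReg K (.write b i e)

/-- Mark the head of the arc `arcReg`, and make this arc the parent arc of its head. -/
def markHead : Program :=
  .write parentArr (.read headArr (.cell arcReg)) (.cell arcReg) ;;
    .write markArr (.read headArr (.cell arcReg))
      (.add (.read markArr (.read tailArr (.cell arcReg))) (.const 1))

/-- Reverse the arc whose index is kept in array `j`. -/
def swapArc (j : ℕ) : Program :=
  .write tempReg (.const 0) (.read tailArr (.cell j)) ;;
    .write tailArr (.cell j) (.read headArr (.cell j)) ;;
    .write headArr (.cell j) (.cell tempReg)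

/-- Extend the search along the arc `arcReg`, if necessary and allowed after reversing it. -/
def searchStep : Program :=
  .ite (.read markArr (.read tailArr (.cell arcReg)))
    (.ite (.sub (.const 1) (.read markArr (.read headArr (.cell arcReg)))) markHead .skip)
    (.ite (.cell reorientReg)
      (.ite (.read markArr (.read headArr (.cell arcReg))) (swapArc arcReg ;; markHead) .skip)
      .skip)

/-- Extend the search along all arcs, one after the other. -/
def searchRound : Program :=
  .for arcReg (.cell edgeCountReg) searchStep

/-- Unmark all vertices. -/
def clearMarks : Program :=
  fillArray markArr (.cell vertexCountReg) (.cell arcReg) (.const 0)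

/-- Mark the vertices that can be reached from the vertex `startReg`; if `reorientReg` is positive,
arcs are reversed in order to reach more vertices. -/
def search : Program :=
  clearMarks ;; .write markArr (.cell startReg) (.const 1) ;;
    .for roundReg (.cell vertexCountReg) searchRound

section Search

variable {n m : ℕ}

/-- The vertices with positive mark. -/
def marked (mk : Fin n → ℕ) : Finset (Fin n) :=
  Finset.univ.filter fun v => 0 < mk v

/-- The search tree given by marks and parent arcs: every marked vertex except the root `src` has a
parent arc, whose tail has a smaller mark. -/
structure SearchTree (D : Fin m → Fin n × Fin n) (src : Fin n) (mk : Fin n → ℕ) (pr : ℤ → ℤ) :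
    Prop where
  root : mk src = 1
  le_card : ∀ v, mk v ≤ (marked mk).card
  parent : ∀ v, v ≠ src → 0 < mk v → ∃ e : Fin m, pr ((v : ℕ) : ℤ) = ((e : ℕ) : ℤ) ∧
    (D e).2 = v ∧ 0 < mk (D e).1 ∧ mk (D e).1 < mk v

variable {D₀ D : Fin m → Fin n × Fin n} {src : Fin n} {mk : Fin n → ℕ} {pr : ℤ → ℤ}

theorem SearchTree.two_le (h : SearchTree D src mk pr) {v : Fin n} (hv : v ≠ src)
    (h0 : 0 < mk v) : 2 ≤ mk v := by
  obtain ⟨e, -, -, h1, h2⟩ := h.parent v hv h0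
  omega

theorem SearchTree.reaches (h : SearchTree D src mk pr) {v : Fin n} (hv : 0 < mk v) :
    Reaches D src v := by
  generalize hk : mk v = k
  induction k using Nat.strong_induction_on generalizing v with
  | _ k ih =>
    by_cases hvs : v = src
    · rw [hvs]
      exact .refl
    · obtain ⟨e, -, h1, h2, h3⟩ := h.parent v hvs hv
      exact (ih _ (hk ▸ h3) h2 rfl).tail ⟨e, Prod.ext rfl h1⟩

theorem marked_update {v : Fin n} {x : ℕ} (hx : 0 < x) :
    marked (Function.update mk v x) = insert v (marked mk) := by
  ext u
  by_cases hu : u = v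
  · simp [marked, hu, hx]
  · simp [marked, hu]

theorem SearchTree.mark (h : SearchTree D src mk pr) {e : Fin m} (h1 : 0 < mk (D e).1)
    (h2 : mk (D e).2 = 0) :
    SearchTree D src (Function.update mk (D e).2 (mk (D e).1 + 1))
        (Function.update pr (((D e).2 : ℕ) : ℤ) ((e : ℕ) : ℤ)) ∧
      (marked mk).card < (marked (Function.update mk (D e).2 (mk (D e).1 + 1))).card := by
  have hcard : (marked (Function.update mk (D e).2 (mk (D e).1 + 1))).card =
      (marked mk).card + 1 := by
    rw [marked_update (Nat.succ_pos _), Finset.card_insert_of_notMem]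
    simp [marked, h2]
  have hne : ∀ v, 0 < mk v → v ≠ (D e).2 := by
    rintro v hv rfl
    omega
  refine ⟨⟨?_, fun v => ?_, fun v hv h0 => ?_⟩, by omega⟩
  · rw [Function.update_of_ne (hne _ (by rw [h.root]; exact Nat.one_pos)), h.root]
  · rw [hcard]
    by_cases hv : v = (D e).2
    · subst hv
      rw [Function.update_self]
      exact Nat.add_le_add_right (h.le_card _) _
    · rw [Function.update_of_ne hv]
      exact (h.le_card v).trans (Nat.le_succ _)
  · by_cases hve : v = (D e).2
    · subst hve
      refine ⟨e, by simp, rfl, ?_⟩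
      rw [Function.update_of_ne (hne _ h1), Function.update_self]
      omega
    · have hcast : ((v : ℕ) : ℤ) ≠ (((D e).2 : ℕ) : ℤ) := by
        exact_mod_cast fun h => hve (Fin.ext h)
      rw [Function.update_of_ne hve] at h0
      obtain ⟨i, h3, h4, h5, h6⟩ := h.parent v hv h0
      refine ⟨i, by rw [Function.update_of_ne hcast, h3], h4, ?_⟩
      rw [Function.update_of_ne hve, Function.update_of_ne (hne _ h5)]
      exact ⟨h5, h6⟩

theorem SearchTree.swap (h : SearchTree D src mk pr) {e : Fin m} (he : mk (D e).1 = 0) :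
    SearchTree (Function.update D e (D e).swap) src mk pr := by
  refine ⟨h.root, h.le_card, fun v hv h0 => ?_⟩
  obtain ⟨i, h1, h2, h3, h4⟩ := h.parent v hv h0
  have hi : i ≠ e := by
    rintro rfl
    omega
  exact ⟨i, h1, by rwa [Function.update_of_ne hi], by rwa [Function.update_of_ne hi],
    by rwa [Function.update_of_ne hi]⟩

/-- The state of the search: `D` results from `D₀` by reversing arcs, where `0 < sw` if arcs may be
reversed. -/
structure SearchState (D₀ : Fin m → Fin n × Fin n) (src : Fin n) (sw : ℤ) (s : Store)
    (D : Fin m → Fin n × Fin n) (mk : Fin n → ℕ) : Prop where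
  arcs : HoldsArcs (s tailArr) (s headArr) D
  marks : Holds (s markArr) (fun v => (mk v : ℤ))
  tree : SearchTree D src mk (s parentArr)
  orientation : IsOrientation D₀ D
  fixed : sw ≤ 0 → D = D₀

variable {s : Store} {sw : ℤ}

theorem SearchState.set (h : SearchState D₀ src sw s D mk) {a : ℕ}
    (ha : a ∉ [tailArr, headArr, markArr, parentArr]) (k x : ℤ) :
    SearchState D₀ src sw (s.set a k x) D mk := by
  have hne : ∀ b ∈ [tailArr, headArr, markArr, parentArr], s.set a k x b = s b := fun b hb =>
    Store.set_ne _ _ _ (by rintro rfl; exact ha hb)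
  refine ⟨?_, ?_, ?_, h.orientation, h.fixed⟩
  · rw [hne tailArr (by simp), hne headArr (by simp)]
    exact h.arcs
  · rw [hne markArr (by simp)]
    exact h.marks
  · rw [hne parentArr (by simp)]
    exact h.tree

/-- The search cannot be extended along the arc `e`. -/
def ClosedAt (sw : ℤ) (D : Fin m → Fin n × Fin n) (mk : Fin n → ℕ) (e : Fin m) : Prop :=
  (0 < mk (D e).1 → 0 < mk (D e).2) ∧ (0 < sw → 0 < mk (D e).2 → 0 < mk (D e).1)

variable {N : ℕ}

theorem swapArc_runs (h : HoldsArcs (s tailArr) (s headArr) D) {j : ℕ} (htail : j ≠ tailArr)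
    (htemp : j ≠ tempReg) {e : Fin m} (hj : s j 0 = ((e : ℕ) : ℤ)) :
    Runs N (swapArc j) s fun s' => Agree [tailArr, headArr, tempReg] s s' ∧
      HoldsArcs (s' tailArr) (s' headArr) (Function.update D e (D e).swap) := by
  refine .seq (.write (.seq (.write (.write ⟨?_, ?_⟩))))
  · exact (((Agree.refl _ s).set (by simp) _ _).set (by simp) _ _).set (by simp) _ _
  · have := h.swap e
    simpa [Expr.eval, htail, htemp, hj, h.1 e, h.2 e] using this

theorem SearchState.swapArc_runs (h : SearchState D₀ src sw s D mk) (hsw : 0 < sw) {e : Fin m}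
    (hj : s arcReg 0 = ((e : ℕ) : ℤ)) (he : mk (D e).1 = 0) :
    Runs N (swapArc arcReg) s fun s' => Agree [tailArr, headArr, tempReg] s s' ∧
      SearchState D₀ src sw s' (Function.update D e (D e).swap) mk := by
  refine (KTrail.swapArc_runs h.arcs (by simp) (by simp) hj).mono fun s' ⟨ha, harcs⟩ =>
    ⟨ha, harcs, ?_, ?_, h.orientation.update_swap e, fun h => absurd hsw h.not_gt⟩
  · rw [ha markArr (by simp)]
    exact h.marks
  · rw [ha parentArr (by simp)]
    exact h.tree.swap he

theorem markHead_runs (h : SearchState D₀ src sw s D mk) {e : Fin m}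
    (hj : s arcReg 0 = ((e : ℕ) : ℤ)) (h1 : 0 < mk (D e).1) (h2 : mk (D e).2 = 0) :
    Runs N markHead s fun s' => Agree [markArr, parentArr] s s' ∧
      ∃ mk', SearchState D₀ src sw s' D mk' ∧ (marked mk).card < (marked mk').card := by
  refine .seq (.write (.write ⟨?_, ?_⟩))
  · exact ((Agree.refl _ s).set (by simp) _ _).set (by simp) _ _
  · refine ⟨Function.update mk (D e).2 (mk (D e).1 + 1), ⟨?_, ?_, ?_, h.orientation, h.fixed⟩,
      (h.tree.mark h1 h2).2⟩
    · simpa using h.arcs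
    · have := h.marks.natCast_update (D e).2 (mk (D e).1 + 1)
      simpa [Expr.eval, hj, h.arcs.1 e, h.arcs.2 e, h.marks _] using this
    · simpa [Expr.eval, hj, h.arcs.1 e, h.arcs.2 e] using (h.tree.mark h1 h2).1

theorem searchStep_runs (h : SearchState D₀ src sw s D mk) {e : Fin m}
    (hj : s arcReg 0 = ((e : ℕ) : ℤ)) (hsw : s reorientReg 0 = sw) :
    Runs N searchStep s fun s' => Agree [tailArr, headArr, markArr, parentArr, tempReg] s s' ∧
      ∃ D' mk', SearchState D₀ src sw s' D' mk' ∧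
        ((marked mk).card < (marked mk').card ∧ ¬ ClosedAt sw D mk e ∨
          D' = D ∧ mk' = mk ∧ ClosedAt sw D mk e) := by
  have hskip : ClosedAt sw D mk e → Agree [tailArr, headArr, markArr, parentArr, tempReg] s s ∧
      ∃ D' mk', SearchState D₀ src sw s D' mk' ∧
        ((marked mk).card < (marked mk').card ∧ ¬ ClosedAt sw D mk e ∨
          D' = D ∧ mk' = mk ∧ ClosedAt sw D mk e) :=
    fun hc => ⟨Agree.refl _ s, D, mk, h, Or.inr ⟨rfl, rfl, hc⟩⟩
  refine .ite (fun h1 => .ite (fun h2 => ?_) (fun h2 => .skip (hskip ?_)))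
    (fun h1 => .ite (fun h2 => .ite (fun h3 => ?_) (fun h3 => .skip (hskip ?_)))
      (fun h2 => .skip (hskip ?_))) <;>
    simp only [Expr.eval, hj, h.arcs.1 e, h.arcs.2 e, h.marks _, hsw] at h1 h2
  · refine (markHead_runs h hj (by omega) (by omega)).mono fun s' ⟨ha, mk', h', hlt⟩ =>
      ⟨ha.mono (by simp), D, mk', h', Or.inl ⟨hlt, fun hc => ?_⟩⟩
    have := hc.1 (by omega)
    omega
  · exact ⟨fun _ => by omega, fun _ _ => by omega⟩
  · simp only [Expr.eval, hj, h.arcs.2 e, h.marks _] at h3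
    refine .seq ((h.swapArc_runs h2 hj (by omega)).mono fun s' ⟨ha, hst⟩ => ?_)
    refine (markHead_runs (e := e) hst (by rw [ha arcReg (by simp), hj]) (by simp; omega)
      (by simp; omega)).mono fun s'' ⟨ha', mk', h', hlt⟩ =>
        ⟨(ha.mono (by simp)).trans (ha'.mono (by simp)), _, mk', h', Or.inl ⟨hlt, fun hc => ?_⟩⟩
    have := hc.2 (by omega) (by omega)
    omega
  · simp only [Expr.eval, hj, h.arcs.2 e, h.marks _] at h3
    exact ⟨fun _ => by omega, fun _ _ => by omega⟩
  · exact ⟨fun _ => by omega, fun _ => by omega⟩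

theorem SearchTree.single (D : Fin m → Fin n × Fin n) (src : Fin n) (pr : ℤ → ℤ) :
    SearchTree D src (Pi.single src 1) pr := by
  have hmarked : marked (Pi.single src 1) = {src} := by
    ext v
    by_cases hv : v = src <;> simp [marked, hv]
  refine ⟨by simp, fun v => ?_, fun v hv h0 => absurd h0 (by simp [hv])⟩
  rw [hmarked, Finset.card_singleton, Pi.single_apply]
  split_ifs <;> simp

theorem fillArray_frame_runs {b K : ℕ} {c i e : Expr} {p f : Fin K → ℤ} (hK : K ≤ N)
    (hb : b ≠ arcReg) (hc : ∀ t, Agree [b, arcReg] s t → c.eval t = K) (hp : Function.Injective p)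
    (h : ∀ t, Agree [b, arcReg] s t → ∀ j : Fin K, t arcReg 0 = ((j : ℕ) : ℤ) →
      i.eval t = p j ∧ e.eval t = f j) :
    Runs N (fillArray b c i e) s fun s' => Agree [b, arcReg] s s' ∧ (∀ j, s' b (p j) = f j) ∧
      ∀ x, (∀ j, p j ≠ x) → s' b x = s b x := by
  refine .for (fun k s' => Agree [b, arcReg] s s' ∧ (∀ j : Fin K, (j : ℕ) < k → s' b (p j) = f j) ∧
      ∀ x, (∀ j, p j ≠ x) → s' b x = s b x)
    hK (fun k s' h' => hc s' h'.1) ⟨(Agree.refl _ s).set (by simp) _ _, by simp, by simp [hb]⟩ ?_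
    fun s' ⟨ha, hf, hframe⟩ => ⟨ha, fun j => hf j j.2, hframe⟩
  rintro k hk s' ⟨ha, hf, hframe⟩ hs'
  obtain ⟨hi, he⟩ := h s' ha ⟨k, hk⟩ hs'
  refine .write ⟨by rwa [Store.set_ne _ _ _ hb.symm],
    (ha.set (by simp) _ _).set (by simp) _ _, fun j hj => ?_, fun x hx => ?_⟩
  · rw [Store.set_ne _ _ _ hb, Store.set_apply, if_pos rfl, hi, he]
    rcases Nat.lt_succ_iff_lt_or_eq.1 hj with hjk | rfl
    · rw [Function.update_of_ne fun heq => hjk.ne (congrArg Fin.val (hp heq)), hf j hjk]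
    · rw [Function.update_self]
  · rw [Store.set_ne _ _ _ hb, Store.set_apply, if_pos rfl, hi, Function.update_of_ne (hx _).symm,
      hframe x hx]

theorem fillArray_runs {b K : ℕ} {c i e : Expr} {p f : Fin K → ℤ} (hK : K ≤ N) (hb : b ≠ arcReg)
    (hc : ∀ t, Agree [b, arcReg] s t → c.eval t = K) (hp : Function.Injective p)
    (h : ∀ t, Agree [b, arcReg] s t → ∀ j : Fin K, t arcReg 0 = ((j : ℕ) : ℤ) →
      i.eval t = p j ∧ e.eval t = f j) :
    Runs N (fillArray b c i e) s fun s' => Agree [b, arcReg] s s' ∧ ∀ j, s' b (p j) = f j :=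
  (fillArray_frame_runs hK hb hc hp h).mono fun _ h' => ⟨h'.1, h'.2.1⟩

theorem natCast_val_injective (K : ℕ) : Function.Injective fun j : Fin K => ((j : ℕ) : ℤ) :=
  Nat.cast_injective.comp Fin.val_injective

theorem clearMarks_runs (hn : n ≤ N) (hcount : s vertexCountReg 0 = n) :
    Runs N clearMarks s fun s' => Agree [markArr, arcReg] s s' ∧
      Holds (s' markArr) (0 : Fin n → ℤ) :=
  fillArray_runs hn (by simp) (fun t ha => by simp [Expr.eval, ha vertexCountReg, hcount])
    (natCast_val_injective n) fun _ _ _ hj => ⟨hj, rfl⟩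

/-- The progress of the search: at least `k` vertices are marked, unless the search is complete. -/
def SearchProgress (D₀ : Fin m → Fin n × Fin n) (src : Fin n) (sw : ℤ) (k : ℕ) (s : Store) : Prop :=
  ∃ D mk, SearchState D₀ src sw s D mk ∧ (k ≤ (marked mk).card ∨ ∀ e, ClosedAt sw D mk e)

theorem SearchProgress.set {k : ℕ} (h : SearchProgress D₀ src sw k s) {a : ℕ}
    (ha : a ∉ [tailArr, headArr, markArr, parentArr]) (i x : ℤ) :
    SearchProgress D₀ src sw k (s.set a i x) := by
  obtain ⟨D, mk, hst, hk⟩ := h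
  exact ⟨D, mk, hst.set ha i x, hk⟩

theorem searchProgress_one (harcs : HoldsArcs (s tailArr) (s headArr) D₀)
    (hmarks : Holds (s markArr) (Pi.single src (1 : ℤ))) : SearchProgress D₀ src sw 1 s := by
  refine ⟨D₀, Pi.single src 1, ⟨harcs, fun v => ?_, .single D₀ src _, fun e => Or.inl rfl,
    fun _ => rfl⟩, Or.inl (Finset.card_pos.2 ⟨src, by simp [marked]⟩)⟩
  rw [hmarks v, Pi.single_apply]
  by_cases hv : v = src <;> simp [hv]

theorem searchRound_runs {k : ℕ} (hm : m ≤ N) (hcount : s edgeCountReg 0 = m)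
    (hsw : s reorientReg 0 = sw) (h : SearchProgress D₀ src sw k s) :
    Runs N searchRound s fun s' =>
      Agree [tailArr, headArr, markArr, parentArr, arcReg, tempReg] s s' ∧
        SearchProgress D₀ src sw (k + 1) s' := by
  obtain ⟨D, mk, hst, hprog⟩ := h
  refine .for (fun j t => Agree [tailArr, headArr, markArr, parentArr, arcReg, tempReg] s t ∧
    ∃ D mk, SearchState D₀ src sw t D mk ∧ ((∀ e, ClosedAt sw D mk e) ∨ k + 1 ≤ (marked mk).card ∨
      k ≤ (marked mk).card ∧ ∀ e : Fin m, (e : ℕ) < j → ClosedAt sw D mk e)) hm ?_ ?_ ?_ ?_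
  · rintro j t ⟨ha, -⟩
    simp [Expr.eval, ha edgeCountReg (by simp), hcount]
  · exact ⟨(Agree.refl _ s).set (by simp) _ _, D, mk, hst.set (by simp) _ _,
      hprog.elim (fun h => Or.inr (Or.inr ⟨h, by simp⟩)) Or.inl⟩
  · rintro j hj t ⟨ha, D, mk, hst, hprog⟩ htj
    refine (searchStep_runs (e := ⟨j, hj⟩) hst htj (by rw [ha reorientReg (by simp), hsw])).mono ?_
    rintro t' ⟨ha', D', mk', hst', hstep⟩
    refine ⟨by rw [ha' arcReg (by simp), htj], (ha.trans (ha'.mono (by simp))).set (by simp) _ _,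
      D', mk', hst'.set (by simp) _ _, ?_⟩
    rcases hstep with ⟨hlt, hnot⟩ | ⟨rfl, rfl, hclosed⟩
    · rcases hprog with h | h | ⟨h, -⟩
      · exact absurd (h _) hnot
      · exact Or.inr (Or.inl (h.trans hlt.le))
      · exact Or.inr (Or.inl (h.trans_lt hlt))
    · refine hprog.imp_right (Or.imp_right fun h => ⟨h.1, fun e he => ?_⟩)
      rcases Nat.lt_succ_iff_lt_or_eq.1 he with hej | rfl
      exacts [h.2 e hej, hclosed]
  · rintro t ⟨ha, D, mk, hst, hprog⟩
    refine ⟨ha, D, mk, hst, ?_⟩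
    rcases hprog with h | h | h
    exacts [Or.inr h, Or.inl h, Or.inr fun e => h.2 e e.2]

theorem search_runs (hn : n ≤ N) (hm : m ≤ N) (hcountV : s vertexCountReg 0 = n)
    (hcountE : s edgeCountReg 0 = m) (harcs : HoldsArcs (s tailArr) (s headArr) D₀)
    (hsrc : s startReg 0 = ((src : ℕ) : ℤ)) :
    Runs N search s fun s' =>
      Agree [tailArr, headArr, markArr, parentArr, roundReg, arcReg, tempReg] s s' ∧
        ∃ D mk, SearchState D₀ src (s reorientReg 0) s' D mk ∧
          ∀ e, ClosedAt (s reorientReg 0) D mk e := by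
  refine .seq ((clearMarks_runs hn hcountV).mono fun s₁ ⟨ha₁, hclear⟩ => .seq (.write ?_))
  refine .for (fun k s' =>
    Agree [tailArr, headArr, markArr, parentArr, roundReg, arcReg, tempReg] s s' ∧
      SearchProgress D₀ src (s reorientReg 0) (k + 1) s') hn ?_ ?_ ?_ ?_
  · rintro k s' ⟨ha, -⟩
    simp [Expr.eval, ha vertexCountReg (by simp), hcountV]
  · refine ⟨((ha₁.mono (by simp)).set (by simp) _ _).set (by simp) _ _,
      (searchProgress_one ?_ ?_).set (by simp) _ _⟩
    · simpa [ha₁ tailArr, ha₁ headArr] using harcs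
    · simpa [Expr.eval, ha₁ startReg, hsrc, Pi.single] using hclear.update src 1
  · rintro k - s' ⟨ha, hprog⟩ hs'
    refine (searchRound_runs hm (by rw [ha edgeCountReg (by simp), hcountE])
      (ha reorientReg (by simp) ▸ rfl) hprog).mono fun s'' ⟨ha', hprog'⟩ =>
        ⟨by rw [ha' roundReg (by simp), hs'], ?_, hprog'.set (by simp) _ _⟩
    exact (ha.trans (ha'.mono (by simp))).set (by simp) _ _
  · rintro s' ⟨ha, D, mk, hst, hprog⟩
    refine ⟨ha, D, mk, hst, hprog.resolve_left fun h => ?_⟩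
    have := (marked mk).card_le_univ
    rw [Fintype.card_fin] at this
    omega

theorem SearchState.pos_iff_reaches (h : SearchState D₀ src sw s D mk) (hsw : sw ≤ 0)
    (hc : ∀ e, ClosedAt sw D mk e) (v : Fin n) : 0 < mk v ↔ Reaches D₀ src v := by
  obtain rfl := h.fixed hsw
  refine ⟨h.tree.reaches, fun hr => ?_⟩
  by_contra hv
  obtain ⟨e, h1, h2⟩ := exists_arc_leaving (P := fun v => 0 < mk v) hr
    (by rw [h.tree.root]; exact Nat.one_pos) hv
  exact h2 ((hc e).1 h1)

theorem search_fixed_runs (hn : n ≤ N) (hm : m ≤ N) (hcountV : s vertexCountReg 0 = n)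
    (hcountE : s edgeCountReg 0 = m) (hfixed : s reorientReg 0 = 0)
    (harcs : HoldsArcs (s tailArr) (s headArr) D) (hsrc : s startReg 0 = ((src : ℕ) : ℤ)) :
    Runs N search s fun s' =>
      Agree [tailArr, headArr, markArr, parentArr, roundReg, arcReg, tempReg] s s' ∧
        ∃ mk, SearchState D src 0 s' D mk ∧ ∀ v, 0 < mk v ↔ Reaches D src v := by
  refine (search_runs hn hm hcountV hcountE harcs hsrc).mono fun s' ⟨ha, D', mk, hst, hclosed⟩ => ?_
  rw [hfixed] at hst hclosed
  obtain rfl : D' = D := hst.fixed le_rfl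
  exact ⟨ha, mk, hst, hst.pos_iff_reaches le_rfl hclosed⟩

end Search

/-! ## Augmentation -/

/-- Copy the first cells of array `a` to array `b`, one for every arc. -/
def copyArray (a b : ℕ) : Program :=
  fillArray b (.cell edgeCountReg) (.cell arcReg) (.read a (.cell arcReg))

/-- Copy the arcs held by the arrays `a` and `b` to the arrays `a'` and `b'`. -/
def copyArcs (a b a' b' : ℕ) : Program :=
  copyArray a a' ;; copyArray b b'

/-- Follow the parent arcs from the vertex `pathVertexReg` to the start of the search, and reverse
them. -/
def reversePath : Program :=
  .loop (.sub (.read markArr (.cell pathVertexReg)) (.const 1))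
    (.write pathArcReg (.const 0) (.read parentArr (.cell pathVertexReg)) ;; swapArc pathArcReg ;;
      .write pathVertexReg (.const 0) (.read headArr (.cell pathArcReg)))

/-- Test whether all vertices are marked. -/
def allMarked : Program :=
  .write allMarkedReg (.const 0) (.const 1) ;;
    .for arcReg (.cell vertexCountReg)
      (.ite (.sub (.const 1) (.read markArr (.cell arcReg)))
        (.write allMarkedReg (.const 0) (.const 0)) .skip)

/-- Search the stored root-connected orientation from the vertex `e`. -/
def searchRooted (e : Expr) : Program :=
  copyArcs rootedTailArr rootedHeadArr tailArr headArr ;; .write startReg (.const 0) e ;; search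

/-- Test whether the current orientation is connected from the root `0`. -/
def testRooted : Program :=
  .write startReg (.const 0) (.const 0) ;; search ;; allMarked

/-- Accept the current orientation, in which the vertex `loserReg` has lost an arc. -/
def accept : Program :=
  copyArcs tailArr headArr rootedTailArr rootedHeadArr ;;
    .write slackArr (.cell loserReg) (.sub (.read slackArr (.cell loserReg)) (.const 1)) ;;
    .write foundReg (.const 0) (.const 1)

/-- Try to move an entering arc from the vertex `loserReg` to the vertex `wantReg`, by reversing a
path from `wantReg` to `loserReg`. -/
def exchange : Program :=
  searchRooted (.cell wantReg) ;;
    .ite (.read markArr (.cell loserReg))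
      (.write pathVertexReg (.const 0) (.cell loserReg) ;; reversePath ;; testRooted ;;
        .ite (.cell allMarkedReg) accept .skip)
      .skip

/-- Try `exchange`, unless an arc has already been found or `loserReg` cannot spare one. -/
def tryExchange : Program :=
  .ite (.sub (.const 1) (.cell foundReg))
    (.ite (.read slackArr (.cell loserReg)) exchange .skip) .skip

/-- Try to find another entering arc for the vertex `wantReg`. -/
def augment : Program :=
  .write foundReg (.const 0) (.const 0) ;; .for loserReg (.cell vertexCountReg) tryExchange

section Augment

variable {n m N : ℕ} {s : Store} {ends D : Fin m → Fin n × Fin n} {r src u v : Fin n}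
  {ν sl mk : Fin n → ℕ}

theorem copyArray_runs {a b : ℕ} (hm : m ≤ N) (hcount : s edgeCountReg 0 = m) {f : Fin m → ℤ}
    (h : Holds (s a) f) (ha : a ≠ b) (ha' : a ≠ arcReg) (hb : b ≠ arcReg)
    (hb' : b ≠ edgeCountReg) :
    Runs N (copyArray a b) s fun s' => Agree [b, arcReg] s s' ∧ Holds (s' b) f := by
  have hab : a ∉ [b, arcReg] := by simp [ha, ha']
  have hcountb : edgeCountReg ∉ [b, arcReg] := by simp [hb'.symm]
  refine fillArray_runs hm hb (fun t h' => by simp [Expr.eval, h' edgeCountReg hcountb, hcount])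
    (natCast_val_injective m) fun t h' j hj => ⟨hj, ?_⟩
  simp only [Expr.eval, hj, h' a hab]
  exact h j

theorem copyArcs_runs {a b a' b' : ℕ} (hm : m ≤ N) (hcount : s edgeCountReg 0 = m)
    (h : HoldsArcs (s a) (s b) D) (hne : [a, b, a', b', arcReg, edgeCountReg].Nodup) :
    Runs N (copyArcs a b a' b') s fun s' =>
      Agree [a', b', arcReg] s s' ∧ HoldsArcs (s' a') (s' b') D := by
  simp only [List.nodup_cons, List.mem_cons, not_or, List.not_mem_nil] at hne
  refine .seq ((copyArray_runs hm hcount h.1 (by omega) (by omega) (by omega)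
    (by omega)).mono fun s₁ ⟨ha₁, htail⟩ => ?_)
  have hb : Holds (s₁ b) fun e => (((D e).2 : ℕ) : ℤ) := by
    rw [ha₁ b (by simp; omega)]
    exact h.2
  refine (copyArray_runs hm (by rw [ha₁ edgeCountReg (by simp; omega), hcount]) hb (by omega)
    (by omega) (by omega) (by omega)).mono fun s₂ ⟨ha₂, hhead⟩ =>
      ⟨(ha₁.mono (by simp)).trans (ha₂.mono (by simp)), ?_, hhead⟩
  rw [ha₂ a' (by simp; omega)]
  exact htail

/-- `D'` results from `D` by reversing a path from `x` to `u` that consists of arcs of the search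
tree with marks `mk`. -/
structure ReversedPath (ends D : Fin m → Fin n × Fin n) (mk : Fin n → ℕ) (u x : Fin n)
    (D' : Fin m → Fin n × Fin n) : Prop where
  orientation : IsOrientation ends D'
  eq_of_le : ∀ e, mk (D e).2 ≤ mk x → D' e = D e
  degree : ∀ y, indeg D' y + (if y = u then 1 else 0) = indeg D y + (if y = x then 1 else 0)

theorem ReversedPath.step {D' : Fin m → Fin n × Fin n} {e : Fin m}
    (h : ReversedPath ends D mk u (D e).2 D') (he : mk (D e).1 < mk (D e).2) :
    ReversedPath ends D mk u (D e).1 (Function.update D' e (D' e).swap) := by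
  refine ⟨h.orientation.update_swap e, fun i hi => ?_, fun y => ?_⟩
  · rw [Function.update_of_ne (by rintro rfl; omega), h.eq_of_le i (hi.trans he.le)]
  · have hdeg := h.degree y
    have hswap := indeg_update_swap D' e y
    rw [h.eq_of_le e le_rfl] at hswap ⊢
    omega

theorem reversePath_runs (hn : n ≤ N) {sw : ℤ} {D₀ : Fin m → Fin n × Fin n}
    (h : SearchState D₀ src sw s D mk) (hD : IsOrientation ends D)
    (hu : s pathVertexReg 0 = ((u : ℕ) : ℤ)) (hmk : 0 < mk u) :
    Runs N reversePath s fun s' =>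
      Agree [tailArr, headArr, pathVertexReg, tempReg, pathArcReg] s s' ∧
        ∃ D', HoldsArcs (s' tailArr) (s' headArr) D' ∧ ReversedPath ends D mk u src D' := by
  have hle : mk u ≤ N :=
    ((h.tree.le_card u).trans (by simpa using (marked mk).card_le_univ)).trans hn
  refine .loop (fun k t => Agree [tailArr, headArr, pathVertexReg, tempReg, pathArcReg] s t ∧
    ∃ x D', t pathVertexReg 0 = (((x : Fin n) : ℕ) : ℤ) ∧ 0 < mk x ∧ mk x = k ∧
      HoldsArcs (t tailArr) (t headArr) D' ∧ ReversedPath ends D mk u x D') hle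
    ⟨Agree.refl _ s, u, D, hu, hmk, rfl, h.arcs, hD, fun _ _ => rfl, fun _ => rfl⟩ ?_ ?_
  · rintro _ t ⟨ha, x, D', hx, hx0, rfl, harcs, hrev⟩ hpos
    simp only [Expr.eval, hx, ha markArr (by simp), h.marks x] at hpos
    have hxs : x ≠ src := by
      rintro rfl
      rw [h.tree.root] at hpos
      omega
    obtain ⟨e, hparent, rfl, htail, hlt⟩ := h.tree.parent x hxs hx0
    refine .seq (.write (.seq ?_))
    refine (swapArc_runs (D := D') (e := e) (by simpa using harcs) (by simp) (by simp)
      (by simp [Expr.eval, hx, ha parentArr (by simp), hparent])).mono fun t' ⟨ha', harcs'⟩ => ?_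
    have harc : t' pathArcReg 0 = ((e : ℕ) : ℤ) := by
      rw [ha' pathArcReg (by simp)]
      simp [Expr.eval, hx, ha parentArr (by simp), hparent]
    have hframe : Agree [tailArr, headArr, pathVertexReg, tempReg, pathArcReg] s t' :=
      (ha.set (by simp) _ _).trans (ha'.mono (by simp))
    refine .write ⟨mk (D e).1, hlt, hframe.set (by simp) _ _, (D e).1, _, ?_, htail, rfl,
      by simpa using harcs', hrev.step hlt⟩
    simp [Expr.eval, harc, harcs'.2 e, hrev.eq_of_le e le_rfl]
  · rintro _ t ⟨ha, x, D', hx, hx0, rfl, harcs, hrev⟩ hpos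
    obtain rfl : x = src := by
      by_contra hxs
      have := h.tree.two_le hxs hx0
      simp only [Expr.eval, hx, ha markArr (by simp), h.marks x] at hpos
      omega
    exact ⟨ha, D', harcs, hrev⟩

theorem allMarked_runs (hn : n ≤ N) (hcount : s vertexCountReg 0 = n)
    (h : Holds (s markArr) (fun v => (mk v : ℤ))) :
    Runs N allMarked s fun s' =>
      Agree [arcReg, allMarkedReg] s s' ∧ (0 < s' allMarkedReg 0 ↔ ∀ v, 0 < mk v) := by
  refine .seq (.write (.for (fun k s' => Agree [arcReg, allMarkedReg] s s' ∧
    (0 < s' allMarkedReg 0 ↔ ∀ v : Fin n, (v : ℕ) < k → 0 < mk v)) hn ?_ ?_ ?_ ?_))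
  · rintro k s' ⟨ha, -⟩
    simp [Expr.eval, ha vertexCountReg (by simp), hcount]
  · exact ⟨((Agree.refl _ s).set (by simp) _ _).set (by simp) _ _, by simp [Expr.eval]⟩
  · rintro k hk s' ⟨ha, hall⟩ hs'
    have hsucc : (∀ v : Fin n, (v : ℕ) < k + 1 → 0 < mk v) ↔
        (∀ v : Fin n, (v : ℕ) < k → 0 < mk v) ∧ 0 < mk ⟨k, hk⟩ := by
      refine ⟨fun h => ⟨fun v hv => h v (by omega), h _ (Nat.lt_succ_self k)⟩, fun h v hv => ?_⟩
      rcases Nat.lt_succ_iff_lt_or_eq.1 hv with hvk | rfl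
      exacts [h.1 v hvk, h.2]
    have hval : s' markArr k = mk ⟨k, hk⟩ := by rw [ha markArr (by simp)]; exact h ⟨k, hk⟩
    refine .ite (fun h1 => .write ⟨by simpa using hs', ?_, ?_⟩)
      (fun h1 => .skip ⟨hs', ha.set (by simp) _ _, ?_⟩) <;>
      simp only [Expr.eval, hs', hval] at h1
    · exact (ha.set (by simp) _ _).set (by simp) _ _
    · have : ¬ 0 < mk ⟨k, hk⟩ := by omega
      rw [hsucc]
      simp [Expr.eval, this]
    · have : 0 < mk ⟨k, hk⟩ := by omega
      rw [hsucc, Store.set_ne _ _ _ (by simp), hall]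
      simp [this]
  · exact fun s' ⟨ha, hall⟩ =>
      ⟨ha, hall.trans ⟨fun hall v => hall v v.2, fun hall v _ => hall v⟩⟩

/-- The state between augmentations: the store holds a root-connected orientation `D` in which
every vertex `v` has `sl v` entering arcs more than needed for `ν`. -/
structure AugState (ends : Fin m → Fin n × Fin n) (r : Fin n) (s : Store) (ν : Fin n → ℕ)
    (D : Fin m → Fin n × Fin n) (sl : Fin n → ℕ) : Prop where
  vertices : s vertexCountReg 0 = n
  edges : s edgeCountReg 0 = m
  fixed : s reorientReg 0 = 0
  arcs : HoldsArcs (s rootedTailArr) (s rootedHeadArr) D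
  slack : Holds (s slackArr) (fun v => (sl v : ℤ))
  orientation : IsOrientation ends D
  rootConnected : RootConnected D r
  degree : ∀ v, ν v + (if v = r then 0 else 1) + sl v = indeg D v

/-- The store holds an orientation that shows that `ν` is orientable. -/
def HoldsWitness (ends : Fin m → Fin n × Fin n) (r : Fin n) (ν : Fin n → ℕ) (s : Store) : Prop :=
  ∃ D sl, AugState ends r s ν D sl

theorem HoldsWitness.orientable (h : HoldsWitness ends r ν s) : Orientable ends r ν := by
  obtain ⟨D, sl, h⟩ := h
  exact ⟨D, h.orientation, h.rootConnected, fun v => (Nat.le_add_right _ _).trans (h.degree v).le⟩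

theorem AugState.of_agree (h : AugState ends r s ν D sl) {L : List ℕ} {s' : Store}
    (ha : Agree L s s') (hL : ∀ a ∈ L,
      a ∉ [vertexCountReg, edgeCountReg, reorientReg, rootedTailArr, rootedHeadArr, slackArr]) :
    AugState ends r s' ν D sl := by
  have heq : ∀ a ∈ [vertexCountReg, edgeCountReg, reorientReg, rootedTailArr, rootedHeadArr,
    slackArr], s' a = s a := fun a h => ha a fun h' => hL a h' h
  refine ⟨?_, ?_, ?_, ?_, ?_, h.orientation, h.rootConnected, h.degree⟩
  · rw [heq vertexCountReg (by simp), h.vertices]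
  · rw [heq edgeCountReg (by simp), h.edges]
  · rw [heq reorientReg (by simp), h.fixed]
  · rw [heq rootedTailArr (by simp), heq rootedHeadArr (by simp)]
    exact h.arcs
  · rw [heq slackArr (by simp)]
    exact h.slack

theorem HoldsWitness.of_agree (h : HoldsWitness ends r ν s) {L : List ℕ} {s' : Store}
    (ha : Agree L s s') (hL : ∀ a ∈ L,
      a ∉ [vertexCountReg, edgeCountReg, reorientReg, rootedTailArr, rootedHeadArr, slackArr]) :
    HoldsWitness ends r ν s' := by
  obtain ⟨D, sl, h⟩ := h
  exact ⟨D, sl, h.of_agree ha hL⟩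

theorem searchRooted_runs (hn : n ≤ N) (hm : m ≤ N) (h : AugState ends r s ν D sl) {e : Expr}
    (he : ∀ t, Agree [tailArr, headArr, arcReg] s t → e.eval t = ((src : ℕ) : ℤ)) :
    Runs N (searchRooted e) s fun s' =>
      Agree [tailArr, headArr, markArr, parentArr, startReg, roundReg, arcReg, tempReg] s s' ∧
        ∃ mk, SearchState D src 0 s' D mk ∧ ∀ v, 0 < mk v ↔ Reaches D src v := by
  refine .seq ((copyArcs_runs hm h.edges h.arcs (by simp)).mono fun s₁ ⟨ha₁, harcs⟩ =>
    .seq (.write ?_))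
  have ha₂ := (ha₁.mono (L' := [tailArr, headArr, startReg, arcReg]) (by simp)).set
    (a := startReg) (by simp) ((Expr.const 0).eval s₁) (e.eval s₁)
  refine (search_fixed_runs hn hm (by rw [ha₂ vertexCountReg (by simp), h.vertices])
    (by rw [ha₂ edgeCountReg (by simp), h.edges]) (by rw [ha₂ reorientReg (by simp), h.fixed])
    (by simpa using harcs) (by simpa [Expr.eval] using he s₁ ha₁)).mono fun s₃ ⟨ha₃, hsearch⟩ =>
      ⟨(ha₂.mono (by simp)).trans (ha₃.mono (by simp)), hsearch⟩

theorem testRooted_runs (hn : n ≤ N) (hm : m ≤ N) (hr : (r : ℕ) = 0)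
    (hcountV : s vertexCountReg 0 = n) (hcountE : s edgeCountReg 0 = m)
    (hfixed : s reorientReg 0 = 0) (harcs : HoldsArcs (s tailArr) (s headArr) D) :
    Runs N testRooted s fun s' =>
      Agree [tailArr, headArr, markArr, parentArr, startReg, roundReg, arcReg, allMarkedReg,
        tempReg] s s' ∧ HoldsArcs (s' tailArr) (s' headArr) D ∧
        (0 < s' allMarkedReg 0 ↔ RootConnected D r) := by
  refine .seq (.write (.seq ?_))
  have ha₁ := (Agree.refl [startReg] s).set (a := startReg) (by simp) ((Expr.const 0).eval s)
    ((Expr.const 0).eval s)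
  refine (search_fixed_runs (src := r) hn hm (by rw [ha₁ vertexCountReg (by simp), hcountV])
    (by rw [ha₁ edgeCountReg (by simp), hcountE]) (by rw [ha₁ reorientReg (by simp), hfixed])
    (by simpa using harcs) (by simp [Expr.eval, hr])).mono ?_
  rintro s₂ ⟨ha₂, mk, hst, hmk⟩
  refine (allMarked_runs hn (by simp [ha₂ vertexCountReg, hcountV]) hst.marks).mono
    fun s₃ ⟨ha₃, hall⟩ => ⟨((ha₁.mono (by simp)).trans (ha₂.mono (by simp))).trans
      (ha₃.mono (by simp)), ?_, hall.trans (forall_congr' hmk)⟩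
  rw [ha₃ tailArr (by simp), ha₃ headArr (by simp)]
  exact hst.arcs

theorem accept_runs (hm : m ≤ N) (h : AugState ends r s ν D sl) {D' : Fin m → Fin n × Fin n}
    (harcs : HoldsArcs (s tailArr) (s headArr) D') (hrev : ReversedPath ends D mk u v D')
    (hroot : RootConnected D' r) (hu : s loserReg 0 = ((u : ℕ) : ℤ)) (hsl : 0 < sl u) :
    Runs N accept s fun s' =>
      Agree [arcReg, rootedTailArr, rootedHeadArr, slackArr, foundReg] s s' ∧
        s' foundReg 0 = 1 ∧ HoldsWitness ends r (ν + Pi.single v 1) s' := by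
  refine .seq ((copyArcs_runs hm h.edges harcs (by simp)).mono fun s₁ ⟨ha, harcs'⟩ =>
    .seq (.write (.write ⟨((ha.mono (by simp)).set (by simp) _ _).set (by simp) _ _,
      by simp [Expr.eval], D', Function.update sl u (sl u - 1), ?_⟩)))
  refine ⟨?_, ?_, ?_, by simpa using harcs', ?_, hrev.orientation, hroot, fun x => ?_⟩
  · simp [ha vertexCountReg, h.vertices]
  · simp [ha edgeCountReg, h.edges]
  · simp [ha reorientReg, h.fixed]
  · have := h.slack.natCast_update u (sl u - 1)
    rw [Nat.cast_pred hsl] at this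
    simpa [Expr.eval, ha slackArr, ha loserReg, hu, h.slack u] using this
  · have hold := h.degree x
    have hnew := hrev.degree x
    rw [Pi.add_apply, Pi.single_apply]
    by_cases hx : x = u
    · subst hx
      rw [Function.update_self]
      rw [if_pos rfl] at hnew
      omega
    · rw [Function.update_of_ne hx]
      rw [if_neg hx] at hnew
      omega

theorem exchange_runs (hn : n ≤ N) (hm : m ≤ N) (h : AugState ends r s ν D sl)
    (hr : (r : ℕ) = 0) (hv : s wantReg 0 = ((v : ℕ) : ℤ)) (hu : s loserReg 0 = ((u : ℕ) : ℤ))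
    (hsl : 0 < sl u) (hfound : s foundReg 0 = 0) :
    Runs N exchange s fun s' =>
      Agree [tailArr, headArr, markArr, parentArr, startReg, roundReg, arcReg, rootedTailArr,
        rootedHeadArr, slackArr, foundReg, allMarkedReg, pathVertexReg, tempReg, pathArcReg] s s' ∧
      (s' foundReg 0 = 1 ∧ HoldsWitness ends r (ν + Pi.single v 1) s' ∨
        s' foundReg 0 = 0 ∧ AugState ends r s' ν D sl ∧ ∃ Y, Tight D r Y ∧ u ∈ Y ∧ v ∉ Y) := by
  refine .seq ((searchRooted_runs (src := v) hn hm h fun t ht => by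
    simp [Expr.eval, ht wantReg, hv]).mono fun s₁ ⟨ha₁, mk, hst, hreach⟩ => ?_)
  have hmarku : (Expr.read markArr (.cell loserReg)).eval s₁ = mk u := by
    simp only [Expr.eval, ha₁ loserReg (by simp), hu]
    exact hst.marks u
  refine .ite (fun hpos => ?_) (fun hpos => .skip ⟨ha₁.mono (by simp), Or.inr
    ⟨by rw [ha₁ foundReg (by simp), hfound], h.of_agree ha₁ (by simp),
      exists_tight_of_not_reaches h.rootConnected fun huv => hpos ?_⟩⟩)
  swap
  · rw [hmarku]
    exact_mod_cast (hreach u).2 huv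
  rw [hmarku] at hpos
  refine .seq (.write (.seq ((reversePath_runs (u := u) hn (hst.set (by simp) _ _) h.orientation
    (by simp [Expr.eval, ha₁ loserReg, hu]) (by exact_mod_cast hpos)).mono ?_)))
  rintro s₂ ⟨ha₂, D', harcs, hrev⟩
  replace ha₂ : Agree [tailArr, headArr, markArr, parentArr, startReg, roundReg, arcReg,
      pathVertexReg, tempReg, pathArcReg] s s₂ :=
    ((ha₁.mono (by simp)).set (by simp) _ _).trans (ha₂.mono (by simp))
  have h₂ := h.of_agree ha₂ (by simp)
  refine .seq ((testRooted_runs hn hm hr h₂.vertices h₂.edges h₂.fixed harcs).mono ?_)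
  rintro s₃ ⟨ha₃, harcs₃, hroot⟩
  have h₃ := h₂.of_agree ha₃ (by simp)
  replace ha₃ : Agree [tailArr, headArr, markArr, parentArr, startReg, roundReg, arcReg,
      allMarkedReg, pathVertexReg, tempReg, pathArcReg] s s₃ :=
    (ha₂.mono (by simp)).trans (ha₃.mono (by simp))
  refine .ite (fun hpos => ?_) (fun hpos => .skip ⟨ha₃.mono (by simp), Or.inr
    ⟨by rw [ha₃ foundReg (by simp), hfound], h₃, exists_tight_of_not_rootConnected
      h.orientation h.rootConnected hrev.orientation hrev.degree fun hc => hpos (hroot.2 hc)⟩⟩)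
  exact (accept_runs hm h₃ harcs₃ hrev (hroot.1 hpos) (by rw [ha₃ loserReg (by simp), hu])
    hsl).mono fun s₄ ⟨ha₄, hres⟩ => ⟨(ha₃.mono (by simp)).trans (ha₄.mono (by simp)), Or.inl hres⟩

/-- The arrays that are changed by augmentations. -/
abbrev scratch : List ℕ :=
  [tailArr, headArr, markArr, parentArr, startReg, roundReg, arcReg, rootedTailArr, rootedHeadArr,
    slackArr, loserReg, foundReg, allMarkedReg, pathVertexReg, tempReg, pathArcReg]

/-- The progress of an augmentation at `v`: either it has succeeded, or none of the vertices below
`k` that could spare an arc can pass it to `v`, each time because of a tight set. -/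
def AugProgress (ends : Fin m → Fin n × Fin n) (r : Fin n) (ν : Fin n → ℕ) (v : Fin n)
    (D : Fin m → Fin n × Fin n) (sl : Fin n → ℕ) (k : ℕ) (s : Store) : Prop :=
  s foundReg 0 = 1 ∧ HoldsWitness ends r (ν + Pi.single v 1) s ∨
    s foundReg 0 = 0 ∧ AugState ends r s ν D sl ∧
      ∀ u : Fin n, (u : ℕ) < k → 0 < sl u → ∃ Y, Tight D r Y ∧ u ∈ Y ∧ v ∉ Y

theorem AugProgress.set_loser {k : ℕ} (h : AugProgress ends r ν v D sl k s) (x : ℤ) :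
    AugProgress ends r ν v D sl k (s.set loserReg 0 x) := by
  have ha : Agree [loserReg] s (s.set loserReg 0 x) := (Agree.refl _ s).set (by simp) _ _
  rw [AugProgress, ha foundReg (by simp)]
  exact h.imp (And.imp_right fun h => h.of_agree ha (by simp))
    (And.imp_right fun h => ⟨h.1.of_agree ha (by simp), h.2⟩)

theorem tryExchange_runs (hn : n ≤ N) (hm : m ≤ N) (hr : (r : ℕ) = 0)
    (hv : s wantReg 0 = ((v : ℕ) : ℤ)) (hu : s loserReg 0 = ((u : ℕ) : ℤ))
    (h : AugProgress ends r ν v D sl u s) :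
    Runs N tryExchange s fun s' =>
      Agree [tailArr, headArr, markArr, parentArr, startReg, roundReg, arcReg, rootedTailArr,
        rootedHeadArr, slackArr, foundReg, allMarkedReg, pathVertexReg, tempReg, pathArcReg] s s' ∧
      AugProgress ends r ν v D sl (u + 1) s' := by
  rcases h with h | ⟨hfound, hst, hprog⟩
  · exact .ite (fun hpos => by simp [Expr.eval, h.1] at hpos)
      (fun _ => .skip ⟨Agree.refl _ s, Or.inl h⟩)
  have hsucc (hY : 0 < sl u → ∃ Y, Tight D r Y ∧ u ∈ Y ∧ v ∉ Y) (w : Fin n) (hw : (w : ℕ) < u + 1)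
      (hw0 : 0 < sl w) : ∃ Y, Tight D r Y ∧ w ∈ Y ∧ v ∉ Y := by
    rcases Nat.lt_succ_iff_lt_or_eq.1 hw with hwu | hwu
    · exact hprog w hwu hw0
    · obtain rfl := Fin.ext hwu
      exact hY hw0
  have hslack : (Expr.read slackArr (.cell loserReg)).eval s = sl u := by
    simp only [Expr.eval, hu]
    exact hst.slack u
  refine .ite (fun _ => .ite (fun hpos => ?_) (fun hpos => .skip ⟨Agree.refl _ s, Or.inr
    ⟨hfound, hst, hsucc fun h0 => ?_⟩⟩)) (fun hneg => by simp [Expr.eval, hfound] at hneg) <;>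
    rw [hslack] at hpos
  · exact (exchange_runs hn hm hst hr hv hu (by exact_mod_cast hpos) hfound).mono
      fun s' ⟨ha, hres⟩ => ⟨ha, hres.imp_right fun ⟨hfound, hst, hY⟩ =>
        ⟨hfound, hst, hsucc fun _ => hY⟩⟩
  · exact absurd (by exact_mod_cast h0) hpos

theorem AugState.not_orientable_add_single (h : AugState ends r s ν D sl)
    (hY : ∀ u, 0 < sl u → ∃ Y, Tight D r Y ∧ u ∈ Y ∧ v ∉ Y) :
    ¬ Orientable ends r (ν + Pi.single v 1) := fun hν => by
  obtain ⟨Z, hZ, hmax⟩ := exists_saturated_superset h.orientation h.rootConnected {v} (μ := ν)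
    fun w hw u hu => by
      obtain rfl := Finset.mem_singleton.1 hw
      refine hY u ?_
      have := h.degree u
      omega
  simpa [Finset.sum_add_distrib, Pi.single_apply, hZ (Finset.mem_singleton_self v)] using hmax _ hν

theorem augment_runs (hn : n ≤ N) (hm : m ≤ N) (h : HoldsWitness ends r ν s)
    (hr : (r : ℕ) = 0) (hv : s wantReg 0 = ((v : ℕ) : ℤ)) :
    Runs N augment s fun s' => Agree scratch s s' ∧
      (s' foundReg 0 = 1 ∧ HoldsWitness ends r (ν + Pi.single v 1) s' ∨
        s' foundReg 0 = 0 ∧ HoldsWitness ends r ν s' ∧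
          ¬ Orientable ends r (ν + Pi.single v 1)) := by
  obtain ⟨D, sl, h⟩ := h
  refine .seq (.write (.for (fun k s' => Agree scratch s s' ∧ AugProgress ends r ν v D sl k s')
    hn ?_ ?_ ?_ ?_))
  · rintro k s' ⟨ha, -⟩
    simp [Expr.eval, ha vertexCountReg (by simp), h.vertices]
  · have ha : Agree [foundReg] s (s.set foundReg 0 0) := (Agree.refl _ s).set (by simp) _ _
    have hprog : AugProgress ends r ν v D sl 0 (s.set foundReg 0 0) :=
      Or.inr ⟨by simp, h.of_agree ha (by simp), by simp⟩
    exact ⟨(ha.mono (by simp)).set (by simp) _ _, hprog.set_loser _⟩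
  · rintro k hk s' ⟨ha, hprog⟩ hs'
    refine (tryExchange_runs (u := ⟨k, hk⟩) hn hm hr (by rw [ha wantReg (by simp), hv]) hs'
      hprog).mono fun t ⟨ha', hprog'⟩ => ⟨by rw [ha' loserReg (by simp), hs'], ?_,
        hprog'.set_loser _⟩
    exact (ha.trans (ha'.mono (by simp))).set (by simp) _ _
  · rintro s' ⟨ha, hprog⟩
    exact ⟨ha, hprog.imp_right fun ⟨hfound, hst, hY⟩ =>
      ⟨hfound, ⟨D, sl, hst⟩, hst.not_orientable_add_single fun u => hY u u.2⟩⟩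

end Augment

/-! ## Input and output -/

/-- The address of the tail (`c = 2`) or the head (`c = 3`) of the arc `arcReg` in the input and the
output. -/
abbrev arcAddr (c : ℤ) : Expr := .add (.const c) (.add (.cell arcReg) (.cell arcReg))

/-- The address of entry `e` of the vector that follows the graph in the input and the output. -/
abbrev vectorAddr (e : Expr) : Expr :=
  .add (.add (.const 2) (.add (.cell edgeCountReg) (.cell edgeCountReg))) e

/-- Read the graph. -/
def readGraph : Program :=
  .write vertexCountReg (.const 0) (.cell inputArr) ;;
    .write edgeCountReg (.const 0) (.read inputArr (.const 1)) ;;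
    fillArray tailArr (.cell edgeCountReg) (.cell arcReg) (.read inputArr (arcAddr 2)) ;;
    fillArray headArr (.cell edgeCountReg) (.cell arcReg) (.read inputArr (arcAddr 3))

/-- Read the vector that follows the graph. -/
def readVector : Program :=
  fillArray vectorArr (.cell vertexCountReg) (.cell arcReg)
    (.read inputArr (vectorAddr (.cell arcReg)))

/-- Output the graph and the vector in `labelArr`. -/
def writeInstance : Program :=
  .write outputArr (.const 0) (.cell copiesReg) ;;
    .write outputArr (.const 1) (.cell edgeCountReg) ;;
    fillArray outputArr (.cell edgeCountReg) (arcAddr 2) (.read tailArr (.cell arcReg)) ;;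
    fillArray outputArr (.cell edgeCountReg) (arcAddr 3) (.read headArr (.cell arcReg)) ;;
    fillArray outputArr (.cell copiesReg) (vectorAddr (.cell arcReg))
      (.read labelArr (.cell arcReg))

section Lists

theorem getElem?_flatMap_pair {γ : Type*} (f g : γ → ℤ) (l : List γ) (j : ℕ) :
    (l.flatMap fun e => [f e, g e])[2 * j]? = l[j]?.map f ∧
      (l.flatMap fun e => [f e, g e])[2 * j + 1]? = l[j]?.map g := by
  induction l generalizing j with
  | nil => simp
  | cons a l ih =>
    cases j with
    | zero => simp
    | succ j => simpa [Nat.mul_succ] using ih j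

variable {I : EdgeList} {w : Fin I.n → ℤ} {a : ℤ → ℤ}

theorem EdgeList.length_encode (I : EdgeList) : I.encode.length = 2 + 2 * I.m := by
  simp [EdgeList.encode, List.length_flatMap, Function.comp_def, List.ofFn_const]
  omega

theorem EdgeList.getElem?_encode_append (l : List ℤ) (j : Fin I.m) :
    (I.encode ++ l)[2 + 2 * (j : ℕ)]? = some (((I.ends j).1 : ℕ) : ℤ) ∧
      (I.encode ++ l)[3 + 2 * (j : ℕ)]? = some (((I.ends j).2 : ℕ) : ℤ) := by
  have h := getElem?_flatMap_pair (fun e : Fin I.n × Fin I.n => ((e.1 : ℕ) : ℤ))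
    (fun e => ((e.2 : ℕ) : ℤ)) (List.ofFn I.ends) j
  rw [List.getElem?_append_left (by rw [I.length_encode]; omega),
    List.getElem?_append_left (by rw [I.length_encode]; omega),
    show 2 + 2 * (j : ℕ) = 2 * j + 1 + 1 by ring, show 3 + 2 * (j : ℕ) = 2 * j + 1 + 1 + 1 by ring]
  simpa [EdgeList.encode] using h

theorem EdgeList.getElem?_encode_append_ofFn (i : Fin I.n) :
    (I.encode ++ List.ofFn w)[2 + 2 * I.m + i]? = some (w i) := by
  rw [List.getElem?_append_right (by rw [I.length_encode]; omega), I.length_encode,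
    Nat.add_sub_cancel_left]
  simp

/-- The array `a` starts with the encoding of the graph `I`, followed by the entries of `w`. -/
structure HoldsInstance (a : ℤ → ℤ) (I : EdgeList) (w : Fin I.n → ℤ) : Prop where
  vertices : a 0 = I.n
  edges : a 1 = I.m
  tail : ∀ j : Fin I.m, a (2 + 2 * ((j : ℕ) : ℤ)) = (((I.ends j).1 : ℕ) : ℤ)
  head : ∀ j : Fin I.m, a (3 + 2 * ((j : ℕ) : ℤ)) = (((I.ends j).2 : ℕ) : ℤ)
  vector : ∀ i : Fin I.n, a (2 + 2 * (I.m : ℤ) + ((i : ℕ) : ℤ)) = w i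

theorem holdsInstance_iff : HoldsInstance a I w ↔
    ∀ (k : ℕ) (x : ℤ), (I.encode ++ List.ofFn w)[k]? = some x → a k = x := by
  constructor
  · intro h k x hx
    have hk : k < 2 + 2 * I.m + I.n := by
      have := (List.getElem?_eq_some_iff.1 hx).1
      rwa [List.length_append, I.length_encode, List.length_ofFn] at this
    obtain rfl | rfl | ⟨j, hj, rfl⟩ | ⟨j, hj, rfl⟩ | ⟨i, hi, rfl⟩ : k = 0 ∨ k = 1 ∨
        (∃ j < I.m, k = 2 + 2 * j) ∨ (∃ j < I.m, k = 3 + 2 * j) ∨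
          ∃ i < I.n, k = 2 + 2 * I.m + i := by
      obtain h0 | h0 | h2 | h2 : k = 0 ∨ k = 1 ∨ (2 ≤ k ∧ k < 2 + 2 * I.m) ∨ 2 + 2 * I.m ≤ k := by
        omega
      · exact .inl h0
      · exact .inr (.inl h0)
      · obtain h | h : k = 2 + 2 * ((k - 2) / 2) ∨ k = 3 + 2 * ((k - 2) / 2) := by omega
        · exact .inr (.inr (.inl ⟨_, by omega, h⟩))
        · exact .inr (.inr (.inr (.inl ⟨_, by omega, h⟩)))
      · exact .inr (.inr (.inr (.inr ⟨k - (2 + 2 * I.m), by omega, by omega⟩)))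
    · obtain rfl := Option.some.inj hx
      exact h.vertices
    · obtain rfl := Option.some.inj hx
      exact h.edges
    · rw [(EdgeList.getElem?_encode_append _ ⟨j, hj⟩).1, Option.some_inj] at hx
      rw [← hx, ← h.tail ⟨j, hj⟩]
      push_cast
      rfl
    · rw [(EdgeList.getElem?_encode_append _ ⟨j, hj⟩).2, Option.some_inj] at hx
      rw [← hx, ← h.head ⟨j, hj⟩]
      push_cast
      rfl
    · rw [EdgeList.getElem?_encode_append_ofFn ⟨i, hi⟩, Option.some_inj] at hx
      rw [← hx, ← h.vector ⟨i, hi⟩]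
      push_cast
      rfl
  · intro h
    exact ⟨h 0 _ rfl, h 1 _ rfl,
      fun j => by exact_mod_cast h _ _ (EdgeList.getElem?_encode_append _ j).1,
      fun j => by exact_mod_cast h _ _ (EdgeList.getElem?_encode_append _ j).2,
      fun i => by exact_mod_cast h _ _ (EdgeList.getElem?_encode_append_ofFn i)⟩

theorem holdsInstance_inputStore (I : EdgeList) (w : Fin I.n → ℤ) :
    HoldsInstance (inputStore (I.encode ++ List.ofFn w) inputArr) I w :=
  holdsInstance_iff.2 fun k x hx => by simp [inputStore, hx]

theorem HoldsInstance.hasOutput {s : Store} (h : HoldsInstance (s outputArr) I w) :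
    HasOutput s (I.encode ++ List.ofFn w) := fun k =>
  holdsInstance_iff.1 h k _ (by simp)

theorem two_mul_length_le_bitLength (l : List ℤ) : 2 * l.length ≤ bitLength l := by
  rw [bitLength, ← List.length_map (f := fun x : ℤ => x.natAbs.size + 2), mul_comm, ← smul_eq_mul]
  exact List.card_nsmul_le_sum _ _ (by simp)

theorem EdgeList.add_le_bitLength (I : EdgeList) (w : Fin I.n → ℤ) :
    I.n + I.m + 2 ≤ bitLength (I.encode ++ List.ofFn w) := by
  have := two_mul_length_le_bitLength (I.encode ++ List.ofFn w)
  rw [List.length_append, I.length_encode, List.length_ofFn] at this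
  omega

variable {N : ℕ} {s : Store}

theorem readGraph_runs (hm : I.m ≤ N) (h : HoldsInstance (s inputArr) I w) :
    Runs N readGraph s fun s' =>
      Agree [vertexCountReg, edgeCountReg, tailArr, headArr, arcReg] s s' ∧
        s' vertexCountReg 0 = I.n ∧ s' edgeCountReg 0 = I.m ∧
          HoldsArcs (s' tailArr) (s' headArr) I.ends := by
  refine .seq (.write (.seq (.write ?_)))
  obtain ⟨s₂, hs₂, ha₂, hvertices, hedges⟩ : ∃ s₂, s₂ = (s.set vertexCountReg 0 I.n).set
      edgeCountReg 0 I.m ∧ Agree [vertexCountReg, edgeCountReg] s s₂ ∧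
        s₂ vertexCountReg 0 = I.n ∧ s₂ edgeCountReg 0 = I.m :=
    ⟨_, rfl, ((Agree.refl _ s).set (by simp) _ _).set (by simp) _ _, by simp, by simp⟩
  simp only [Expr.eval, h.vertices, Store.set_ne _ _ _ (show inputArr ≠ vertexCountReg by simp),
    h.edges, ← hs₂]
  refine .seq ((fillArray_runs (K := I.m) (f := fun j => (((I.ends j).1 : ℕ) : ℤ)) hm (by simp)
    (fun t ha => by simp [Expr.eval, ha edgeCountReg, hedges])
    (natCast_val_injective _) fun t ha j hj => ⟨by exact hj, ?_⟩).mono fun s₃ ⟨ha₃, htail⟩ => ?_)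
  · simp [Expr.eval, hj, ha inputArr, ha₂ inputArr, ← two_mul, h.tail j]
  refine (fillArray_runs (K := I.m) (f := fun j => (((I.ends j).2 : ℕ) : ℤ)) hm (by simp)
    (fun t ha => by simp [Expr.eval, ha edgeCountReg, ha₃ edgeCountReg, hedges])
    (natCast_val_injective _) fun t ha j hj => ⟨by exact hj, ?_⟩).mono fun s₄ ⟨ha₄, hhead⟩ => ?_
  · simp [Expr.eval, hj, ha inputArr, ha₃ inputArr, ha₂ inputArr, ← two_mul, h.head j]
  refine ⟨((ha₂.mono (by simp)).trans (ha₃.mono (by simp))).trans (ha₄.mono (by simp)), ?_, ?_,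
    ?_, hhead⟩
  · rw [ha₄ vertexCountReg (by simp), ha₃ vertexCountReg (by simp), hvertices]
  · rw [ha₄ edgeCountReg (by simp), ha₃ edgeCountReg (by simp), hedges]
  · rw [ha₄ tailArr (by simp)]
    exact htail

theorem readVector_runs (hn : I.n ≤ N) (hcountV : s vertexCountReg 0 = I.n)
    (hcountE : s edgeCountReg 0 = I.m) (h : HoldsInstance (s inputArr) I w) :
    Runs N readVector s fun s' => Agree [vectorArr, arcReg] s s' ∧ Holds (s' vectorArr) w :=
  fillArray_runs hn (by simp) (fun t ha => by simp [Expr.eval, ha vertexCountReg, hcountV])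
    (natCast_val_injective _) fun t ha j hj => ⟨hj, by
      simp [Expr.eval, hj, ha inputArr, ha edgeCountReg, hcountE, ← two_mul, h.vector j]⟩

theorem writeInstance_runs (hn : I.n ≤ N) (hm : I.m ≤ N) (hcountV : s copiesReg 0 = I.n)
    (hcountE : s edgeCountReg 0 = I.m) (harcs : HoldsArcs (s tailArr) (s headArr) I.ends)
    (hlabel : Holds (s labelArr) w) :
    Runs N writeInstance s fun s' => HoldsInstance (s' outputArr) I w := by
  refine .seq (.write (.seq (.write ?_)))
  obtain ⟨s₂, hs₂, ha₂, hvertices, hedges⟩ : ∃ s₂, s₂ = (s.set outputArr 0 I.n).set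
      outputArr 1 I.m ∧ Agree [outputArr] s s₂ ∧ s₂ outputArr 0 = I.n ∧ s₂ outputArr 1 = I.m :=
    ⟨_, rfl, ((Agree.refl _ s).set (by simp) _ _).set (by simp) _ _, by simp, by simp⟩
  simp only [Expr.eval, hcountV, Store.set_ne _ _ _ (show edgeCountReg ≠ outputArr by simp),
    hcountE, ← hs₂]
  refine .seq ((fillArray_frame_runs (K := I.m) (p := fun j => 2 + 2 * ((j : ℕ) : ℤ))
    (f := fun j => (((I.ends j).1 : ℕ) : ℤ)) hm (by simp)
    (fun t ha => by simp [Expr.eval, ha edgeCountReg, ha₂ edgeCountReg, hcountE])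
    (fun i j hij => Fin.ext (by dsimp only at hij; omega))
    fun t ha j hj => ⟨by simp [Expr.eval, hj, two_mul], by
      simp [Expr.eval, hj, ha tailArr, ha₂ tailArr, harcs.1 j]⟩).mono
    fun s₃ ⟨ha₃, htail, hframe₃⟩ => .seq ?_)
  refine (fillArray_frame_runs (K := I.m) (p := fun j => 3 + 2 * ((j : ℕ) : ℤ))
    (f := fun j => (((I.ends j).2 : ℕ) : ℤ)) hm (by simp)
    (fun t ha => by simp [Expr.eval, ha edgeCountReg, ha₃ edgeCountReg, ha₂ edgeCountReg, hcountE])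
    (fun i j hij => Fin.ext (by dsimp only at hij; omega))
    fun t ha j hj => ⟨by simp [Expr.eval, hj, two_mul], by
      simp [Expr.eval, hj, ha headArr, ha₃ headArr, ha₂ headArr, harcs.2 j]⟩).mono
    fun s₄ ⟨ha₄, hhead, hframe₄⟩ => ?_
  refine (fillArray_frame_runs (K := I.n) (p := fun i => 2 + 2 * (I.m : ℤ) + ((i : ℕ) : ℤ))
    (f := w) hn (by simp)
    (fun t ha => by
      simp [Expr.eval, ha copiesReg, ha₄ copiesReg, ha₃ copiesReg, ha₂ copiesReg, hcountV])
    (fun i j hij => Fin.ext (by dsimp only at hij; omega))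
    fun t ha i hi => ⟨by
      simp [Expr.eval, hi, two_mul, ha edgeCountReg, ha₄ edgeCountReg, ha₃ edgeCountReg,
        ha₂ edgeCountReg, hcountE], by
      simp [Expr.eval, hi, ha labelArr, ha₄ labelArr, ha₃ labelArr, ha₂ labelArr, hlabel i]⟩).mono
    fun s₅ ⟨_, hvector, hframe₅⟩ => ⟨?_, ?_, fun j => ?_, fun j => ?_, hvector⟩
  · rw [hframe₅ _ (by omega), hframe₄ _ (by omega), hframe₃ _ (by omega), hvertices]
  · rw [hframe₅ _ (by omega), hframe₄ _ (by omega), hframe₃ _ (by omega), hedges]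
  · rw [hframe₅ _ (by omega), hframe₄ _ (by omega), htail j]
  · rw [hframe₅ _ (by omega), hhead j]

end Lists

/-! ## Initialization -/

/-- Find a root-connected orientation, by a search that reverses the arcs it follows backwards. -/
def orientGraph : Program :=
  .write reorientReg (.const 0) (.const 1) ;; .write startReg (.const 0) (.const 0) ;; search ;;
    .write reorientReg (.const 0) (.const 0)

/-- Add the indegrees of the vertices to `slackArr`. -/
def countHeads : Program :=
  .for arcReg (.cell edgeCountReg)
    (.write slackArr (.read headArr (.cell arcReg))
      (.add (.read slackArr (.read headArr (.cell arcReg))) (.const 1)))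

/-- Compute the numbers of arcs that the vertices could spare. -/
def initSlack : Program :=
  fillArray slackArr (.cell vertexCountReg) (.cell arcReg) (.const (-1)) ;;
    .write slackArr (.const 0) (.const 0) ;; countHeads

/-- Read the graph and find a root-connected orientation. -/
def prepare : Program :=
  readGraph ;; orientGraph ;; initSlack ;; copyArcs tailArr headArr rootedTailArr rootedHeadArr

section Initialize

variable {n m N : ℕ} {s : Store} {r : Fin n} {D : Fin m → Fin n × Fin n}

theorem EdgeList.forall_of_connected {I : EdgeList} (h : Connected I.toGraph) {P : Fin I.n → Prop}
    {r : Fin I.n} (hr : P r) (hP : ∀ e, P (I.ends e).1 ↔ P (I.ends e).2) (v : Fin I.n) : P v := by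
  have hreach := (SimpleGraph.reachable_iff_reflTransGen _ _).1
    (h.preconnected (I.vert r) (I.vert v))
  suffices key : ∀ y : V(I.toGraph),
      Relation.ReflTransGen I.toGraph.toSimpleGraph.Adj (I.vert r) y → P y.1 from key _ hreach
  intro y hy
  induction hy with
  | refl => exact hr
  | tail _ hadj ih =>
    obtain ⟨-, e, he⟩ := hadj
    have hPe := hP e
    rcases he with he | he <;> rw [he] at hPe
    exacts [hPe.1 ih, hPe.2 ih]

theorem orientGraph_runs {I : EdgeList} (hconn : Connected I.toGraph) {r : Fin I.n}
    (hr : (r : ℕ) = 0) (hn : I.n ≤ N) (hm : I.m ≤ N) (hcountV : s vertexCountReg 0 = I.n)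
    (hcountE : s edgeCountReg 0 = I.m) (harcs : HoldsArcs (s tailArr) (s headArr) I.ends) :
    Runs N orientGraph s fun s' =>
      Agree [tailArr, headArr, markArr, parentArr, startReg, reorientReg, roundReg, arcReg, tempReg]
        s s' ∧ s' reorientReg 0 = 0 ∧ ∃ D, HoldsArcs (s' tailArr) (s' headArr) D ∧
          IsOrientation I.ends D ∧ RootConnected D r := by
  refine .seq (.write (.seq (.write (.seq ((search_runs (D₀ := I.ends) (src := r) hn hm
    (by simpa using hcountV) (by simpa using hcountE) (by simpa using harcs)
    (by simp [Expr.eval, hr])).mono fun t ⟨ha, D, mk, hst, hclosed⟩ => .write ?_)))))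
  simp only [Store.set_apply, if_true, Expr.eval] at hst hclosed
  have hmarked : ∀ v, 0 < mk v := by
    refine I.forall_of_connected hconn (r := r) (by rw [hst.tree.root]; exact Nat.one_pos)
      fun e => ?_
    have hc := hclosed e
    rcases hst.orientation e with h | h <;> rw [ClosedAt, h] at hc
    exacts [⟨hc.1, hc.2 one_pos⟩, ⟨hc.2 one_pos, hc.1⟩]
  refine ⟨?_, by simp [Expr.eval], D, by simpa using hst.arcs, hst.orientation,
    fun v => hst.tree.reaches (hmarked v)⟩
  exact ((((Agree.refl _ s).set (by simp) _ _).set (by simp) _ _).trans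
    (ha.mono (by simp))).set (by simp) _ _

theorem card_filter_lt_succ {k : ℕ} (hk : k < m) (p : Fin m → Prop) [DecidablePred p] :
    Finset.card {e : Fin m | (e : ℕ) < k + 1 ∧ p e} =
      Finset.card {e : Fin m | (e : ℕ) < k ∧ p e} + if p ⟨k, hk⟩ then 1 else 0 := by
  have hsplit (e : Fin m) : (if (e : ℕ) < k + 1 ∧ p e then 1 else 0) =
      (if (e : ℕ) < k ∧ p e then 1 else 0) +
        if ⟨k, hk⟩ = e then (if p ⟨k, hk⟩ then 1 else 0) else 0 := by
    obtain hek | rfl | hek : (e : ℕ) < k ∨ ⟨k, hk⟩ = e ∨ k < (e : ℕ) := by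
      simpa [Fin.ext_iff, eq_comm] using lt_trichotomy (e : ℕ) k
    · simp [hek, hek.trans k.lt_succ_self, Fin.ext_iff, hek.ne']
    · simp
    · simp [hek.not_gt, Fin.ext_iff, hek.ne, Nat.not_lt.2 hek]
  simp_rw [Finset.card_filter, hsplit, Finset.sum_add_distrib, Finset.sum_ite_eq,
    Finset.mem_univ, if_true]

theorem countHeads_runs (hm : m ≤ N) (hcount : s edgeCountReg 0 = m)
    (hhead : Holds (s headArr) fun e => (((D e).2 : ℕ) : ℤ)) {f : Fin n → ℤ}
    (hf : Holds (s slackArr) f) :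
    Runs N countHeads s fun s' => Agree [slackArr, arcReg] s s' ∧
      Holds (s' slackArr) fun v => f v + indeg D v := by
  refine .for (fun k s' => Agree [slackArr, arcReg] s s' ∧ Holds (s' slackArr) fun v =>
    f v + Finset.card {e : Fin m | (e : ℕ) < k ∧ (D e).2 = v}) hm ?_ ?_ ?_ ?_
  · rintro k t ⟨ha, -⟩
    simp [Expr.eval, ha edgeCountReg, hcount]
  · exact ⟨(Agree.refl _ s).set (by simp) _ _, by simpa using hf⟩
  · rintro k hk t ⟨ha, hslack⟩ ht
    have hD : t headArr k = (((D ⟨k, hk⟩).2 : ℕ) : ℤ) := by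
      rw [ha headArr (by simp)]
      exact hhead ⟨k, hk⟩
    refine .write ⟨by simpa using ht, (ha.set (by simp) _ _).set (by simp) _ _, ?_⟩
    convert hslack.update (D ⟨k, hk⟩).2 (t slackArr (((D ⟨k, hk⟩).2 : ℕ) : ℤ) + 1) using 1
    · simp [Expr.eval, ht, hD]
    · funext v
      rw [card_filter_lt_succ hk]
      by_cases hv : v = (D ⟨k, hk⟩).2
      · subst hv
        rw [Function.update_self, hslack, if_pos rfl]
        push_cast
        ring
      · rw [Function.update_of_ne hv, if_neg (Ne.symm hv), add_zero]
  · rintro t ⟨ha, hslack⟩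
    simpa [indeg] using And.intro ha hslack

theorem initSlack_runs (hn : n ≤ N) (hm : m ≤ N) (hcountV : s vertexCountReg 0 = n)
    (hcountE : s edgeCountReg 0 = m) (hr : (r : ℕ) = 0)
    (hhead : Holds (s headArr) fun e => (((D e).2 : ℕ) : ℤ)) :
    Runs N initSlack s fun s' => Agree [slackArr, arcReg] s s' ∧
      Holds (s' slackArr) fun v => Function.update (-1 : Fin n → ℤ) r 0 v + indeg D v := by
  refine .seq ((fillArray_runs (f := (-1 : Fin n → ℤ)) hn (by simp)
    (fun t ha => by simp [Expr.eval, ha vertexCountReg, hcountV]) (natCast_val_injective n)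
    fun _ _ _ hj => ⟨by exact hj, rfl⟩).mono fun t ⟨ha, hslack⟩ => .seq (.write ?_))
  refine (countHeads_runs hm (by simp [ha edgeCountReg, hcountE])
    (by simpa [ha headArr] using hhead) (f := Function.update (-1 : Fin n → ℤ) r 0) ?_).mono
      fun t' ⟨ha', hslack'⟩ => ⟨(ha.set (by simp) _ _).trans ha', hslack'⟩
  have hroot := Holds.update (f := (-1 : Fin n → ℤ)) hslack r 0
  simpa [Expr.eval, hr] using hroot

/-- The arrays that are changed by the initialization. -/
abbrev initScratch : List ℕ :=
  [vertexCountReg, edgeCountReg, tailArr, headArr, markArr, parentArr, startReg, reorientReg,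
    roundReg, arcReg, rootedTailArr, rootedHeadArr, slackArr, tempReg]

theorem prepare_runs {I : EdgeList} {w : Fin I.n → ℤ} (hconn : Connected I.toGraph) {r : Fin I.n}
    (hr : (r : ℕ) = 0) (hn : I.n ≤ N) (hm : I.m ≤ N) (h : HoldsInstance (s inputArr) I w) :
    Runs N prepare s fun s' => Agree initScratch s s' ∧ HoldsWitness I.ends r 0 s' := by
  refine .seq ((readGraph_runs hm h).mono fun s₁ ⟨ha₁, hcountV, hcountE, harcs⟩ => .seq ?_)
  refine (orientGraph_runs hconn hr hn hm hcountV hcountE harcs).mono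
    fun s₂ ⟨ha₂, hfixed, D, harcs₂, hD, hroot⟩ => .seq ?_
  rw [← ha₂ vertexCountReg (by simp)] at hcountV
  rw [← ha₂ edgeCountReg (by simp)] at hcountE
  refine (initSlack_runs hn hm hcountV hcountE hr harcs₂.2).mono fun s₃ ⟨ha₃, hslack⟩ => ?_
  refine (copyArcs_runs (D := D) hm (by rw [ha₃ edgeCountReg (by simp), hcountE])
    (by rwa [ha₃ tailArr (by simp), ha₃ headArr (by simp)]) (by simp)).mono
      fun s₄ ⟨ha₄, hcopy⟩ => ⟨?_, D, fun v => indeg D v - if v = r then 0 else 1, ?_⟩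
  · exact (((ha₁.mono (by simp)).trans (ha₂.mono (by simp))).trans (ha₃.mono (by simp))).trans
      (ha₄.mono (by simp))
  have hpos : ∀ v, (if v = r then 0 else 1) ≤ indeg D v := fun v => by
    split_ifs with hv
    exacts [Nat.zero_le _, hroot.indeg_pos hv]
  refine ⟨by simp [ha₄ vertexCountReg, ha₃ vertexCountReg, hcountV],
    by simp [ha₄ edgeCountReg, ha₃ edgeCountReg, hcountE],
    by simp [ha₄ reorientReg, ha₃ reorientReg, hfixed], hcopy, fun v => ?_, hD, hroot, fun v => ?_⟩
  · rw [ha₄ slackArr (by simp), hslack v]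
    dsimp only
    rw [Nat.cast_sub (hpos v), Function.update_apply]
    split_ifs <;> simp [neg_add_eq_sub]
  · rw [Pi.zero_apply, zero_add, Nat.add_sub_cancel' (hpos v)]

end Initialize

/-! ## The greedy algorithm -/

/-- Try to increase the entry of the vertex `wantReg` in the output vector. -/
def increase : Program :=
  augment ;;
    .ite (.cell foundReg)
      (.write outputArr (.cell wantReg) (.add (.read outputArr (.cell wantReg)) (.const 1))) .skip

/-- Increase the entry of the vertex `wantReg` in the output vector as often as possible. -/
def saturate : Program :=
  .write foundReg (.const 0) (.const 1) ;; .loop (.cell foundReg) increase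

/-- Find a vertex whose entry in `vectorArr` is maximal and positive. -/
def selectMax : Program :=
  .write selectedReg (.const 0) (.const (-1)) ;; .write selectedWeightReg (.const 0) (.const 0) ;;
    .for arcReg (.cell vertexCountReg)
      (.ite (.sub (.read vectorArr (.cell arcReg)) (.cell selectedWeightReg))
        (.write selectedReg (.const 0) (.cell arcReg) ;;
          .write selectedWeightReg (.const 0) (.read vectorArr (.cell arcReg))) .skip)

/-- Handle the vertex `selectedReg`: erase its weight and saturate it. -/
def process : Program :=
  .write vectorArr (.cell selectedReg) (.const 0) ;;
    .write wantReg (.const 0) (.cell selectedReg) ;; saturate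

/-- Handle an unprocessed vertex of maximal positive weight, if there is one. -/
def processMax : Program :=
  selectMax ;; .ite (.add (.cell selectedReg) (.const 1)) process .skip

/-- Maximize a linear function over the feasible split vectors. -/
def optimize : Program :=
  prepare ;; readVector ;; .for stepReg (.cell vertexCountReg) processMax

section Optimize

variable {n m N : ℕ} {s s' : Store} {ends : Fin m → Fin n × Fin n} {r v : Fin n} {ν : Fin n → ℕ}

/-- The store holds `ν` as the output and an orientation that shows that `ν` is orientable. -/
structure HoldsVector (ends : Fin m → Fin n × Fin n) (r : Fin n) (ν : Fin n → ℕ) (s : Store) :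
    Prop where
  witness : HoldsWitness ends r ν s
  output : Holds (s outputArr) fun v => (ν v : ℤ)

theorem HoldsVector.of_agree (h : HoldsVector ends r ν s) {L : List ℕ} (ha : Agree L s s')
    (hL : ∀ a ∈ L, a ∉ [outputArr, vertexCountReg, edgeCountReg, reorientReg, rootedTailArr,
      rootedHeadArr, slackArr]) : HoldsVector ends r ν s' where
  witness := h.witness.of_agree ha fun a haL h' => hL a haL (List.mem_cons_of_mem _ h')
  output := by
    rw [ha outputArr fun h' => hL _ h' (by simp)]
    exact h.output

theorem increase_runs (hn : n ≤ N) (hm : m ≤ N) (h : HoldsVector ends r ν s) (hr : (r : ℕ) = 0)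
    (hv : s wantReg 0 = ((v : ℕ) : ℤ)) :
    Runs N increase s fun s' => Agree (outputArr :: scratch) s s' ∧
      (s' foundReg 0 = 1 ∧ HoldsVector ends r (ν + Pi.single v 1) s' ∨
        s' foundReg 0 = 0 ∧ HoldsVector ends r ν s' ∧
          ¬ Orientable ends r (ν + Pi.single v 1)) := by
  refine .seq ((augment_runs hn hm h.witness hr hv).mono fun t ⟨ha, hres⟩ => ?_)
  have hout : Holds (t outputArr) fun v => (ν v : ℤ) := by
    rw [ha outputArr (by simp)]
    exact h.output
  have ha' : Agree (outputArr :: scratch) s t := ha.mono (by simp)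
  rcases hres with ⟨hfound, hwit⟩ | ⟨hfound, hwit, hnot⟩
  · refine .ite (fun _ => .write ⟨ha'.set (by simp) _ _, .inl ⟨by simpa using hfound,
      hwit.of_agree ((Agree.refl [outputArr] t).set (by simp) _ _) (by simp), ?_⟩⟩)
      fun h => absurd h (by simp [Expr.eval, hfound])
    have hv' : t wantReg 0 = ((v : ℕ) : ℤ) := by rw [ha wantReg (by simp), hv]
    convert hout.natCast_update v (ν v + 1) using 1
    · simp [Expr.eval, hv', hout v]
    · funext u
      by_cases hu : u = v
      · simp [hu]
      · simp [hu]
  · exact .ite (fun h => absurd h (by simp [Expr.eval, hfound])) fun _ =>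
      .skip ⟨ha', .inr ⟨hfound, ⟨hwit, hout⟩, hnot⟩⟩

theorem saturate_runs (hn : n ≤ N) (hm : m + 1 ≤ N) (h : HoldsVector ends r ν s)
    (hr : (r : ℕ) = 0) (hv : s wantReg 0 = ((v : ℕ) : ℤ)) :
    Runs N saturate s fun s' => Agree (outputArr :: scratch) s s' ∧ ∃ j,
      HoldsVector ends r (ν + Pi.single v j) s' ∧
        ¬ Orientable ends r (ν + Pi.single v j + Pi.single v 1) := by
  refine .seq (.write (.loop (fun k s' => Agree (outputArr :: scratch) s s' ∧ ∃ j,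
    HoldsVector ends r (ν + Pi.single v j) s' ∧ (s' foundReg 0 = 1 ∧ j + k = m + 1 ∨
      s' foundReg 0 = 0 ∧ ¬ Orientable ends r (ν + Pi.single v j + Pi.single v 1))) hm ?_ ?_ ?_))
  · have ha : Agree [foundReg] s (s.set foundReg 0 1) := (Agree.refl _ s).set (by simp) _ _
    refine ⟨ha.mono (by simp), 0, ?_, .inl ⟨by simp [Expr.eval], by simp⟩⟩
    rw [Pi.single_zero, add_zero]
    exact h.of_agree ha (by simp)
  · rintro k t ⟨ha, j, hvec, hprog⟩ hpos
    obtain ⟨-, hk⟩ := hprog.resolve_right fun h => by simp [Expr.eval, h.1] at hpos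
    have hj : j ≤ m := by
      have := hvec.witness.orientable.le_card v
      simp only [Pi.add_apply, Pi.single_eq_same, Fintype.card_fin] at this
      omega
    refine (increase_runs (v := v) hn (by omega) hvec hr (by rw [ha wantReg (by simp), hv])).mono
      fun t' ⟨ha', hres⟩ => ⟨k - 1, by omega, ha.trans ha', ?_⟩
    rcases hres with ⟨hfound, hvec'⟩ | ⟨hfound, hvec', hnot⟩
    · rw [add_assoc, ← Pi.single_add] at hvec'
      exact ⟨j + 1, hvec', .inl ⟨hfound, by omega⟩⟩
    · exact ⟨j, hvec', .inr ⟨hfound, hnot⟩⟩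
  · rintro k t ⟨ha, j, hvec, hprog⟩ hpos
    exact ⟨ha, j, hvec, (hprog.resolve_left fun h => by simp [Expr.eval, h.1] at hpos).2⟩

/-- The selection of a vertex with maximal positive entry of `g` among the vertices below `k`; the
store holds `-1` if there is none. -/
structure Selected (g : Fin n → ℤ) (k : ℕ) (s : Store) : Prop where
  le : ∀ u : Fin n, (u : ℕ) < k → g u ≤ s selectedWeightReg 0
  attained : s selectedReg 0 = -1 ∧ s selectedWeightReg 0 = 0 ∨
    ∃ v : Fin n, s selectedReg 0 = ((v : ℕ) : ℤ) ∧ s selectedWeightReg 0 = g v ∧ 0 < g v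

theorem selectMax_runs (hn : n ≤ N) (hcount : s vertexCountReg 0 = n) {g : Fin n → ℤ}
    (hg : Holds (s vectorArr) g) :
    Runs N selectMax s fun s' => Agree [arcReg, selectedReg, selectedWeightReg] s s' ∧
      (s' selectedReg 0 = -1 ∧ (∀ u, g u ≤ 0) ∨
        ∃ v : Fin n, s' selectedReg 0 = ((v : ℕ) : ℤ) ∧ 0 < g v ∧ ∀ u, g u ≤ g v) := by
  refine .seq (.write (.seq (.write (.for (fun k t =>
    Agree [arcReg, selectedReg, selectedWeightReg] s t ∧ Selected g k t) hn ?_ ?_ ?_ ?_))))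
  · rintro k t ⟨ha, -⟩
    simp [Expr.eval, ha vertexCountReg (by simp), hcount]
  · exact ⟨(((Agree.refl _ s).set (by simp) _ _).set (by simp) _ _).set (by simp) _ _,
      by simp, .inl (by simp [Expr.eval])⟩
  · rintro k hk t ⟨ha, hsel⟩ ht
    have hgk : t vectorArr k = g ⟨k, hk⟩ := by
      rw [ha vectorArr (by simp)]
      exact hg ⟨k, hk⟩
    have hle {x : ℤ} (hx : t selectedWeightReg 0 ≤ x) (hkx : g ⟨k, hk⟩ ≤ x) (u : Fin n)
        (hu : (u : ℕ) < k + 1) : g u ≤ x := by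
      obtain hu | rfl := Nat.lt_succ_iff_lt_or_eq.1 hu
      exacts [(hsel.le u hu).trans hx, hkx]
    refine .ite (fun hlt => .seq (.write (.write ⟨by simpa using ht,
      ((ha.set (by simp) _ _).set (by simp) _ _).set (by simp) _ _, ?_, .inr ⟨⟨k, hk⟩, ?_⟩⟩)))
      fun hlt => .skip ⟨ht, ha.set (by simp) _ _, ?_, by simpa using hsel.attained⟩ <;>
      simp only [Expr.eval, ht, hgk] at hlt
    · simpa [Expr.eval, ht, hgk] using hle (by omega) le_rfl
    · have hpos : 0 < g ⟨k, hk⟩ := by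
        rcases hsel.attained with ⟨-, h⟩ | ⟨v, -, h, hv⟩ <;> omega
      simpa [Expr.eval, ht, hgk] using hpos
    · simpa using hle le_rfl (by omega)
  · rintro t ⟨ha, hle, ⟨hsel, hw⟩ | ⟨v, hsel, hw, hv⟩⟩ <;> rw [hw] at hle
    exacts [⟨ha, .inl ⟨hsel, fun u => hle u u.2⟩⟩, ⟨ha, .inr ⟨v, hsel, hv, fun u => hle u u.2⟩⟩]

variable {w : Fin n → ℤ} {A : Finset (Fin n)}

/-- The state of the greedy algorithm after the vertices in `A` have been processed. -/
structure GreedyState (ends : Fin m → Fin n × Fin n) (r : Fin n) (w : Fin n → ℤ) (s : Store)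
    (A : Finset (Fin n)) (ν : Fin n → ℕ) : Prop where
  vector : HoldsVector ends r ν s
  weights : Holds (s vectorArr) fun v => if v ∈ A then 0 else w v
  pos : ∀ a ∈ A, 0 < w a
  le : ∀ a ∈ A, ∀ b ∉ A, w b ≤ w a
  zero : ∀ v ∉ A, ν v = 0
  saturated : ∀ v ∈ A, ¬ Orientable ends r ({u | w v ≤ w u}.indicator ν + Pi.single v 1)

theorem GreedyState.of_agree (h : GreedyState ends r w s A ν) {L : List ℕ} (ha : Agree L s s')
    (hL : ∀ a ∈ L, a ∉ [vectorArr, outputArr, vertexCountReg, edgeCountReg, reorientReg,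
      rootedTailArr, rootedHeadArr, slackArr]) : GreedyState ends r w s' A ν := by
  refine ⟨h.vector.of_agree ha fun a haL h' => hL a haL (List.mem_cons_of_mem _ h'), ?_, h.pos,
    h.le, h.zero, h.saturated⟩
  rw [ha vectorArr fun h' => hL _ h' (by simp)]
  exact h.weights

theorem GreedyState.insert (h : GreedyState ends r w s A ν) (hvA : v ∉ A) (hv : 0 < w v)
    (hmax : ∀ u ∉ A, w u ≤ w v) {j : ℕ} (hvec : HoldsVector ends r (ν + Pi.single v j) s')
    (hsat : ¬ Orientable ends r (ν + Pi.single v j + Pi.single v 1))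
    (hweights : Holds (s' vectorArr) fun u => if u ∈ insert v A then 0 else w u) :
    GreedyState ends r w s' (insert v A) (ν + Pi.single v j) := by
  refine ⟨hvec, hweights, Finset.forall_mem_insert _ _ _ |>.2 ⟨hv, h.pos⟩,
    Finset.forall_mem_insert _ _ _ |>.2 ⟨fun u hu => ?_, fun a ha u hu => ?_⟩, fun u hu => ?_,
    Finset.forall_mem_insert _ _ _ |>.2 ⟨fun hor => hsat ?_, fun a ha hor => h.saturated a ha ?_⟩⟩
  · exact hmax u fun huA => hu (Finset.mem_insert_of_mem huA)
  · exact h.le a ha u fun huA => hu (Finset.mem_insert_of_mem huA)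
  · rw [Finset.mem_insert, not_or] at hu
    simp [h.zero u hu.2, hu.1]
  · refine hor.mono (add_le_add_left (fun u => ?_) _)
    by_cases hu : w v ≤ w u
    · simp [hu]
    · have huA : u ∉ A := fun huA => hu (h.le u huA v hvA)
      have huv : u ≠ v := fun huv => hu (by rw [huv])
      simp [h.zero u huA, huv]
  · exact hor.mono (add_le_add_left
      (Set.indicator_mono (le_add_of_nonneg_right zero_le)) _)

theorem process_runs (hn : n ≤ N) (hm : m + 1 ≤ N) (h : GreedyState ends r w s A ν)
    (hr : (r : ℕ) = 0) (hvA : v ∉ A) (hv : 0 < w v) (hmax : ∀ u ∉ A, w u ≤ w v)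
    (hsel : s selectedReg 0 = ((v : ℕ) : ℤ)) :
    Runs N process s fun s' => Agree (outputArr :: wantReg :: vectorArr :: scratch) s s' ∧
      ∃ ν', GreedyState ends r w s' (insert v A) ν' := by
  refine .seq (.write (.seq (.write ?_)))
  obtain ⟨t, ht⟩ : ∃ t, t = (s.set vectorArr v 0).set wantReg 0 v := ⟨_, rfl⟩
  have ha : Agree [wantReg, vectorArr] s t :=
    ht ▸ ((Agree.refl _ s).set (by simp) _ _).set (by simp) _ _
  simp only [Expr.eval, hsel, Store.set_ne _ _ _ (show selectedReg ≠ vectorArr by simp), ← ht]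
  refine (saturate_runs (v := v) hn hm (h.vector.of_agree ha (by simp)) hr
    (by simp [ht])).mono fun t' ⟨ha', j, hvec, hsat⟩ =>
      ⟨(ha.mono (by simp)).trans (ha'.mono (by simp)), _,
        h.insert hvA hv hmax hvec hsat ?_⟩
  rw [ha' vectorArr (by simp)]
  convert h.weights.update v 0 using 1
  · simp [ht]
  · funext u
    by_cases hu : u = v
    · simp [hu]
    · simp [hu]

theorem GreedyState.isGreedy (h : GreedyState ends r w s A ν) (hA : ∀ v ∉ A, w v ≤ 0) :
    IsGreedy {μ | Orientable ends r μ} w ν where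
  mem := h.vector.witness.orientable
  eq_zero v hv := h.zero v fun hvA => (h.pos v hvA).not_ge hv
  saturated v hv := h.saturated v (by_contra fun hvA => hv.not_ge (hA v hvA))

/-- The progress of the greedy algorithm: at least `k` vertices have been processed, unless all
vertices with positive weight have been. -/
def GreedyProgress (ends : Fin m → Fin n × Fin n) (r : Fin n) (w : Fin n → ℤ) (k : ℕ) (s : Store) :
    Prop :=
  ∃ A ν, GreedyState ends r w s A ν ∧ (k ≤ A.card ∨ ∀ v ∉ A, w v ≤ 0)

theorem GreedyProgress.set_step {k : ℕ} (h : GreedyProgress ends r w k s) (x : ℤ) :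
    GreedyProgress ends r w k (s.set stepReg 0 x) := by
  obtain ⟨A, ν, h, hk⟩ := h
  exact ⟨A, ν, h.of_agree ((Agree.refl [stepReg] s).set (by simp) _ _) (by simp), hk⟩

theorem GreedyProgress.vertices {k : ℕ} (h : GreedyProgress ends r w k s) :
    s vertexCountReg 0 = n := by
  obtain ⟨A, ν, ⟨⟨⟨D, sl, h⟩, -⟩, -⟩, -⟩ := h
  exact h.vertices

theorem GreedyProgress.exists_isGreedy (h : GreedyProgress ends r w n s) :
    ∃ ν : Fin n → ℕ, Holds (s outputArr) (fun v => (ν v : ℤ)) ∧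
      IsGreedy {μ | Orientable ends r μ} w ν := by
  obtain ⟨A, ν, h, hA⟩ := h
  refine ⟨ν, h.vector.output, h.isGreedy (hA.elim (fun hcard v hv => ?_) id)⟩
  have huniv : A = Finset.univ := Finset.eq_univ_of_card A <| by
    rw [Fintype.card_fin]
    exact le_antisymm (by simpa using A.card_le_univ) hcard
  simp [huniv] at hv

theorem processMax_runs (hn : n ≤ N) (hm : m + 1 ≤ N) {k : ℕ} (h : GreedyProgress ends r w k s)
    (hr : (r : ℕ) = 0) :
    Runs N processMax s fun s' => s' stepReg = s stepReg ∧ GreedyProgress ends r w (k + 1) s' := by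
  have hcount := h.vertices
  obtain ⟨A, ν, h, hprog⟩ := h
  refine .seq ((selectMax_runs hn hcount h.weights).mono ?_)
  rintro t ⟨ha, ⟨hsel, hall⟩ | ⟨v, hsel, hpos, hmax⟩⟩
  · refine .ite (fun h => absurd h (by simp [Expr.eval, hsel])) fun _ => .skip
      ⟨ha stepReg (by simp), A, ν, h.of_agree ha (by simp), .inr fun v hv => ?_⟩
    simpa [hv] using hall v
  · have hv : v ∉ A := fun hv => by simp [hv] at hpos
    rw [if_neg hv] at hpos hmax
    refine .ite (fun _ => ?_) fun h => absurd h (by simp [Expr.eval, hsel])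
    refine (process_runs hn hm (h.of_agree ha (by simp)) hr hv hpos
      (fun u hu => by simpa [hu] using hmax u) hsel).mono fun t' ⟨ha', ν', h'⟩ =>
        ⟨by rw [ha' stepReg (by simp), ha stepReg (by simp)], _, ν', h', .inl ?_⟩
    rw [Finset.card_insert_of_notMem hv]
    exact Nat.succ_le_succ (hprog.resolve_right fun hA => hpos.not_ge (hA v hv))

theorem optimize_runs {I : EdgeList} {w : Fin I.n → ℤ} (hconn : Connected I.toGraph) {r : Fin I.n}
    (hr : (r : ℕ) = 0) (hn : I.n ≤ N) (hm : I.m + 1 ≤ N) (h : HoldsInstance (s inputArr) I w)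
    (h0 : s outputArr = 0) :
    Runs N optimize s fun s' => ∃ ν : Fin I.n → ℕ, Holds (s' outputArr) (fun v => (ν v : ℤ)) ∧
      IsGreedy {μ | Orientable I.ends r μ} w ν := by
  refine .seq ((prepare_runs hconn hr hn (by omega) h).mono fun s₁ ⟨ha₁, hwit⟩ => .seq ?_)
  obtain ⟨D, sl, hst⟩ := id hwit
  refine (readVector_runs (w := w) hn hst.vertices hst.edges (by rwa [ha₁ inputArr (by simp)])).mono
    fun s₂ ⟨ha₂, hw⟩ => .for (fun k t => GreedyProgress I.ends r w k t) hn
      (fun k t h => by simpa [Expr.eval] using h.vertices) (GreedyProgress.set_step ?_ _)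
      (fun k _ t h ht => (processMax_runs hn hm h hr).mono fun t' ⟨hstep, h'⟩ =>
        ⟨by rw [hstep, ht], h'.set_step _⟩) fun t => GreedyProgress.exists_isGreedy
  refine ⟨∅, 0, ⟨⟨hwit.of_agree ha₂ (by simp), fun v => ?_⟩, by simpa using hw, by simp, by simp,
    by simp, by simp⟩, .inl (Nat.zero_le _)⟩
  simp [ha₂ outputArr, ha₁ outputArr, h0]

end Optimize

/-! ## Splitting vertices -/

section Arborescence

open Finset

variable {V E : Type*}

/-- The arcs in `T` form an arborescence that spans all vertices and has root `r`. -/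
structure IsArborescence [DecidableEq V] (D : E → V × V) (r : V) (T : Finset E) : Prop where
  card_le : ∀ v, card {e ∈ T | (D e).2 = v} ≤ if v = r then 0 else 1
  reaches : ∀ v, Relation.ReflTransGen (fun x y => ∃ e ∈ T, D e = (x, y)) r v

theorem SearchTree.isArborescence {n m : ℕ} {D : Fin m → Fin n × Fin n} {r : Fin n}
    {mk : Fin n → ℕ} {pr : ℤ → ℤ} (h : SearchTree D r mk pr) (hmk : ∀ v, 0 < mk v)
    (hroot : pr ((r : ℕ) : ℤ) = -1) :
    IsArborescence D r {e | pr (((D e).2 : ℕ) : ℤ) = ((e : ℕ) : ℤ)} := by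
  refine ⟨fun v => ?_, fun v => ?_⟩
  · split_ifs with hv
    · rw [Nat.le_zero, card_eq_zero, filter_filter, filter_eq_empty_iff]
      rintro e - ⟨h1, h2⟩
      rw [h2, hv] at h1
      omega
    · refine card_le_one.2 fun e he i hi => Fin.ext ?_
      simp only [mem_filter, mem_univ, true_and] at he hi
      rw [he.2] at he
      rw [hi.2] at hi
      exact_mod_cast he.1.symm.trans hi.1
  · induction hk : mk v using Nat.strong_induction_on generalizing v with
    | _ k ih =>
      by_cases hv : v = r
      · rw [hv]
      · obtain ⟨e, h1, h2, -, h3⟩ := h.parent v hv (hmk v)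
        exact (ih _ (hk ▸ h3) _ rfl).tail ⟨e, by simp [h2, h1], Prod.ext rfl h2⟩

variable {m : ℕ} [DecidableEq V] {D : Fin m → V × V} {T : Finset (Fin m)} {k : ℕ} {v : V}

/-- The arcs with head `v` and index at least `k` that do not belong to `T`. -/
def spareArcs (D : Fin m → V × V) (T : Finset (Fin m)) (k : ℕ) (v : V) : Finset (Fin m) :=
  {e | k ≤ (e : ℕ) ∧ e ∉ T ∧ (D e).2 = v}

theorem card_spareArcs_le_succ : (spareArcs D T k v).card ≤ (spareArcs D T (k + 1) v).card + 1 := by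
  have hsub : ∀ e ∈ spareArcs D T k v \ spareArcs D T (k + 1) v, (e : ℕ) = k := by
    intro e he
    simp only [spareArcs, mem_sdiff, mem_filter, mem_univ, true_and, not_and] at he
    by_contra hne
    exact he.2 (by omega) he.1.2.1 he.1.2.2
  have hone : (spareArcs D T k v \ spareArcs D T (k + 1) v).card ≤ 1 :=
    card_le_one.2 fun e he i hi => Fin.ext ((hsub e he).trans (hsub i hi).symm)
  have := le_card_sdiff (spareArcs D T (k + 1) v) (spareArcs D T k v)
  omega

theorem spareArcs_subset_succ (hk : k < m) (hv : ⟨k, hk⟩ ∈ T ∨ (D ⟨k, hk⟩).2 ≠ v) :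
    spareArcs D T k v ⊆ spareArcs D T (k + 1) v := by
  intro e he
  simp only [spareArcs, mem_filter, mem_univ, true_and] at he ⊢
  refine ⟨Nat.lt_of_le_of_ne he.1 fun hke => ?_, he.2⟩
  subst hke
  exact hv.elim he.2.1 fun h => h he.2.2

theorem IsArborescence.le_card_spareArcs {r : V} (h : IsArborescence D r T) {μ : V → ℕ}
    (hμ : ∀ v, μ v + (if v = r then 0 else 1) ≤ indeg D v) (v : V) :
    μ v ≤ (spareArcs D T 0 v).card := by
  have hsplit : indeg D v = card {e ∈ T | (D e).2 = v} + (spareArcs D T 0 v).card := by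
    rw [indeg, ← card_filter_add_card_filter_not (· ∈ T), filter_filter, filter_filter]
    congr 2 <;> ext e <;> simp [spareArcs, and_comm]
  have := hμ v
  have := h.card_le v
  omega

end Arborescence

section Splitting

open Finset

variable {n m : ℕ} {D : Fin m → Fin n × Fin n} {T : Finset (Fin m)} {μ : Fin n → ℕ} {k K : ℕ}
  {φ : ℕ → Fin n} {hd : Fin m → ℕ} {rem : Fin n → ℕ}

/-- The result of splitting vertices at the heads of some of the first `k` arcs, none of which is
in `T`. There are `K` vertices, the vertex `i` is a copy of `φ i`, the arc `e` enters `hd e`, and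
`rem v` further copies of `v` are wanted. -/
structure Splitting (D : Fin m → Fin n × Fin n) (T : Finset (Fin m)) (μ : Fin n → ℕ) (k K : ℕ)
    (φ : ℕ → Fin n) (hd : Fin m → ℕ) (rem : Fin n → ℕ) : Prop where
  le : n ≤ K
  le_add : K ≤ n + k
  original : ∀ v : Fin n, φ v = v
  head_lt : ∀ e, hd e < K
  head : ∀ e, φ (hd e) = (D e).2
  fixed : ∀ e : Fin m, e ∈ T ∨ k ≤ e → hd e = (D e).2
  copy : ∀ i, n ≤ i → i < K → ∃ e, hd e = i
  count : ∀ v, card {i ∈ range K | φ i = v} + rem v = μ v + 1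
  rem_le : ∀ v, rem v ≤ (spareArcs D T k v).card

theorem Splitting.initial (hμ : ∀ v, μ v ≤ (spareArcs D T 0 v).card) (hφ : ∀ v : Fin n, φ v = v) :
    Splitting D T μ 0 n φ (fun e => (D e).2) μ := by
  refine ⟨le_rfl, le_rfl, hφ, fun e => (D e).2.2, fun e => hφ _, fun _ _ => rfl,
    fun i h1 h2 => by omega, fun v => ?_, hμ⟩
  have hfiber : {i ∈ range n | φ i = v} = {(v : ℕ)} := by
    ext i
    simp only [mem_filter, mem_range, mem_singleton]
    constructor
    · rintro ⟨hi, rfl⟩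
      rw [hφ ⟨i, hi⟩]
    · rintro rfl
      exact ⟨v.2, hφ v⟩
  rw [hfiber, card_singleton, add_comm]

theorem Splitting.keep (h : Splitting D T μ k K φ hd rem) (hk : k < m)
    (hkeep : ⟨k, hk⟩ ∈ T ∨ rem (D ⟨k, hk⟩).2 = 0) : Splitting D T μ (k + 1) K φ hd rem := by
  refine { h with
    le_add := h.le_add.trans (Nat.le_succ _)
    fixed := fun e he => h.fixed e (he.imp_right Nat.le_of_succ_le)
    rem_le := fun v => ?_ }
  by_cases hv : (D ⟨k, hk⟩).2 = v ∧ rem v = 0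
  · exact hv.2.trans_le (Nat.zero_le _)
  · refine (h.rem_le v).trans (card_le_card (spareArcs_subset_succ hk ?_))
    refine hkeep.imp_right fun h0 hv' => hv ⟨hv', hv' ▸ h0⟩

theorem card_filter_update_range (φ : ℕ → Fin n) (K : ℕ) (u v : Fin n) :
    card {i ∈ range (K + 1) | Function.update φ K u i = v} =
      card {i ∈ range K | φ i = v} + if u = v then 1 else 0 := by
  have hrange : {i ∈ range K | Function.update φ K u i = v} = {i ∈ range K | φ i = v} :=
    filter_congr fun i hi => by rw [Function.update_of_ne (mem_range.1 hi).ne]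
  rw [range_add_one, filter_insert, Function.update_self, hrange]
  split_ifs
  · exact card_insert_of_notMem (by simp)
  · rfl

theorem Splitting.split (h : Splitting D T μ k K φ hd rem) (hk : k < m) (hT : ⟨k, hk⟩ ∉ T)
    (hrem : 0 < rem (D ⟨k, hk⟩).2) :
    Splitting D T μ (k + 1) (K + 1) (Function.update φ K (D ⟨k, hk⟩).2)
      (Function.update hd ⟨k, hk⟩ K)
      (Function.update rem (D ⟨k, hk⟩).2 (rem (D ⟨k, hk⟩).2 - 1)) where
  le := h.le.trans (Nat.le_succ K)
  le_add := Nat.succ_le_succ h.le_add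
  original v := by rw [Function.update_of_ne (v.2.trans_le h.le).ne, h.original]
  head_lt e := by
    by_cases he : e = ⟨k, hk⟩
    · simp [he]
    · rw [Function.update_of_ne he]
      exact (h.head_lt e).trans (Nat.lt_succ_self K)
  head e := by
    by_cases he : e = ⟨k, hk⟩
    · simp [he]
    · rw [Function.update_of_ne he, Function.update_of_ne (h.head_lt e).ne, h.head]
  fixed e he := by
    have hne : e ≠ ⟨k, hk⟩ := by
      rintro rfl
      exact he.elim hT (Nat.not_succ_le_self k)
    rw [Function.update_of_ne hne, h.fixed e (he.imp_right Nat.le_of_succ_le)]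
  copy i h1 h2 := by
    by_cases hi : i = K
    · exact ⟨⟨k, hk⟩, by simp [hi]⟩
    · obtain ⟨e, he⟩ := h.copy i h1 (by omega)
      refine ⟨e, ?_⟩
      rw [Function.update_of_ne ?_, he]
      rintro rfl
      have := h.fixed ⟨k, hk⟩ (Or.inr le_rfl)
      omega
  count v := by
    have hcount := h.count v
    rw [card_filter_update_range]
    by_cases hv : (D ⟨k, hk⟩).2 = v
    · subst hv
      rw [Function.update_self, if_pos rfl]
      omega
    · rwa [Function.update_of_ne (Ne.symm hv), if_neg hv]
  rem_le v := by
    by_cases hv : (D ⟨k, hk⟩).2 = v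
    · subst hv
      rw [Function.update_self]
      exact Nat.sub_le_iff_le_add.2 ((h.rem_le _).trans card_spareArcs_le_succ)
    · rw [Function.update_of_ne (Ne.symm hv)]
      exact (h.rem_le v).trans (card_le_card (spareArcs_subset_succ hk (Or.inr hv)))

theorem Splitting.rem_eq_zero (h : Splitting D T μ m K φ hd rem) (v : Fin n) : rem v = 0 := by
  have hspare : spareArcs D T m v = ∅ := by
    ext e
    simp [spareArcs]
  simpa [hspare] using h.rem_le v

end Splitting

section Certificate

theorem EdgeList.reachable_of_ends {H : EdgeList} {e : Fin H.m} {x y : Fin H.n}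
    (h : H.ends e = (x, y)) : H.toGraph.toSimpleGraph.Reachable (H.vert x) (H.vert y) := by
  by_cases hxy : H.vert x = H.vert y
  · rw [hxy]
  · exact SimpleGraph.Adj.reachable ⟨hxy, e, Or.inl h⟩

theorem IsOrientation.eq_or_eq_swap_iff {V E : Type*} {ends D : E → V × V}
    (h : IsOrientation ends D) (e : E) (x y : V) :
    D e = (x, y) ∨ D e = (y, x) ↔ ends e = (x, y) ∨ ends e = (y, x) := by
  rcases h e with he | he
  · rw [he]
  · rw [he, Prod.swap_eq_iff_eq_swap, Prod.swap_eq_iff_eq_swap, or_comm]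
    rfl

variable {I : EdgeList} {D : Fin I.m → Fin I.n × Fin I.n}

theorem IsOrientation.isHomImage (hD : IsOrientation I.ends D) {K : ℕ}
    {ends' : Fin I.m → Fin K × Fin K} {φ : Fin K → Fin I.n} (hφ : Function.Surjective φ)
    (hends : ∀ e, (φ (ends' e).1, φ (ends' e).2) = D e) :
    IsHomImage I.toGraph (EdgeList.toGraph ⟨K, I.m, ends'⟩)
      (EdgeList.vec ⟨K, I.m, ends'⟩ fun w => I.vert (φ w)) := by
  let H : EdgeList := ⟨K, I.m, ends'⟩
  refine ⟨fun v => ?_, fun u v => congrArg Set.encard (Set.ext fun e => ?_)⟩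
  · obtain ⟨w, hw⟩ := hφ v.1
    exact ⟨H.vert w, congrArg I.vert hw⟩
  · have hlink : I.toGraph.IsLink e u v ↔ D e = (u.1, v.1) ∨ D e = (v.1, u.1) :=
      (hD.eq_or_eq_swap_iff e u.1 v.1).symm
    rw [Set.mem_ofPred_eq, hlink, ← hends]
    constructor
    · rintro (h | h)
      · exact ⟨H.vert (ends' e).1, H.vert (ends' e).2, Or.inl rfl,
          congrArg (I.vert ∘ Prod.fst) h, congrArg (I.vert ∘ Prod.snd) h⟩
      · exact ⟨H.vert (ends' e).2, H.vert (ends' e).1, Or.inr rfl,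
          congrArg (I.vert ∘ Prod.snd) h, congrArg (I.vert ∘ Prod.fst) h⟩
    · rintro ⟨x, y, hxy, rfl, rfl⟩
      exact hxy.imp (congrArg (Prod.map φ φ)) (congrArg (Prod.map φ φ))

theorem EdgeList.encard_preimage_vec (H : EdgeList) (φ : ℕ → Fin I.n) (v : V(I.toGraph)) :
    ((H.vec fun w => I.vert (φ w)) ⁻¹' {v}).encard =
      (((Finset.range H.n).filter fun i => φ i = v.1).card : ℕ∞) := by
  have himage : (H.vec fun w => I.vert (φ w)) ⁻¹' {v} =
      H.vert '' (Finset.univ.filter fun i : Fin H.n => φ i = v.1 : Finset (Fin H.n)) := by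
    ext w
    simp only [Finset.coe_filter, Finset.mem_univ, true_and]
    constructor
    · exact fun hw => ⟨w.1, congrArg Subtype.val hw, rfl⟩
    · rintro ⟨i, hi, rfl⟩
      exact Subtype.ext hi
  have hinj : Function.Injective H.vert := fun i j hij => congrArg Subtype.val hij
  rw [himage, hinj.encard_image, Set.encard_coe_eq_coe_finsetCard, Finset.card_filter,
    Finset.card_filter]
  exact congrArg _ (Fin.sum_univ_eq_sum_range (fun i => if φ i = v.1 then 1 else 0) H.n)

variable {r : Fin I.n} {T : Finset (Fin I.m)} {μ : Fin I.n → ℕ} {k K : ℕ} {φ : ℕ → Fin I.n}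
  {hd : Fin I.m → ℕ} {rem : Fin I.n → ℕ}

/-- The graph obtained by splitting vertices. -/
def Splitting.graph (h : Splitting D T μ k K φ hd rem) : EdgeList :=
  ⟨K, I.m, fun e => (⟨(D e).1, (D e).1.2.trans_le h.le⟩, ⟨hd e, h.head_lt e⟩)⟩

/-- The vertex of the split graph that retains the name `v`. -/
def Splitting.originalVert (h : Splitting D T μ k K φ hd rem) (v : Fin I.n) : Fin h.graph.n :=
  ⟨v, v.2.trans_le h.le⟩

theorem Splitting.reachable_originalVert (h : Splitting D T μ k K φ hd rem)
    (hT : IsArborescence D r T) (v : Fin I.n) :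
    h.graph.toGraph.toSimpleGraph.Reachable (h.graph.vert (h.originalVert r))
      (h.graph.vert (h.originalVert v)) := by
  induction hT.reaches v with
  | refl => rfl
  | tail _ hxy ih =>
    obtain ⟨e, he, hDe⟩ := hxy
    refine ih.trans (EdgeList.reachable_of_ends (H := h.graph) (e := e)
      (Prod.ext (Fin.ext ?_) (Fin.ext ?_)))
    · exact congrArg (fun a => (a.1 : ℕ)) hDe
    · exact (h.fixed e (Or.inl he)).trans (congrArg (fun a => (a.2 : ℕ)) hDe)

theorem Splitting.connected (h : Splitting D T μ k K φ hd rem) (hT : IsArborescence D r T) :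
    Connected h.graph.toGraph := by
  have hreach : ∀ w, h.graph.toGraph.toSimpleGraph.Reachable (h.graph.vert (h.originalVert r))
      (h.graph.vert w) := by
    intro w
    rcases Nat.lt_or_ge w I.n with hw | hw
    · exact h.reachable_originalVert hT ⟨w, hw⟩
    · obtain ⟨e, he⟩ := h.copy w hw w.2
      exact (h.reachable_originalVert hT (D e).1).trans
        (EdgeList.reachable_of_ends (H := h.graph) (e := e) (Prod.ext rfl (Fin.ext he)))
  have : Nonempty V(h.graph.toGraph) := ⟨h.graph.vert (h.originalVert r)⟩
  exact ⟨fun x y => (hreach x.1).symm.trans (hreach y.1)⟩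

theorem Splitting.certifies (h : Splitting D T μ I.m K φ hd rem) (hD : IsOrientation I.ends D)
    (hT : IsArborescence D r T) :
    Certifies I.toGraph (I.vec fun v => μ v + 1) h.graph.toGraph
      (h.graph.vec fun w => I.vert (φ w)) := by
  refine ⟨h.connected hT, hD.isHomImage (φ := fun w : Fin K => φ w)
    (fun v => ⟨h.originalVert v, h.original v⟩)
    (fun e => Prod.ext (h.original _) (h.head e)), fun v => ?_⟩
  have hcount := h.count v.1
  rw [h.rem_eq_zero, add_zero] at hcount
  rw [EdgeList.encard_preimage_vec]
  exact congrArg _ hcount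

end Certificate

/-! ## Constructing a certificate -/

/-- Increase the entry of the vertex `vertexReg` by its entry in `vectorArr`. -/
def addCopies : Program :=
  .for copiesReg (.read vectorArr (.cell vertexReg))
    (.write wantReg (.const 0) (.cell vertexReg) ;; augment)

/-- Find an orientation for the vector in `vectorArr`. -/
def orient : Program :=
  .for vertexReg (.cell vertexCountReg) addCopies

/-- Split the head of the arc `arcReg`: the arc gets a new vertex as its head. -/
def splitHead : Program :=
  .write labelArr (.cell copiesReg) (.read headArr (.cell arcReg)) ;;
    .write vectorArr (.read headArr (.cell arcReg))
      (.sub (.read vectorArr (.read headArr (.cell arcReg))) (.const 1)) ;;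
    .write headArr (.cell arcReg) (.cell copiesReg) ;;
    .write copiesReg (.const 0) (.add (.cell copiesReg) (.const 1))

/-- Split the head of the arc `arcReg` if further copies of it are wanted, unless `arcReg` is its
parent arc. -/
def splitArc : Program :=
  .ite (.read vectorArr (.read headArr (.cell arcReg)))
    (.ite (.sub (.read parentArr (.read headArr (.cell arcReg))) (.cell arcReg)) splitHead
      (.ite (.sub (.cell arcReg) (.read parentArr (.read headArr (.cell arcReg)))) splitHead .skip))
    .skip

/-- Split the vertices according to the vector in `vectorArr`. -/
def splitVertices : Program :=
  .write copiesReg (.const 0) (.cell vertexCountReg) ;;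
    fillArray labelArr (.cell vertexCountReg) (.cell arcReg) (.cell arcReg) ;;
    .for arcReg (.cell edgeCountReg) splitArc

/-- Find an arborescence with root `0` and store the parent arcs of the other vertices. -/
def growArborescence : Program :=
  searchRooted (.const 0) ;; .write parentArr (.const 0) (.const (-1))

/-- Output a certificate for a feasible split vector. -/
def construct : Program :=
  prepare ;; readVector ;; orient ;; growArborescence ;; splitVertices ;; writeInstance

section Orient

variable {n m N : ℕ} {s : Store} {ends : Fin m → Fin n × Fin n} {r v : Fin n} {μ ν : Fin n → ℕ}

theorem addCopies_runs (hn : n ≤ N) (hm : m ≤ N) (hr : (r : ℕ) = 0) (h : HoldsWitness ends r ν s)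
    (hv : s vertexReg 0 = ((v : ℕ) : ℤ)) {j : ℕ} (hj : s vectorArr ((v : ℕ) : ℤ) = j)
    (hor : Orientable ends r (ν + Pi.single v j)) :
    Runs N addCopies s fun s' => Agree (wantReg :: copiesReg :: scratch) s s' ∧
      HoldsWitness ends r (ν + Pi.single v j) s' := by
  have hjm : j ≤ m := by
    have := hor.le_card v
    simp only [Pi.add_apply, Pi.single_eq_same, Fintype.card_fin] at this
    omega
  refine .for (fun l t => Agree (wantReg :: copiesReg :: scratch) s t ∧
    HoldsWitness ends r (ν + Pi.single v l) t) (hjm.trans hm) ?_ ?_ ?_ fun _ => id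
  · rintro l t ⟨ha, -⟩
    simp [Expr.eval, ha vectorArr, ha vertexReg, hv, hj]
  · refine ⟨(Agree.refl _ s).set (by simp) _ _, ?_⟩
    rw [Pi.single_zero, add_zero]
    exact h.of_agree ((Agree.refl [copiesReg] s).set (by simp) _ _) (by simp)
  · rintro l hl t ⟨ha, hwit⟩ ht
    have ha₁ := (Agree.refl [wantReg] t).set (a := wantReg) (by simp) ((Expr.const 0).eval t)
      ((Expr.cell vertexReg).eval t)
    refine .seq (.write ((augment_runs (v := v) hn hm (hwit.of_agree ha₁ (by simp)) hr
      (by simp [Expr.eval, ha vertexReg, hv])).mono fun t' ⟨ha₂, hres⟩ => ?_))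
    rw [add_assoc, ← Pi.single_add] at hres
    refine ⟨by rw [ha₂ copiesReg (by simp), ha₁ copiesReg (by simp), ht],
      ((ha.trans (ha₁.mono (by simp))).trans (ha₂.mono (by simp))).set (by simp) _ _, ?_⟩
    rcases hres with ⟨-, hwit'⟩ | ⟨-, -, hnot⟩
    · exact hwit'.of_agree ((Agree.refl [copiesReg] t').set (by simp) _ _) (by simp)
    · exact absurd (hor.mono (add_le_add_right (Pi.single_mono v hl) ν)) hnot

theorem orient_runs (hn : n ≤ N) (hm : m ≤ N) (hr : (r : ℕ) = 0) (h : HoldsWitness ends r 0 s)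
    (hμ : Orientable ends r μ) (hvector : Holds (s vectorArr) fun v => (μ v : ℤ)) :
    Runs N orient s fun s' => Agree (wantReg :: copiesReg :: vertexReg :: scratch) s s' ∧
      HoldsWitness ends r μ s' := by
  refine .for (fun k t => Agree (wantReg :: copiesReg :: vertexReg :: scratch) s t ∧
    HoldsWitness ends r (fun v : Fin n => if (v : ℕ) < k then μ v else 0) t) hn ?_ ?_ ?_ ?_
  · rintro k t ⟨-, D, sl, hst⟩
    exact hst.vertices
  · refine ⟨(Agree.refl _ s).set (by simp) _ _, ?_⟩
    simp only [Nat.not_lt_zero, if_false]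
    exact h.of_agree ((Agree.refl [vertexReg] s).set (by simp) _ _) (by simp)
  · rintro k hk t ⟨ha, hwit⟩ ht
    have hsucc : (fun v : Fin n => if (v : ℕ) < k then μ v else 0) + Pi.single ⟨k, hk⟩ (μ ⟨k, hk⟩) =
        fun v : Fin n => if (v : ℕ) < k + 1 then μ v else 0 := by
      funext v
      rcases lt_trichotomy (v : ℕ) k with hv | rfl | hv
      · simp [Fin.ext_iff, hv, hv.ne, hv.trans (Nat.lt_succ_self k)]
      · simp
      · simp [Fin.ext_iff, hv.ne', hv.not_gt, hv.not_ge]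
    refine (addCopies_runs (v := ⟨k, hk⟩) (j := μ ⟨k, hk⟩) hn hm hr hwit ht ?_ ?_).mono
      fun t' ⟨ha', hwit'⟩ => ⟨by rw [ha' vertexReg (by simp), ht],
        (ha.trans (ha'.mono (by simp))).set (by simp) _ _, ?_⟩
    · rw [ha vectorArr (by simp)]
      exact hvector ⟨k, hk⟩
    · rw [hsucc]
      exact hμ.mono fun v => ite_le_sup _ _ _ |>.trans (by simp)
    · rw [← hsucc]
      exact hwit'.of_agree ((Agree.refl [vertexReg] t').set (by simp) _ _) (by simp)
  · rintro t ⟨ha, hwit⟩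
    exact ⟨ha, by simpa using hwit⟩

end Orient

section Split

variable {n m N : ℕ} {s s₀ : Store} {D : Fin m → Fin n × Fin n} {r : Fin n} {μ : Fin n → ℕ}
  {T : Finset (Fin m)} {k K : ℕ} {φ : ℕ → Fin n} {hd : Fin m → ℕ} {rem : Fin n → ℕ}

theorem growArborescence_runs {ends : Fin m → Fin n × Fin n} {sl : Fin n → ℕ} (hn : n ≤ N)
    (hm : m ≤ N) (hr : (r : ℕ) = 0) (h : AugState ends r s μ D sl) :
    Runs N growArborescence s fun s' =>
      Agree [tailArr, headArr, markArr, parentArr, startReg, roundReg, arcReg, tempReg] s s' ∧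
        HoldsArcs (s' tailArr) (s' headArr) D ∧
        ∃ T, IsArborescence D r T ∧
          ∀ e, e ∈ T ↔ s' parentArr (((D e).2 : ℕ) : ℤ) = ((e : ℕ) : ℤ) := by
  refine .seq ((searchRooted_runs (src := r) hn hm h fun t _ => by simp [Expr.eval, hr]).mono
    fun t ⟨ha, mk, hst, hreach⟩ => ?_)
  have htree : SearchTree D r mk (Function.update (t parentArr) 0 (-1)) := by
    refine ⟨hst.tree.root, hst.tree.le_card, fun v hv hpos => ?_⟩
    obtain ⟨e, hparent, he⟩ := hst.tree.parent v hv hpos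
    have hv0 : (v : ℕ) ≠ 0 := fun h => hv (Fin.ext (h.trans hr.symm))
    exact ⟨e, by simpa [hv0] using hparent, he⟩
  exact .write ⟨ha.set (by simp) _ _, by simpa using hst.arcs, _,
    htree.isArborescence (fun v => (hreach v).2 (h.rootConnected v)) (by simp [hr]),
    fun e => by simp [Expr.eval]⟩

/-- The store holds the result of splitting heads of the first `k` arcs, starting from `s₀`. -/
structure SplitState (s₀ : Store) (D : Fin m → Fin n × Fin n) (T : Finset (Fin m)) (μ : Fin n → ℕ)
    (k K : ℕ) (φ : ℕ → Fin n) (hd : Fin m → ℕ) (rem : Fin n → ℕ) (s : Store) : Prop where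
  splitting : Splitting D T μ k K φ hd rem
  agree : Agree [labelArr, vectorArr, headArr, copiesReg, arcReg] s₀ s
  copies : s copiesReg 0 = K
  wanted : Holds (s vectorArr) fun v => (rem v : ℤ)
  heads : Holds (s headArr) fun e => (hd e : ℤ)
  labels : Holds (s labelArr) fun i : Fin K => ((φ i : ℕ) : ℤ)

theorem SplitState.set_arc (h : SplitState s₀ D T μ k K φ hd rem s) (x : ℤ) :
    SplitState s₀ D T μ k K φ hd rem (s.set arcReg 0 x) where
  splitting := h.splitting
  agree := h.agree.set (by simp) _ _
  copies := by simpa using h.copies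
  wanted := by simpa using h.wanted
  heads := by simpa using h.heads
  labels := by simpa using h.labels

theorem SplitState.headArr_eq (h : SplitState s₀ D T μ k K φ hd rem s) (hk : k < m) :
    s headArr k = (((D ⟨k, hk⟩).2 : ℕ) : ℤ) := by
  rw [← h.splitting.fixed ⟨k, hk⟩ (Or.inr le_rfl)]
  exact h.heads ⟨k, hk⟩

theorem splitHead_runs (h : SplitState s₀ D T μ k K φ hd rem s) (hk : k < m)
    (hs : s arcReg 0 = k) (hT : ⟨k, hk⟩ ∉ T) (hrem : 0 < rem (D ⟨k, hk⟩).2) :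
    Runs N splitHead s fun s' => s' arcReg 0 = k ∧
      ∃ K φ hd rem, SplitState s₀ D T μ (k + 1) K φ hd rem s' := by
  have hhead := h.headArr_eq hk
  refine .seq (.write (.seq (.write (.seq (.write (.write ⟨by simpa using hs, _, _, _, _,
    h.splitting.split hk hT hrem, (((h.agree.set (by simp) _ _).set (by simp) _ _).set
      (by simp) _ _).set (by simp) _ _, ?_, ?_, ?_, fun i => ?_⟩))))))
  · simp [Expr.eval, h.copies]
  · convert h.wanted.natCast_update (D ⟨k, hk⟩).2 (rem (D ⟨k, hk⟩).2 - 1) using 1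
    simp [Expr.eval, hs, hhead, h.wanted (D ⟨k, hk⟩).2, Nat.cast_sub hrem]
  · convert h.heads.natCast_update ⟨k, hk⟩ K using 1
    simp [Expr.eval, hs, h.copies]
  · simp only [Expr.eval, Store.set_apply, hs, hhead, h.copies]
    by_cases hi : (i : ℕ) = K
    · simp [hi]
    · have hiK : (i : ℕ) < K := by omega
      simpa [hi] using h.labels ⟨i, hiK⟩

theorem splitArc_runs (h : SplitState s₀ D T μ k K φ hd rem s) (hk : k < m)
    (hs : s arcReg 0 = k)
    (hT : ∀ e, e ∈ T ↔ s₀ parentArr (((D e).2 : ℕ) : ℤ) = ((e : ℕ) : ℤ)) :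
    Runs N splitArc s fun s' => s' arcReg 0 = k ∧
      ∃ K φ hd rem, SplitState s₀ D T μ (k + 1) K φ hd rem s' := by
  have hkeep (hkeep : ⟨k, hk⟩ ∈ T ∨ rem (D ⟨k, hk⟩).2 = 0) :
      Runs N .skip s fun s' => s' arcReg 0 = k ∧
        ∃ K φ hd rem, SplitState s₀ D T μ (k + 1) K φ hd rem s' :=
    .skip ⟨hs, K, φ, hd, rem, { h with splitting := h.splitting.keep hk hkeep }⟩
  have hTk : ⟨k, hk⟩ ∈ T ↔ s₀ parentArr (((D ⟨k, hk⟩).2 : ℕ) : ℤ) = k := hT ⟨k, hk⟩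
  have hhead := h.headArr_eq hk
  have heval : (Expr.read vectorArr (.read headArr (.cell arcReg))).eval s = rem (D ⟨k, hk⟩).2 ∧
      (Expr.read parentArr (.read headArr (.cell arcReg))).eval s =
        s₀ parentArr (((D ⟨k, hk⟩).2 : ℕ) : ℤ) ∧ (Expr.cell arcReg).eval s = k := by
    simp only [Expr.eval, hs, hhead, h.agree parentArr (by simp), h.wanted _, and_self]
  obtain ⟨hwanted, hparent, harc⟩ := heval
  refine .ite (fun hrem => .ite (fun hlt => ?_) fun hle => .ite (fun hlt => ?_) fun hge => ?_)
    fun hrem => ?_ <;> rw [hwanted] at hrem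
  · rw [Expr.eval, hparent, harc] at hlt
    exact splitHead_runs h hk hs (by rw [hTk]; omega) (by omega)
  · rw [Expr.eval, hparent, harc] at hlt
    exact splitHead_runs h hk hs (by rw [hTk]; omega) (by omega)
  · rw [Expr.eval, hparent, harc] at hle hge
    exact hkeep (.inl (by rw [hTk]; omega))
  · exact hkeep (.inr (by omega))

theorem splitVertices_runs (hn : n ≤ N) (hm : m ≤ N) (hcountV : s vertexCountReg 0 = n)
    (hcountE : s edgeCountReg 0 = m) (hheads : Holds (s headArr) fun e => (((D e).2 : ℕ) : ℤ))
    (hvector : Holds (s vectorArr) fun v => (μ v : ℤ))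
    (hT : ∀ e, e ∈ T ↔ s parentArr (((D e).2 : ℕ) : ℤ) = ((e : ℕ) : ℤ)) (r : Fin n)
    (hμ : ∀ v, μ v ≤ (spareArcs D T 0 v).card) :
    Runs N splitVertices s fun s' => ∃ K φ hd rem, SplitState s D T μ m K φ hd rem s' := by
  refine .seq (.write (.seq ((fillArray_runs (f := fun v : Fin n => ((v : ℕ) : ℤ)) hn (by simp)
    (fun t ha => by simp [Expr.eval, ha vertexCountReg, hcountV]) (natCast_val_injective n)
    fun _ _ _ hj => ⟨by exact hj, by exact hj⟩).mono fun t ⟨ha, hlabels⟩ => ?_)))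
  refine .for (fun k t => ∃ K φ hd rem, SplitState s D T μ k K φ hd rem t) hm ?_ ?_ ?_
    fun _ => id
  · rintro k t ⟨K, φ, hd, rem, h⟩
    simp [Expr.eval, h.agree edgeCountReg, hcountE]
  · let φ (i : ℕ) : Fin n := if hi : i < n then ⟨i, hi⟩ else r
    have hφ (v : Fin n) : φ v = v := dif_pos v.2
    refine ⟨n, φ, _, μ, SplitState.set_arc ⟨.initial hμ hφ, ?_, ?_, ?_, ?_, fun i => ?_⟩ 0⟩
    · exact ((Agree.refl _ s).set (by simp) _ _).trans (ha.mono (by simp))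
    · simp [ha copiesReg, Expr.eval, hcountV]
    · simpa [ha vectorArr] using hvector
    · simpa [ha headArr] using hheads
    · exact (hlabels i).trans (congrArg (fun v : Fin n => ((v : ℕ) : ℤ)) (hφ i).symm)
  · rintro k hk t ⟨K, φ, hd, rem, h⟩ ht
    exact (splitArc_runs h hk ht hT).mono fun t' ⟨ht', K, φ, hd, rem, h'⟩ =>
      ⟨ht', K, φ, hd, rem, h'.set_arc _⟩

end Split

theorem construct_runs {I : EdgeList} {μ : Fin I.n → ℕ} {N : ℕ} {s : Store}
    (hconn : Connected I.toGraph) {r : Fin I.n} (hr : (r : ℕ) = 0) (hN : I.n + I.m ≤ N)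
    (h : HoldsInstance (s inputArr) I fun v => (μ v : ℤ)) (hμ : Orientable I.ends r μ) :
    Runs N construct s fun s' => ∃ out, HasOutput s' out ∧
      SplitInstance.IsSolution ⟨I, μ⟩ out := by
  have hn : I.n ≤ N := by omega
  have hm : I.m ≤ N := by omega
  refine .seq ((prepare_runs hconn hr hn hm h).mono fun s₁ ⟨ha₁, hwit₁⟩ => .seq ?_)
  obtain ⟨_, _, hst₁⟩ := id hwit₁
  refine (readVector_runs (w := fun v => (μ v : ℤ)) hn hst₁.vertices hst₁.edges
    (by rwa [ha₁ inputArr (by simp)])).mono fun s₂ ⟨ha₂, hvector⟩ => .seq ?_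
  refine (orient_runs hn hm hr (hwit₁.of_agree ha₂ (by simp)) hμ hvector).mono
    fun s₃ ⟨ha₃, D, sl, hst⟩ => .seq ?_
  refine (growArborescence_runs hn hm hr hst).mono
    fun s₄ ⟨ha₄, harcs, T, htree, hT⟩ => .seq ?_
  have hcountE : s₄ edgeCountReg 0 = I.m := by rw [ha₄ edgeCountReg (by simp), hst.edges]
  refine (splitVertices_runs (μ := μ) hn hm
    (by rw [ha₄ vertexCountReg (by simp), hst.vertices]) hcountE harcs.2
    (by rwa [ha₄ vectorArr (by simp), ha₃ vectorArr (by simp)]) hT r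
    (htree.le_card_spareArcs fun v => ?_)).mono fun s₅ ⟨K, φ, hd, rem, h₅⟩ => ?_
  · rw [← hst.degree v]
    exact Nat.le_add_right _ _
  · have hsplit := h₅.splitting
    exact (writeInstance_runs (I := hsplit.graph) (hsplit.le_add.trans hN) hm h₅.copies
      (by rw [h₅.agree edgeCountReg (by simp), hcountE]; rfl)
      ⟨by rw [h₅.agree tailArr (by simp)]; exact harcs.1, h₅.heads⟩ h₅.labels).mono
        fun s₆ hout => ⟨_, hout.hasOutput, hsplit.graph, fun i => φ i, rfl,
          hsplit.certifies hst.orientation htree⟩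

/-! ## The split polytope -/

section FeasibleSplit

variable {I : EdgeList} {r : Fin I.n}

theorem EdgeList.zero_lt_n (h : IsAdmissible I.toGraph) : 0 < I.n := by
  obtain ⟨v⟩ := h.connected.nonempty
  exact v.1.pos

-- Existence of witnesses follows from the correctness of the programs that compute them.
theorem EdgeList.orientable_zero (hconn : Connected I.toGraph) (hr : (r : ℕ) = 0) :
    Orientable I.ends r 0 := by
  obtain ⟨_, _, _, _, -, h⟩ := prepare_runs hconn hr (Nat.le_add_right I.n I.m)
    (Nat.le_add_left I.m I.n) (holdsInstance_inputStore I 0)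
  exact h.orientable

theorem EdgeList.isFeasibleSplit_iff (hconn : Connected I.toGraph) (hr : (r : ℕ) = 0)
    (μ : Fin I.n → ℕ) : IsFeasibleSplit I.toGraph (I.vec μ) ↔ Orientable I.ends r μ := by
  refine ⟨fun h => I.coding.orientable h r, fun h => ?_⟩
  obtain ⟨_, _, _, _, _, _, H, φ, -, hH⟩ :=
    construct_runs hconn hr le_rfl (holdsInstance_inputStore I fun v => (μ v : ℤ)) h
  exact ⟨_, _, _, _, hH⟩

theorem EdgeList.vec_mem_splitPolytope (hconn : Connected I.toGraph) (hr : (r : ℕ) = 0)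
    {ν : Fin I.n → ℕ} (hν : Orientable I.ends r ν) :
    I.vec (fun v => (ν v : ℝ)) ∈ splitPolytope I.toGraph :=
  subset_convexHull ℝ _ ⟨I.vec ν, (EdgeList.isFeasibleSplit_iff hconn hr ν).2 hν, fun _ => rfl⟩

theorem EdgeList.le_of_mem_splitPolytope {w : Fin I.n → ℝ} {c : ℝ}
    (h : ∀ μ, Orientable I.ends r μ → ∑ v, w v * (μ v : ℝ) ≤ c) {y : V(I.toGraph) → ℝ}
    (hy : y ∈ splitPolytope I.toGraph) : ∑ v, w v * y (I.vert v) ≤ c := by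
  refine convexHull_min (t := {y | ∑ v, w v * y (I.vert v) ≤ c}) ?_ ?_ hy
  · rintro y ⟨μ, hμ, hy⟩
    simp only [Set.mem_ofPred_eq, hy]
    exact h _ (I.coding.orientable hμ r)
  · refine convex_halfSpace_le ⟨fun x y => ?_, fun a x => ?_⟩ c
    · simp [mul_add, Finset.sum_add_distrib]
    · simp [Finset.mul_sum, mul_left_comm]

variable {α β : Type*} {G : Graph α β}

theorem Coding.connected (C : Coding G I) (h : Connected G) : Connected I.toGraph := by
  have : Nonempty V(I.toGraph) := by
    obtain ⟨v⟩ := h.nonempty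
    exact ⟨I.vert (C.vert.symm v)⟩
  refine ⟨fun x y => ?_⟩
  have hreach : ∀ a b : V(G), G.toSimpleGraph.Walk a b →
      I.toGraph.toSimpleGraph.Reachable (I.vert (C.vert.symm a)) (I.vert (C.vert.symm b)) := by
    intro a b p
    induction p with
    | nil => exact .refl _
    | @cons a b _ hadj _ ih =>
      obtain ⟨-, e, he⟩ := hadj
      have hlink := (C.isLink_iff (C.edge.symm ⟨e, he.edge_mem⟩) (C.vert.symm a) (C.vert.symm b)).1
        (by simpa using he)
      exact (hlink.elim EdgeList.reachable_of_ends
        fun h => (EdgeList.reachable_of_ends h).symm).trans ih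
  obtain ⟨p⟩ := h.preconnected (C.vert x.1) (C.vert y.1)
  have h := hreach _ _ p
  rwa [Equiv.symm_apply_apply, Equiv.symm_apply_apply] at h

theorem Coding.isFeasibleSplit_iff (C : Coding G I) (h : Connected G) (hr : (r : ℕ) = 0)
    (μ : V(G) → ℕ) : IsFeasibleSplit G μ ↔ Orientable I.ends r (μ ∘ C.vert) :=
  ⟨fun hμ => C.orientable hμ r, fun hμ =>
    C.isFeasibleSplit ((EdgeList.isFeasibleSplit_iff (C.connected h) hr _).2 hμ)⟩

end FeasibleSplit

theorem isPolymatroid_splitPolytope {α β : Type*} {G : Graph α β} (hG : IsAdmissible G) :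
    IsPolymatroid (splitPolytope G) ∧ integralPoints (splitPolytope G) = splitPoints G := by
  classical
  obtain ⟨I, ⟨C⟩⟩ := exists_coding hG.finite_vertexSet hG.finite_edgeSet
  have := hG.finite_vertexSet.fintype
  obtain ⟨v⟩ := hG.connected.nonempty
  let r : Fin I.n := ⟨0, (C.vert.symm v).pos⟩
  have h0 := EdgeList.orientable_zero (C.connected hG.connected) (r := r) rfl
  have hF : IsSaturable {μ : V(G) → ℕ | Orientable I.ends r (μ ∘ C.vert)} :=
    h0.isSaturable.comp_equiv C.vert
  have hpoints : splitPoints G = realPoints {μ | Orientable I.ends r (μ ∘ C.vert)} :=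
    Set.ext fun x => exists_congr fun μ =>
      and_congr_left' (C.isFeasibleSplit_iff hG.connected rfl μ)
  rw [splitPolytope, hpoints]
  exact ⟨hF.isPolymatroid, hF.integralPoints_eq⟩

theorem optimize_solves : SolvableInPolyTime OptInstance.encode
    (fun i => IsAdmissible i.graph.toGraph) OptInstance.IsSolution := by
  refine solvableInPolyTime_of_runs optimize fun ⟨I, w⟩ hI => ?_
  let r : Fin I.n := ⟨0, EdgeList.zero_lt_n hI⟩
  have hN : I.n + I.m + 2 ≤ bitLength (OptInstance.encode ⟨I, w⟩) := I.add_le_bitLength w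
  have h0 := EdgeList.orientable_zero hI.connected (r := r) rfl
  have hn : I.n ≤ bitLength (OptInstance.encode ⟨I, w⟩) := by omega
  have hm : I.m + 1 ≤ bitLength (OptInstance.encode ⟨I, w⟩) := by omega
  refine (optimize_runs hI.connected (r := r) rfl hn hm
    (holdsInstance_inputStore I w) rfl).mono fun s ⟨ν, hout, hν⟩ => ?_
  refine ⟨List.ofFn fun v => (ν v : ℤ), fun k => ?_, fun v => (ν v : ℤ), rfl, ?_, fun y hy => ?_⟩
  · simpa using hout ⟨k, by simpa using k.2⟩
  · simpa using EdgeList.vec_mem_splitPolytope hI.connected (r := r) rfl hν.mem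
  · refine EdgeList.le_of_mem_splitPolytope (r := r) (fun μ hμ => ?_) hy
    have hμ' : ∀ S, ∑ v ∈ S, (μ v : ℝ) ≤ rank {ν | Orientable I.ends r ν} S :=
      fun S => by exact_mod_cast h0.isSaturable.sum_le_rank hμ S
    simpa using hν.intCast.optimal h0.isSaturable (fun v => Nat.cast_nonneg _) hμ'

theorem construct_solves : SolvableInPolyTime SplitInstance.encode
    (fun i => IsAdmissible i.graph.toGraph ∧
      IsFeasibleSplit i.graph.toGraph (i.graph.vec i.split)) SplitInstance.IsSolution := by
  refine solvableInPolyTime_of_runs construct fun ⟨I, μ⟩ ⟨hI, hμ⟩ => ?_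
  let r : Fin I.n := ⟨0, EdgeList.zero_lt_n hI⟩
  have hN : I.n + I.m + 2 ≤ bitLength (SplitInstance.encode ⟨I, μ⟩) :=
    I.add_le_bitLength fun v => (μ v : ℤ)
  exact construct_runs hI.connected (r := r) rfl (by omega) (holdsInstance_inputStore I _)
    ((EdgeList.isFeasibleSplit_iff hI.connected rfl μ).1 hμ)

end KTrail

theorem theorem5 :
    -- `P_G` is a polymatroid, and its integral points are the feasible split vectors
    (∀ {α : Type*} {β : Type*} (G : Graph α β), KTrail.IsAdmissible G →
      KTrail.IsPolymatroid (KTrail.splitPolytope G) ∧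
      KTrail.integralPoints (KTrail.splitPolytope G) = KTrail.splitPoints G) ∧
    -- linear functions can be maximized over `P_G` in polynomial time
    KTrail.SolvableInPolyTime KTrail.OptInstance.encode
      (fun i => KTrail.IsAdmissible i.graph.toGraph) KTrail.OptInstance.IsSolution ∧
    -- for feasible split vectors, certifying `H` and `φ` can be found in polynomial time
    KTrail.SolvableInPolyTime KTrail.SplitInstance.encode
      (fun i => KTrail.IsAdmissible i.graph.toGraph ∧
        KTrail.IsFeasibleSplit i.graph.toGraph (i.graph.vec i.split))
      KTrail.SplitInstance.IsSolution := by
  exact ⟨fun G hG => KTrail.isPolymatroid_splitPolytope hG, KTrail.optimize_solves,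
    KTrail.construct_solves⟩
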